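/- **Setting.** Let $m\ge 2$, let $M$ be a compact oriented smooth $m$-manifold without boundary, and let $\mathfrak g$ be a finite-dimensional real Lie algebra with a symmetric, nondegenerate, ad-invariant bilinear form $\langle\cdot,\cdot\rangle$. Let $A_0\in\Omega^1(M;\mathfrak g)$ be a flat connection on the trivial bundle, $dA_0+\tfrac12[A_0,A_0]=0$, and write $d_A=d+[A,\cdot\,]$ and $F_A=dA+\tfrac12[A,A]$. *Fields.* Fields take values in $\Omega^\bullet(M;\mathfrak g)\otimes E$, where $E$ is an arbitrary $\mathbb Z$-graded, graded-commutative unital real algebra; the degree in $E$ is the ghost number $\mathrm{gh}$ and the form degree is denoted $\deg$. The fields $\varphi^i$ are, with their bidegrees $(\deg,\mathrm{gh})$: $c:(0,1)$; $a:(1,0)$; $B:(m-2,0)$; $\tau_k:(m-2-k,k)$ for $1\le k\le m-2$. Each field $\varphi^i$ has an antifield $\varphi_i^+$ of bidegree $(m-\deg\varphi^i,\,-1-\mathrm{gh}\,\varphi^i)$. A functional $F$ with values in a real vector space $V$ assigns to the fields and antifields with coefficients in $E$ an element of $V\otimes E$, for every $E$. *Products.* Bilinear operations extend by $b(\alpha\otimes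 e,\beta\otimes e')=b(\alpha,\beta)\otimes ee'$; this defines $[\cdot,\cdot]$ and $\langle\cdot,\cdot\rangle$ (with the wedge product of forms understood). The dot versions are $$[\![\alpha;\beta]\!]=(-1)^{\mathrm{gh}\,\alpha\,\deg\beta}[\alpha,\beta],\qquad \langle\!\langle\alpha;\beta\rangle\!\rangle=(-1)^{\mathrm{gh}\,\alpha\,\deg\beta}\langle\alpha,\beta\rangle ,$$ and, for $\varepsilon\in E$ of degree $q$, $\varepsilon\cdot\rho=(-1)^{q\deg\rho}\varepsilon\rho$. *Superfields.* Put $$\mathsf a=(-1)^{m+1}c+a+(-1)^mB^++\sum_{k=1}^{m-2}(-1)^{\frac{k(k-1)}2+m(k+1)}\tau_k^+,\qquad \mathsf B=\sum_{k=1}^{m-2}(-1)^{\frac{k(k-1)}2}\tau_k+B+(-1)^ma^++c^+,$$ $$\mathsf F_{\mathsf A}=d_{A_0}\mathsf a+\tfrac12[\![\mathsf a;\mathsf a]\!],\qquad d_{\mathsf A}\mathsf B=d_{A_0}\mathsf B+[\![\mathsf a;\mathsf B]\!],\qquad S=\int_M\langle\!\langle\mathsf B;\mathsf F_{\mathsf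 A}\rangle\!\rangle .$$ *Antibrackets.* Left and right functional derivatives with respect to a field or antifield $\psi$ are defined by $$\frac{d}{dt}\Big|_{0}F(\psi+t\rho)=\int_M\Big\langle\rho,\frac{\partial F}{\partial\psi}\Big\rangle=\int_M\Big\langle\frac{F\,\partial}{\partial\psi},\rho\Big\rangle$$ for all coefficients $E$ and all variations $\rho$ of the bidegree of $\psi$ (compatibly with extension of $E$, the left derivative being left $E$-linear in $\rho$ and possibly distributional). The derivatives with respect to $\mathsf a$ and $\mathsf B$ are defined in the same way with $\langle\!\langle\ ;\ \rangle\!\rangle$ in place of $\langle\ ,\ \rangle$, for variations of the fields and antifields that leave the other superfield fixed; the functional $\rho\mapsto\int_M\langle\!\langle\rho;\partial F/\partial\mathsf a\rangle\!\rangle$ is linear over $E$ for the dot product, with the sign $(-1)^{mq}$ for $\varepsilon\in E$ of degree $q$ passing through $\int_M$, and similarly for $\mathsf B$. For a scalar functional $F$ with smooth right derivatives and a functional $G$ set $$(F,G)=\sum_i\int_M\Big\langle\frac{F\,\partial}{\partial\varphi^i},\frac{\partial G}{\partial\varphi_i^+}\Big\rangle-(-1)^{(m+1)\deg\varphi^i}\Big\langle\frac{F\,\partial}{\partial\varphi_i^+},\frac{\partial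 G}{\partial\varphi^i}\Big\rangle,$$ $$\langle\!\langle F;G\rangle\!\rangle=\int_M\Big\langle\!\Big\langle\frac{F\,\partial}{\partial\mathsf B};\frac{\partial G}{\partial\mathsf a}\Big\rangle\!\Big\rangle-(-1)^m\Big\langle\!\Big\langle\frac{F\,\partial}{\partial\mathsf a};\frac{\partial G}{\partial\mathsf B}\Big\rangle\!\Big\rangle .$$ **Theorem 6.2** ("$S$ is a solution of the master equation for the $BF$ theory"). All functional derivatives needed below exist, and the following hold. 1. $S$ solves the master equation: $(S,S)=0$ and $\langle\!\langle S;S\rangle\!\rangle=0$. 2. If all antifields are set to zero, $S$ becomes the classical $BF$ action $\int_M\langle B,F_{A}\rangle$ with $A=A_0+a$. 3. The differential $\delta=\langle\!\langle S;\,\cdot\,\rangle\!\rangle$ satisfies $$\delta\mathsf a=(-1)^m\,\mathsf F_{\mathsf A},\qquad \delta\mathsf B=(-1)^m\,d_{\mathsf A}\mathsf B .$$ 4. The component differential $\delta_{BV}=(S,\,\cdot\,)$ is defined on every field and antifield. Let $\delta_{BV}\mathsf a$ and $\delta_{BV}\mathsf B$ be obtained by replacing each field and antifield in the formulas for $\mathsf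 a$ and $\mathsf B$ by its image under $\delta_{BV}$. Then, with $(-1)^{\deg}$ acting on forms, $$(-1)^{\deg}\delta_{BV}\mathsf a=(-1)^m\mathsf F_{\mathsf A},\qquad(-1)^{\deg}\delta_{BV}\mathsf B=(-1)^m d_{\mathsf A}\mathsf B .$$ When the antifields are zero, $\delta_{BV}$ is on the fields the BRST operator with the hierarchy of ghosts for ghosts: $$\delta a=d_Ac,\quad \delta B=[B,c]+d_A\tau_1,\quad \delta c=-\tfrac12[c,c],\quad \delta\tau_k=(-1)^k[\tau_k,c]+d_A\tau_{k+1}\quad(1\le k\le m-2),$$ where $A=A_0+a$ and $\tau_{m-1}=0$. -/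

import Mathlib

set_option linter.unusedSectionVars false

open MeasureTheory
open scoped Manifold ContDiff TensorProduct DirectSum

noncomputable section

namespace BFTheory

section Wedge

variable {V : Type*} [AddCommGroup V] [Module ℝ V] [TopologicalSpace V]

/-- The wedge product of alternating maps, as a sum over shuffles:
`(a ∧ b)(v₁, …, v_{k+l}) = ∑ sign σ a(v_{σ 1}, …, v_{σ k}) b(v_{σ (k+1)}, …)`. -/
def wedgeAlg {k l : ℕ} (a : V [⋀^Fin k]→ₗ[ℝ] ℝ) (b : V [⋀^Fin l]→ₗ[ℝ] ℝ) :
    V [⋀^Fin (k + l)]→ₗ[ℝ] ℝ :=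
  ((LinearMap.mul' ℝ ℝ).compAlternatingMap (a.domCoprod b)).domDomCongr finSumFinEquiv

/-- The wedge product of continuous alternating maps. -/
def wedgePt {k l : ℕ} (a : V [⋀^Fin k]→L[ℝ] ℝ) (b : V [⋀^Fin l]→L[ℝ] ℝ) :
    V [⋀^Fin (k + l)]→L[ℝ] ℝ :=
  { wedgeAlg a.toAlternatingMap b.toAlternatingMap with
    cont := by
      change Continuous fun v : Fin (k + l) → V =>
        wedgeAlg a.toAlternatingMap b.toAlternatingMap v
      simp only [wedgeAlg, AlternatingMap.domDomCongr_apply, LinearMap.compAlternatingMap_apply,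
        AlternatingMap.domCoprod_apply, sum_apply, map_sum]
      refine continuous_finsetSum _ fun σ _ => ?_
      induction σ using Quotient.inductionOn' with
      | h σ =>
        simp only [AlternatingMap.domCoprod.summand_mk'', smul_apply,
          MultilinearMap.domDomCongr_apply, MultilinearMap.domCoprod_apply]
        have ha : Continuous fun v : Fin (k + l) → V =>
            a fun i => v (finSumFinEquiv (σ (Sum.inl i))) :=
          a.cont.comp (continuous_pi fun i => continuous_apply _)
        have hb : Continuous fun v : Fin (k + l) → V =>
            b fun i => v (finSumFinEquiv (σ (Sum.inr i))) :=
          b.cont.comp (continuous_pi fun i => continuous_apply _)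
        rcases Int.units_eq_one_or (Equiv.Perm.sign σ) with h | h <;>
          simp only [h, one_smul, Units.neg_smul, map_neg, LinearMap.mul'_apply]
        · exact ha.mul hb
        · exact (ha.mul hb).neg }

theorem wedgePt_toAlt {k l : ℕ} (a : V [⋀^Fin k]→L[ℝ] ℝ) (b : V [⋀^Fin l]→L[ℝ] ℝ) :
    (wedgePt a b).toAlternatingMap = wedgeAlg a.toAlternatingMap b.toAlternatingMap := rfl

theorem wedgeAlg_bilin {k l : ℕ} :
    ∃ B : (V [⋀^Fin k]→ₗ[ℝ] ℝ) →ₗ[ℝ] (V [⋀^Fin l]→ₗ[ℝ] ℝ) →ₗ[ℝ] (V [⋀^Fin (k + l)]→ₗ[ℝ] ℝ),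
      ∀ a b, B a b = wedgeAlg a b := by
  refine ⟨LinearMap.mk₂ ℝ wedgeAlg ?_ ?_ ?_ ?_, fun _ _ => rfl⟩ <;> intros <;>
    simp only [wedgeAlg, ← AlternatingMap.domCoprod'_apply, TensorProduct.add_tmul,
      TensorProduct.tmul_add, ← TensorProduct.smul_tmul', TensorProduct.tmul_smul, map_add,
      map_smul] <;>
    (ext v; simp)

theorem wedgePt_add_left {k l : ℕ} (a a' : V [⋀^Fin k]→L[ℝ] ℝ) (b : V [⋀^Fin l]→L[ℝ] ℝ) :
    wedgePt (a + a') b = wedgePt a b + wedgePt a' b := by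
  obtain ⟨B, hB⟩ := wedgeAlg_bilin (V := V) (k := k) (l := l)
  refine ContinuousAlternatingMap.toAlternatingMap_injective ?_
  change wedgeAlg (a.toAlternatingMap + a'.toAlternatingMap) _ = wedgeAlg _ _ + wedgeAlg _ _
  simp only [← hB, map_add, LinearMap.add_apply]

theorem wedgePt_smul_left {k l : ℕ} (c : ℝ) (a : V [⋀^Fin k]→L[ℝ] ℝ) (b : V [⋀^Fin l]→L[ℝ] ℝ) :
    wedgePt (c • a) b = c • wedgePt a b := by
  obtain ⟨B, hB⟩ := wedgeAlg_bilin (V := V) (k := k) (l := l)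
  refine ContinuousAlternatingMap.toAlternatingMap_injective ?_
  change wedgeAlg (c • a.toAlternatingMap) _ = c • wedgeAlg _ _
  simp only [← hB, map_smul, LinearMap.smul_apply]

theorem wedgePt_add_right {k l : ℕ} (a : V [⋀^Fin k]→L[ℝ] ℝ) (b b' : V [⋀^Fin l]→L[ℝ] ℝ) :
    wedgePt a (b + b') = wedgePt a b + wedgePt a b' := by
  obtain ⟨B, hB⟩ := wedgeAlg_bilin (V := V) (k := k) (l := l)
  refine ContinuousAlternatingMap.toAlternatingMap_injective ?_
  change wedgeAlg _ (b.toAlternatingMap + b'.toAlternatingMap) = wedgeAlg _ _ + wedgeAlg _ _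
  simp only [← hB, map_add]

theorem wedgePt_smul_right {k l : ℕ} (c : ℝ) (a : V [⋀^Fin k]→L[ℝ] ℝ) (b : V [⋀^Fin l]→L[ℝ] ℝ) :
    wedgePt a (c • b) = c • wedgePt a b := by
  obtain ⟨B, hB⟩ := wedgeAlg_bilin (V := V) (k := k) (l := l)
  refine ContinuousAlternatingMap.toAlternatingMap_injective ?_
  change wedgeAlg _ (c • b.toAlternatingMap) = c • wedgeAlg _ _
  simp only [← hB, map_smul]

theorem wedgePt_comp {W : Type*} [AddCommGroup W] [Module ℝ W] [TopologicalSpace W] {k l : ℕ}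
    (a : V [⋀^Fin k]→L[ℝ] ℝ) (b : V [⋀^Fin l]→L[ℝ] ℝ) (f : W →L[ℝ] V) :
    (wedgePt a b).compContinuousLinearMap f =
      wedgePt (a.compContinuousLinearMap f) (b.compContinuousLinearMap f) := by
  ext v
  change wedgeAlg _ _ _ = wedgeAlg _ _ _
  simp only [wedgeAlg, AlternatingMap.domDomCongr_apply, LinearMap.compAlternatingMap_apply,
    AlternatingMap.domCoprod_apply, sum_apply, map_sum]
  refine Finset.sum_congr rfl fun σ _ => ?_
  induction σ using Quotient.inductionOn' with
  | h σ => rfl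

end Wedge

section Forms

/-- The model space `ℝ^m` with its Euclidean structure. -/
abbrev Coord (m : ℕ) : Type := EuclideanSpace ℝ (Fin m)

theorem finite_alt (m k : ℕ) : FiniteDimensional ℝ (Coord m [⋀^Fin k]→L[ℝ] ℝ) := by
  let e : (Coord m [⋀^Fin k]→L[ℝ] ℝ) →ₗ[ℝ] MultilinearMap ℝ (fun _ : Fin k => Coord m) ℝ :=
    { toFun := fun a => a.toMultilinearMap
      map_add' := fun _ _ => rfl
      map_smul' := fun _ _ => rfl }
  refine FiniteDimensional.of_injective e fun a b h => ?_
  ext v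
  exact congrArg (fun f : MultilinearMap ℝ (fun _ : Fin k => Coord m) ℝ => f v) h

variable (m : ℕ) (M : Type*) [TopologicalSpace M] [ChartedSpace (Coord m) M]

/-- Families, indexed by the points of `M`, of alternating `k`-forms on the tangent spaces. -/
abbrev RawForm (k : ℕ) : Type _ :=
  (x : M) → TangentSpace (𝓡 m) x [⋀^Fin k]→L[ℝ] ℝ

variable {m M}

/-- The representative of `η` in the chart at `x`: the pullback of `η` along the inverse of the
chart, a form on the target of the chart. -/
def chartRep {k : ℕ} (η : RawForm m M k) (x : M) (z : Coord m) : Coord m [⋀^Fin k]→L[ℝ] ℝ :=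
  (η ((extChartAt (𝓡 m) x).symm z)).compContinuousLinearMap
    (mfderiv 𝓘(ℝ, Coord m) (𝓡 m) (extChartAt (𝓡 m) x).symm z)

/-- Smoothness of a differential form: all its chart representatives are smooth. -/
def IsSmoothForm {k : ℕ} (η : RawForm m M k) : Prop :=
  ∀ x : M, ContDiffOn ℝ ∞ (chartRep η x) (extChartAt (𝓡 m) x).target

/-- The exterior derivative; at `x` it is computed in the chart at `x` and pulled back along it. -/
def rawD {k : ℕ} (η : RawForm m M k) : RawForm m M (k + 1) := fun x =>
  (extDeriv (chartRep η x) (extChartAt (𝓡 m) x x)).compContinuousLinearMap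
    (mfderiv (𝓡 m) 𝓘(ℝ, Coord m) (extChartAt (𝓡 m) x) x)

theorem chartRep_add {k : ℕ} (η θ : RawForm m M k) (x : M) :
    chartRep (η + θ) x = chartRep η x + chartRep θ x := rfl

theorem chartRep_smul {k : ℕ} (c : ℝ) (η : RawForm m M k) (x : M) :
    chartRep (c • η) x = c • chartRep η x := rfl

theorem isOpen_target (x : M) : IsOpen (extChartAt (𝓡 m) x).target :=
  isOpen_extChartAt_target x

variable (m M) in
/-- The subspace of smooth forms. -/
def smoothForms (k : ℕ) : Submodule ℝ (RawForm m M k) where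
  carrier := {η | IsSmoothForm η}
  zero_mem' := fun x => by
    have : chartRep (0 : RawForm m M k) x = 0 := rfl
    rw [this]; exact contDiffOn_const
  add_mem' := fun {η θ} h h' x => by
    rw [chartRep_add]; exact (h x).add (h' x)
  smul_mem' := fun c η h x => by
    rw [chartRep_smul]; exact contDiffOn_const.smul (h x)

variable (m M) in
/-- The real vector space `Ω^k(M)` of smooth differential `k`-forms on `M`. -/
def DForm (k : ℕ) : Type _ := smoothForms m M k

instance (k : ℕ) : AddCommGroup (DForm m M k) := inferInstanceAs (AddCommGroup (smoothForms m M k))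

instance (k : ℕ) : Module ℝ (DForm m M k) := inferInstanceAs (Module ℝ (smoothForms m M k))

variable [IsManifold (𝓡 m) ∞ M]

theorem mfderiv_symm_eq {x : M} {z : Coord m} (hz : z ∈ (extChartAt (𝓡 m) x).target) :
    mfderiv 𝓘(ℝ, Coord m) (𝓡 m) (extChartAt (𝓡 m) x).symm z =
      tangentCoordChange (𝓡 m) x ((extChartAt (𝓡 m) x).symm z) ((extChartAt (𝓡 m) x).symm z) := by
  have h : MDifferentiableAt 𝓘(ℝ, Coord m) (𝓡 m) (extChartAt (𝓡 m) x).symm z :=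
    ((contMDiffOn_extChartAt_symm (n := ∞) x).contMDiffAt
      ((isOpen_target x).mem_nhds hz)).mdifferentiableAt (by simp)
  rw [h.mfderiv, tangentCoordChange_def, (extChartAt (𝓡 m) x).right_inv hz]
  rfl

theorem mfderiv_chart_eq {x p : M} (hp : p ∈ (extChartAt (𝓡 m) x).source) :
    mfderiv (𝓡 m) 𝓘(ℝ, Coord m) (extChartAt (𝓡 m) x) p = tangentCoordChange (𝓡 m) p x p := by
  have h : MDifferentiableAt (𝓡 m) 𝓘(ℝ, Coord m) (extChartAt (𝓡 m) x) p :=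
    ((contMDiffOn_extChartAt (n := ∞)).contMDiffAt
      ((chartAt (Coord m) x).open_source.mem_nhds (by simpa using hp))).mdifferentiableAt (by simp)
  rw [h.mfderiv, tangentCoordChange_def]
  rfl

/-- Chart representatives transform by pullback under the change of charts. -/
theorem chartRep_transition {k : ℕ} (η : RawForm m M k) {x y : M} {z : Coord m}
    (hz : z ∈ (extChartAt (𝓡 m) x).target)
    (hy : (extChartAt (𝓡 m) x).symm z ∈ (extChartAt (𝓡 m) y).source) :
    chartRep η x z =
      (chartRep η y (extChartAt (𝓡 m) y ((extChartAt (𝓡 m) x).symm z))).compContinuousLinearMap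
        (fderiv ℝ (extChartAt (𝓡 m) y ∘ (extChartAt (𝓡 m) x).symm) z) := by
  have h1 : fderiv ℝ (extChartAt (𝓡 m) y ∘ (extChartAt (𝓡 m) x).symm) z =
      tangentCoordChange (𝓡 m) x y ((extChartAt (𝓡 m) x).symm z) := by
    rw [tangentCoordChange_def, (extChartAt (𝓡 m) x).right_inv hz]
    simp [fderivWithin_univ]
  have hx := (extChartAt (𝓡 m) x).map_target hz
  rw [h1, chartRep, chartRep, mfderiv_symm_eq hz,
    mfderiv_symm_eq ((extChartAt (𝓡 m) y).map_source hy)]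
  generalize (extChartAt (𝓡 m) x).symm z = p at *
  rw [(extChartAt (𝓡 m) y).left_inv hy]
  ext v
  exact congrArg (η p) (funext fun i =>
    (tangentCoordChange_comp ⟨⟨hx, hy⟩, mem_extChartAt_source p⟩).symm)

/-- The exterior derivative is computed by `extDeriv` in every chart. -/
theorem chartRep_rawD {k : ℕ} {η : RawForm m M k} (hη : IsSmoothForm η) {x : M} {z : Coord m}
    (hz : z ∈ (extChartAt (𝓡 m) x).target) :
    chartRep (rawD η) x z = extDeriv (chartRep η x) z := by
  set p := (extChartAt (𝓡 m) x).symm z with hp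
  set τ := extChartAt (𝓡 m) p ∘ (extChartAt (𝓡 m) x).symm with hτ
  have hx : p ∈ (extChartAt (𝓡 m) x).source := (extChartAt (𝓡 m) x).map_target hz
  have hpp := mem_extChartAt_source (I := 𝓡 m) p
  have hev : ∀ᶠ z' in nhds z, chartRep η x z' =
      (chartRep η p (τ z')).compContinuousLinearMap (fderiv ℝ τ z') := by
    have hc : ContinuousAt (extChartAt (𝓡 m) x).symm z :=
      continuousAt_extChartAt_symm'' hz
    filter_upwards [(isOpen_target x).mem_nhds hz,
      hc.preimage_mem_nhds ((isOpen_extChartAt_source (I := 𝓡 m) p).mem_nhds hpp)] with z' h1 h2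
    exact chartRep_transition η h1 h2
  have hsm : ContDiffAt ℝ ∞ τ z := by
    have := contDiffWithinAt_ext_coord_change (I := 𝓡 m) (n := ∞) p x (y := z) (by
      rw [PartialEquiv.trans_source, PartialEquiv.symm_source]; exact ⟨hz, hpp⟩)
    rwa [modelWithCornersSelf_coe, Set.range_id, contDiffWithinAt_univ] at this
  have hd : DifferentiableAt ℝ (chartRep η p) (τ z) :=
    ((hη p).contDiffAt ((isOpen_target p).mem_nhds
      ((extChartAt (𝓡 m) p).map_source hpp))).differentiableAt (by simp)
  rw [show extDeriv (chartRep η x) z =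
      extDeriv (fun z' => (chartRep η p (τ z')).compContinuousLinearMap (fderiv ℝ τ z')) z by
        rw [extDeriv, extDeriv, Filter.EventuallyEq.fderiv_eq hev],
    extDeriv_pullback hd hsm (by simpa using WithTop.coe_le_coe.2 (le_top : (2 : ℕ∞) ≤ ⊤))]
  have h1 : fderiv ℝ τ z = tangentCoordChange (𝓡 m) x p p := by
    rw [tangentCoordChange_def, hp, (extChartAt (𝓡 m) x).right_inv hz]
    simp [fderivWithin_univ, hτ, hp]
  rw [chartRep, mfderiv_symm_eq hz, h1, ← hp, rawD, mfderiv_chart_eq hpp]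
  ext v
  exact congrArg (extDeriv (chartRep η p) (extChartAt (𝓡 m) p p)) (funext fun i =>
    tangentCoordChange_self hpp)

theorem isSmoothForm_rawD {k : ℕ} {η : RawForm m M k} (hη : IsSmoothForm η) :
    IsSmoothForm (rawD η) := fun x => by
  refine ContDiffOn.congr (f := extDeriv (chartRep η x)) ?_ fun z hz => chartRep_rawD hη hz
  have h : ContDiffOn ℝ ∞ (fderiv ℝ (chartRep η x)) (extChartAt (𝓡 m) x).target :=
    (hη x).fderiv_of_isOpen (isOpen_target x) (by simp)
  exact (ContinuousAlternatingMap.alternatizeUncurryFinCLM ℝ (Coord m) ℝ).contDiff.comp_contDiffOn h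

theorem differentiableAt_chartRep {k : ℕ} {η : RawForm m M k} (hη : IsSmoothForm η) (x : M) :
    DifferentiableAt ℝ (chartRep η x) (extChartAt (𝓡 m) x x) :=
  ((hη x).contDiffAt ((isOpen_target x).mem_nhds (mem_extChartAt_target x))).differentiableAt
    (by simp)

variable (m M) in
/-- The exterior derivative `d : Ω^k(M) → Ω^{k+1}(M)`. -/
def extD (k : ℕ) : DForm m M k →ₗ[ℝ] DForm m M (k + 1) where
  toFun η := ⟨rawD η.1, isSmoothForm_rawD η.2⟩
  map_add' η θ := by
    refine Subtype.ext (funext fun x => ?_)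
    change rawD (η.1 + θ.1) x = rawD η.1 x + rawD θ.1 x
    simp only [rawD, chartRep_add]
    rw [extDeriv_add (differentiableAt_chartRep η.2 x) (differentiableAt_chartRep θ.2 x)]
    rfl
  map_smul' c η := by
    refine Subtype.ext (funext fun x => ?_)
    change rawD (c • η.1) x = c • rawD η.1 x
    simp only [rawD, chartRep_smul]
    rw [extDeriv_smul]
    rfl

/-- The wedge product of families of alternating forms. -/
def rawWedge {k l : ℕ} (η : RawForm m M k) (θ : RawForm m M l) : RawForm m M (k + l) :=
  fun x => wedgePt (η x) (θ x)

/-- The pointwise wedge product as a bilinear map. -/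
def wedgePtBilin (m k l : ℕ) : (Coord m [⋀^Fin k]→L[ℝ] ℝ) →ₗ[ℝ] (Coord m [⋀^Fin l]→L[ℝ] ℝ) →ₗ[ℝ]
    (Coord m [⋀^Fin (k + l)]→L[ℝ] ℝ) :=
  LinearMap.mk₂ ℝ wedgePt wedgePt_add_left wedgePt_smul_left wedgePt_add_right wedgePt_smul_right

theorem contDiff_wedgePt (m k l : ℕ) :
    ContDiff ℝ ∞ fun p : (Coord m [⋀^Fin k]→L[ℝ] ℝ) × (Coord m [⋀^Fin l]→L[ℝ] ℝ) =>
      wedgePt p.1 p.2 := by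
  have := finite_alt m k
  have := finite_alt m l
  have h := (wedgePtBilin m k l).toContinuousBilinearMap.isBoundedBilinearMap.contDiff (n := ∞)
  exact h

theorem isSmoothForm_rawWedge {k l : ℕ} {η : RawForm m M k} {θ : RawForm m M l}
    (hη : IsSmoothForm η) (hθ : IsSmoothForm θ) : IsSmoothForm (rawWedge η θ) := fun x => by
  have h : ∀ z, chartRep (rawWedge η θ) x z = wedgePt (chartRep η x z) (chartRep θ x z) :=
    fun z => wedgePt_comp (η ((extChartAt (𝓡 m) x).symm z)) (θ ((extChartAt (𝓡 m) x).symm z))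
      (mfderiv 𝓘(ℝ, Coord m) (𝓡 m) (extChartAt (𝓡 m) x).symm z)
  have h' : ContDiffOn ℝ ∞ (fun z => (chartRep η x z, chartRep θ x z))
      (extChartAt (𝓡 m) x).target := (hη x).prodMk (hθ x)
  have h2 := (contDiff_wedgePt m k l).comp_contDiffOn h'
  exact h2.congr fun z _ => h z

variable (m M) in
/-- The wedge product `Ω^k(M) × Ω^l(M) → Ω^{k+l}(M)`. -/
def wedge (k l : ℕ) : DForm m M k →ₗ[ℝ] DForm m M l →ₗ[ℝ] DForm m M (k + l) :=
  LinearMap.mk₂ ℝ (fun η θ => ⟨rawWedge η.1 θ.1, isSmoothForm_rawWedge η.2 θ.2⟩)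
    (fun _ _ _ => Subtype.ext (funext fun _ => wedgePt_add_left _ _ _))
    (fun _ _ _ => Subtype.ext (funext fun _ => wedgePt_smul_left _ _ _))
    (fun _ _ _ => Subtype.ext (funext fun _ => wedgePt_add_right _ _ _))
    (fun _ _ _ => Subtype.ext (funext fun _ => wedgePt_smul_right _ _ _))

variable [T2Space M] [CompactSpace M]

variable (m M) in
/-- A smooth partition of unity subordinate to the domains of the preferred charts. -/
def unityPartition : SmoothPartitionOfUnity M (𝓡 m) M Set.univ :=
  (SmoothPartitionOfUnity.exists_isSubordinate_chartAt_source (𝓡 m) M).choose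

theorem unityPartition_subordinate (x : M) :
    tsupport (unityPartition m M x) ⊆ (chartAt (Coord m) x).source :=
  (SmoothPartitionOfUnity.exists_isSubordinate_chartAt_source (𝓡 m) M).choose_spec x

/-- The density integrated in the chart at `x`: the coefficient of `dz₁ ∧ ⋯ ∧ dz_m` in the chart
representative of the top form `η`, weighted by the partition of unity. -/
def chartDensity (η : DForm m M m) (x : M) (z : Coord m) : ℝ :=
  unityPartition m M x ((extChartAt (𝓡 m) x).symm z) *
    chartRep η.1 x z fun i => EuclideanSpace.single i 1

theorem integrableOn_chartDensity (η : DForm m M m) (x : M) :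
    IntegrableOn (chartDensity η x) (extChartAt (𝓡 m) x).target := by
  set e := extChartAt (𝓡 m) x with he
  set K := e '' tsupport (unityPartition m M x) with hK
  have hs : tsupport (unityPartition m M x) ⊆ e.source := by
    simpa [he] using unityPartition_subordinate (m := m) x
  have hKc : IsCompact K :=
    (isClosed_tsupport _).isCompact.image_of_continuousOn
      ((continuousOn_extChartAt x).mono hs)
  have hKt : K ⊆ e.target := by
    rintro _ ⟨p, hp, rfl⟩; exact e.map_source (hs hp)
  have hcont : ContinuousOn (chartDensity η x) e.target := by
    have h1 : ContinuousOn (fun z => unityPartition m M x (e.symm z)) e.target :=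
      (unityPartition m M x).contMDiff.continuous.comp_continuousOn (continuousOn_extChartAt_symm x)
    have h2 : ContinuousOn (fun z => chartRep η.1 x z fun i => EuclideanSpace.single i 1)
        e.target := by
      have h := (η.2 x).continuousOn
      exact (ContinuousAlternatingMap.apply ℝ (Coord m) ℝ
        (fun i : Fin m => EuclideanSpace.single i (1 : ℝ))).continuous.comp_continuousOn h
    exact h1.mul h2
  refine (hcont.mono hKt |>.integrableOn_compact hKc).of_forall_sdiff_eq_zero
    (isOpen_target x).measurableSet fun z hz => ?_
  have hz0 : unityPartition m M x (e.symm z) = 0 := by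
    by_contra h
    exact hz.2 ⟨e.symm z, subset_tsupport _ h, e.right_inv hz.1⟩
  simp only [chartDensity, ← he, hz0, zero_mul]

theorem finite_support_unityPartition :
    (Function.support fun x : M => (unityPartition m M x : M → ℝ)).Finite := by
  have h := (unityPartition m M).locallyFinite.finite_nonempty_of_compact
  refine h.subset fun x hx => ?_
  exact Function.support_nonempty_iff.2 hx

variable (m M) in
/-- The integral `∫_M : Ω^m(M) → ℝ` over a compact manifold whose preferred charts are positively
oriented, computed with a partition of unity subordinate to these charts. -/
def formIntegral : DForm m M m →ₗ[ℝ] ℝ where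
  toFun η := ∑ᶠ x : M, ∫ z in (extChartAt (𝓡 m) x).target, chartDensity η x z
  map_add' η θ := by
    have hfin : ∀ η : DForm m M m, (Function.support fun x : M =>
        ∫ z in (extChartAt (𝓡 m) x).target, chartDensity η x z).Finite := fun η =>
      (finite_support_unityPartition (m := m) (M := M)).subset fun x hx h => hx (by
        have h0 : ∀ p, unityPartition m M x p = 0 := fun p => congrFun h p
        simp [chartDensity, h0])
    rw [← finsum_add_distrib (hfin η) (hfin θ)]
    refine finsum_congr fun x => ?_
    rw [← integral_add (integrableOn_chartDensity η x) (integrableOn_chartDensity θ x)]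
    refine integral_congr_ae (Filter.Eventually.of_forall fun z => ?_)
    exact mul_add _ _ _
  map_smul' c η := by
    rw [RingHom.id_apply, smul_eq_mul, mul_finsum]
    · refine finsum_congr fun x => ?_
      rw [← integral_const_mul]
      refine integral_congr_ae (Filter.Eventually.of_forall fun z => ?_)
      exact mul_left_comm _ _ _

end Forms

/-- Positivity of the transition maps between the preferred charts of `M`: these charts form an
oriented atlas, which orients `M`. -/
def OrientedCharts (m : ℕ) (M : Type*) [TopologicalSpace M] [ChartedSpace (Coord m) M] : Prop :=
  ∀ x y : M, ∀ z ∈ ((chartAt (Coord m) x).symm.trans (chartAt (Coord m) y)).source,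
    0 < (fderiv ℝ (chartAt (Coord m) y ∘ (chartAt (Coord m) x).symm) z).det

section TotalForms

variable (m : ℕ) (M : Type*) [TopologicalSpace M] [ChartedSpace (Coord m) M]

/-- The space `Ω(M) = ⨁ₖ Ω^k(M)` of inhomogeneous forms. -/
def Forms : Type _ := ⨁ k : ℕ, DForm m M k

instance : AddCommGroup (Forms m M) := inferInstanceAs (AddCommGroup (⨁ k : ℕ, DForm m M k))

instance : Module ℝ (Forms m M) := inferInstanceAs (Module ℝ (⨁ k : ℕ, DForm m M k))

/-- The inclusion `Ω^p(M) → Ω(M)`. -/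
def ofDeg (p : ℕ) : DForm m M p →ₗ[ℝ] Forms m M := DirectSum.lof ℝ ℕ (fun k => DForm m M k) p

/-- The component `Ω(M) → Ω^p(M)` of degree `p`. -/
def component (p : ℕ) : Forms m M →ₗ[ℝ] DForm m M p :=
  DirectSum.component ℝ ℕ (fun k => DForm m M k) p

/-- The linear map on `Ω(M)` given by linear maps on all `Ω^k(M)`. -/
def Forms.lift {W : Type*} [AddCommGroup W] [Module ℝ W] (f : (k : ℕ) → DForm m M k →ₗ[ℝ] W) :
    Forms m M →ₗ[ℝ] W :=
  DirectSum.toModule ℝ ℕ W f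

/-- The projection of an inhomogeneous form to its component of degree `p`. -/
def degProj (p : ℕ) : Forms m M →ₗ[ℝ] Forms m M :=
  ofDeg m M p ∘ₗ component m M p

/-- The operator `(-1)^deg` on forms. -/
def degParity : Forms m M →ₗ[ℝ] Forms m M :=
  Forms.lift m M fun k => ((-1 : ℝ) ^ k) • ofDeg m M k

variable [IsManifold (𝓡 m) ∞ M]

/-- The exterior derivative on inhomogeneous forms. -/
def totalD : Forms m M →ₗ[ℝ] Forms m M :=
  Forms.lift m M fun k => ofDeg m M (k + 1) ∘ₗ extD m M k

/-- The wedge product on inhomogeneous forms. -/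
def totalWedge : Forms m M →ₗ[ℝ] Forms m M →ₗ[ℝ] Forms m M :=
  Forms.lift m M fun k => LinearMap.flip <| Forms.lift m M fun l =>
    ((wedge m M k l).compr₂ (ofDeg m M (k + l))).flip

/-- Integration of inhomogeneous forms: the integral of the component of top degree. -/
def totalIntegral [T2Space M] [CompactSpace M] : Forms m M →ₗ[ℝ] ℝ :=
  formIntegral m M ∘ₗ component m M m

end TotalForms

/-- The coefficient algebras in which fields take their values: `ℤ`-graded real algebras that are
commutative in the graded sense. The grading is the ghost number. -/
structure GhostAlgebra where
  carrier : Type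
  [ring : Ring carrier]
  [algebra : Algebra ℝ carrier]
  gr : ℤ → Submodule ℝ carrier
  [graded : GradedAlgebra gr]
  supercomm : ∀ i j : ℤ, ∀ x ∈ gr i, ∀ y ∈ gr j, x * y = ((-1 : ℝ) ^ (i * j)) • (y * x)

namespace GhostAlgebra

instance : CoeSort GhostAlgebra Type := ⟨carrier⟩

attribute [instance] GhostAlgebra.ring GhostAlgebra.algebra GhostAlgebra.graded

/-- Morphisms of coefficient algebras: algebra homomorphisms that preserve the ghost number. -/
structure Hom (E E' : GhostAlgebra) where
  toAlgHom : E →ₐ[ℝ] E'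
  map_gr : ∀ q : ℤ, ∀ x ∈ E.gr q, toAlgHom x ∈ E'.gr q

/-- The operator `(-1)^gh` on a coefficient algebra. -/
def ghostParity (E : GhostAlgebra) : E →ₗ[ℝ] E :=
  DirectSum.coeLinearMap E.gr ∘ₗ
    DirectSum.lmap (fun q : ℤ => ((-1 : ℝ) ^ q) • (LinearMap.id : E.gr q →ₗ[ℝ] E.gr q)) ∘ₗ
    (DirectSum.decomposeLinearEquiv E.gr).toLinearMap

end GhostAlgebra

section SuperForms

variable (m : ℕ) (M : Type*) [TopologicalSpace M] [ChartedSpace (Coord m) M]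
  (𝔤 : Type*) [LieRing 𝔤] [LieAlgebra ℝ 𝔤]

/-- Forms on `M` with values in the Lie algebra `𝔤`. -/
abbrev LieForms : Type _ := Forms m M ⊗[ℝ] 𝔤

/-- Elements of `Ω(M; 𝔤) ⊗ E`. -/
abbrev SuperForms (E : GhostAlgebra) : Type _ := LieForms m M 𝔤 ⊗[ℝ] E

/-- `Ω^p(M; 𝔤) ⊗ E`. -/
def ofFormDegree (E : GhostAlgebra) (p : ℕ) : Submodule ℝ (SuperForms m M 𝔤 E) :=
  LinearMap.range (TensorProduct.map
    (TensorProduct.map (ofDeg m M p) (LinearMap.id : 𝔤 →ₗ[ℝ] 𝔤))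
    (LinearMap.id : E →ₗ[ℝ] E))

/-- `Ω^p(M; 𝔤) ⊗ E^q`: form degree `p` and ghost number `q`. -/
def ofBidegree (E : GhostAlgebra) (p : ℕ) (q : ℤ) : Submodule ℝ (SuperForms m M 𝔤 E) :=
  LinearMap.range (TensorProduct.map
    (TensorProduct.map (ofDeg m M p) (LinearMap.id : 𝔤 →ₗ[ℝ] 𝔤))
    (E.gr q).subtype)

/-- The operator `(-1)^deg` on `Ω(M; 𝔤)`. -/
def lieParity : LieForms m M 𝔤 →ₗ[ℝ] LieForms m M 𝔤 :=
  TensorProduct.map (degParity m M) LinearMap.id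

end SuperForms

section Operations

variable {m : ℕ} {M : Type*} [TopologicalSpace M] [ChartedSpace (Coord m) M]
  {𝔤 : Type*} [LieRing 𝔤] [LieAlgebra ℝ 𝔤] {E : GhostAlgebra}
  {V : Type*} [AddCommGroup V] [Module ℝ V]

/-- The extension of a bilinear operation `b` on `Ω(M; 𝔤)` to `Ω(M; 𝔤) ⊗ E`:
`(α ⊗ e, β ⊗ e') ↦ b(α, β) ⊗ e e'`. -/
def superExt (b : LieForms m M 𝔤 →ₗ[ℝ] LieForms m M 𝔤 →ₗ[ℝ] V) :
    SuperForms m M 𝔤 E →ₗ[ℝ] SuperForms m M 𝔤 E →ₗ[ℝ] V ⊗[ℝ] E :=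
  TensorProduct.map₂ b (LinearMap.mul ℝ E)

/-- The dot version `(-1)^{gh α · deg β} b(α, β)` of the extension of a bilinear operation: the
sum over `p` of `b((-1)^{p · gh} α, β_p)`, where `β_p` is the component of `β` of form
degree `p`. -/
def dotExt (b : LieForms m M 𝔤 →ₗ[ℝ] LieForms m M 𝔤 →ₗ[ℝ] V) :
    SuperForms m M 𝔤 E →ₗ[ℝ] SuperForms m M 𝔤 E →ₗ[ℝ] V ⊗[ℝ] E :=
  ∑ p ∈ Finset.range (m + 1), (superExt b).compl₁₂
    (TensorProduct.map LinearMap.id (E.ghostParity ^ p))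
    (TensorProduct.map (TensorProduct.map (degProj m M p) LinearMap.id) LinearMap.id)

variable [IsManifold (𝓡 m) ∞ M]

/-- The bracket `[α ⊗ X, β ⊗ Y] = (α ∧ β) ⊗ [X, Y]` of `𝔤`-valued forms. -/
def lieFormBracket : LieForms m M 𝔤 →ₗ[ℝ] LieForms m M 𝔤 →ₗ[ℝ] LieForms m M 𝔤 :=
  TensorProduct.map₂ (totalWedge m M) (LinearMap.mk₂ ℝ (fun X Y : 𝔤 => ⁅X, Y⁆) add_lie smul_lie lie_add fun c X Y => lie_smul c X Y)

/-- The pairing `⟨α ⊗ X, β ⊗ Y⟩ = (α ∧ β) κ(X, Y)` of `𝔤`-valued forms. -/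
def lieFormPairing (κ : LinearMap.BilinForm ℝ 𝔤) :
    LieForms m M 𝔤 →ₗ[ℝ] LieForms m M 𝔤 →ₗ[ℝ] Forms m M :=
  (TensorProduct.map₂ (totalWedge m M) κ).compr₂ (TensorProduct.rid ℝ (Forms m M)).toLinearMap

/-- The exterior derivative of `𝔤`-valued forms. -/
def lieFormD : LieForms m M 𝔤 →ₗ[ℝ] LieForms m M 𝔤 :=
  TensorProduct.map (totalD m M) LinearMap.id

/-- The exterior derivative on `Ω(M; 𝔤) ⊗ E`. -/
def superD : SuperForms m M 𝔤 E →ₗ[ℝ] SuperForms m M 𝔤 E :=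
  TensorProduct.map lieFormD LinearMap.id

/-- The super Lie bracket `[α, β]` on `Ω(M; 𝔤) ⊗ E`. -/
def superBracket (α β : SuperForms m M 𝔤 E) : SuperForms m M 𝔤 E := superExt lieFormBracket α β

/-- The dot Lie bracket `⟦α; β⟧ = (-1)^{gh α · deg β} [α, β]`. -/
def dotBracket (α β : SuperForms m M 𝔤 E) : SuperForms m M 𝔤 E := dotExt lieFormBracket α β

variable [T2Space M] [CompactSpace M]

/-- `∫_M ⟨α, β⟩`, an element of `ℝ ⊗ E`. -/
def pairInt (κ : LinearMap.BilinForm ℝ 𝔤) (α β : SuperForms m M 𝔤 E) : ℝ ⊗[ℝ] E :=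
  superExt ((lieFormPairing κ).compr₂ (totalIntegral m M)) α β

/-- `∫_M ⟪α; β⟫` with the dot pairing `⟪α; β⟫ = (-1)^{gh α · deg β} ⟨α, β⟩`. -/
def dotPairInt (κ : LinearMap.BilinForm ℝ 𝔤) (α β : SuperForms m M 𝔤 E) : ℝ ⊗[ℝ] E :=
  dotExt ((lieFormPairing κ).compr₂ (totalIntegral m M)) α β

end Operations

/-- The names of the fields of the theory: the ghost `c`, the variation `a` of the connection, the
field `B`, and the ghosts for ghosts; `tau i` stands for `τ_{i+1}`, so that the `τ_k` are indexed
by `k = 1, …, m - 2`. -/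
inductive FieldName (m : ℕ) where
  | c : FieldName m
  | a : FieldName m
  | B : FieldName m
  | tau (i : Fin (m - 2)) : FieldName m

namespace FieldName

/-- The form degree of a field. -/
def deg {m : ℕ} : FieldName m → ℕ
  | c => 0
  | a => 1
  | B => m - 2
  | tau i => m - 2 - ((i : ℕ) + 1)

/-- The ghost number of a field. -/
def gh {m : ℕ} : FieldName m → ℤ
  | c => 1
  | a => 0
  | B => 0
  | tau i => ((i : ℕ) : ℤ) + 1

/-- The sum over all fields. -/
def sum {m : ℕ} {X : Type*} [AddCommMonoid X] (f : FieldName m → X) : X :=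
  f c + f a + f B + ∑ i : Fin (m - 2), f (tau i)

end FieldName

/-- Fields and antifields together. -/
inductive Species (m : ℕ) where
  | field (i : FieldName m) : Species m
  | anti (i : FieldName m) : Species m

namespace Species

/-- The form degree; the antifield of a field of form degree `p` has form degree `m - p`. -/
def deg {m : ℕ} : Species m → ℕ
  | field i => i.deg
  | anti i => m - i.deg

/-- The ghost number; the antifield of a field of ghost number `q` has ghost number `-1 - q`. -/
def gh {m : ℕ} : Species m → ℤ
  | field i => i.gh
  | anti i => -1 - i.gh

end Species

section Functionals

variable (m : ℕ) (M : Type*) [TopologicalSpace M] [ChartedSpace (Coord m) M]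
  (𝔤 : Type*) [LieRing 𝔤] [LieAlgebra ℝ 𝔤]

/-- Configurations with coefficients in `E`: for each field and each antifield, an element of
`Ω(M; 𝔤) ⊗ E` of the prescribed form degree and ghost number. -/
abbrev Config (E : GhostAlgebra) : Type _ :=
  (s : Species m) → ofBidegree m M 𝔤 E s.deg s.gh

variable {m M 𝔤} in
/-- The components of a configuration as elements of `Ω(M; 𝔤) ⊗ E`. -/
def Config.val {E : GhostAlgebra} (φ : Config m M 𝔤 E) (s : Species m) : SuperForms m M 𝔤 E := φ s

/-- Extension of coefficients. -/
def changeCoeff (V : Type*) [AddCommGroup V] [Module ℝ V] {E E' : GhostAlgebra} (f : E.Hom E') :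
    V ⊗[ℝ] E →ₗ[ℝ] V ⊗[ℝ] E' :=
  TensorProduct.map LinearMap.id f.toAlgHom.toLinearMap

variable {m M 𝔤} in
theorem changeCoeff_mem {E E' : GhostAlgebra} (f : E.Hom E') {p : ℕ} {q : ℤ}
    {α : SuperForms m M 𝔤 E} (hα : α ∈ ofBidegree m M 𝔤 E p q) :
    changeCoeff (LieForms m M 𝔤) f α ∈ ofBidegree m M 𝔤 E' p q := by
  obtain ⟨x, rfl⟩ := hα
  induction x using TensorProduct.induction_on with
  | zero => simp
  | add x y hx hy => rw [map_add, map_add]; exact add_mem hx hy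
  | tmul u e => exact ⟨u ⊗ₜ ⟨f.toAlgHom e, f.map_gr q e e.2⟩, rfl⟩

variable {m M 𝔤} in
/-- Extension of coefficients for configurations. -/
def Config.map {E E' : GhostAlgebra} (f : E.Hom E') (φ : Config m M 𝔤 E) : Config m M 𝔤 E' :=
  fun s => ⟨changeCoeff (LieForms m M 𝔤) f (φ s), changeCoeff_mem f (φ s).2⟩

/-- Functionals of the fields with values in the real vector space `V` (extended by the
coefficients `E`, for all `E` at once). For `V = ℝ` these are scalar functionals; for
`V = Ω(M; 𝔤)` they are functionals with values in forms, such as the fields themselves. -/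
def Functional (V : Type*) [AddCommGroup V] [Module ℝ V] : Type _ :=
  (E : GhostAlgebra) → Config m M 𝔤 E → V ⊗[ℝ] E

variable {m M 𝔤} in
/-- Compatibility with extension of coefficients. -/
def Functional.IsNatural {V : Type*} [AddCommGroup V] [Module ℝ V] (F : Functional m M 𝔤 V) :
    Prop :=
  ∀ (E E' : GhostAlgebra) (f : E.Hom E') (φ : Config m M 𝔤 E),
    F E' (φ.map f) = changeCoeff V f (F E φ)

/-- Distributional derivatives: families of linear functionals on test forms, which depend on the
configuration. A smooth derivative `D` acts on the test form `ρ` by `∫_M ⟨ρ, D⟩`. -/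
def Distribution (V : Type*) [AddCommGroup V] [Module ℝ V] : Type _ :=
  (E : GhostAlgebra) → Config m M 𝔤 E → SuperForms m M 𝔤 E →ₗ[ℝ] V ⊗[ℝ] E

variable {m M 𝔤} in
/-- Compatibility with extension of coefficients. -/
def Distribution.IsNatural {V : Type*} [AddCommGroup V] [Module ℝ V]
    (L : Distribution m M 𝔤 V) : Prop :=
  ∀ (E E' : GhostAlgebra) (f : E.Hom E') (φ : Config m M 𝔤 E) (ρ : SuperForms m M 𝔤 E),
    L E' (φ.map f) (changeCoeff (LieForms m M 𝔤) f ρ) = changeCoeff V f (L E φ ρ)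

end Functionals

/-- `w` is the derivative at `t = 0` of the curve `u` in the real vector space `W`, tested against
all linear functionals on `W`. -/
def HasDerivAtZero {W : Type*} [AddCommGroup W] [Module ℝ W] (u : ℝ → W) (w : W) : Prop :=
  ∀ ℓ : W →ₗ[ℝ] ℝ, HasDerivAt (fun t => ℓ (u t)) (ℓ w) 0

section Brackets

variable {m : ℕ} {M : Type*} [TopologicalSpace M] [ChartedSpace (Coord m) M]
  {𝔤 : Type*} [LieRing 𝔤] [LieAlgebra ℝ 𝔤] {V : Type*} [AddCommGroup V] [Module ℝ V]

open Classical in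
/-- The configuration in which the component `s` of `φ` is replaced by `φ_s + t ρ`. -/
def Config.shift {E : GhostAlgebra} (φ : Config m M 𝔤 E) (s : Species m)
    (ρ : ofBidegree m M 𝔤 E s.deg s.gh) (t : ℝ) : Config m M 𝔤 E :=
  Function.update φ s (φ s + t • ρ)

/-- Left multiplication by a coefficient: `e (v ⊗ x) = v ⊗ e x`. -/
def coeffMul (V : Type*) [AddCommGroup V] [Module ℝ V] {E : GhostAlgebra} (e : E) :
    V ⊗[ℝ] E →ₗ[ℝ] V ⊗[ℝ] E :=
  TensorProduct.map LinearMap.id (LinearMap.mulLeft ℝ e)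

/-- `L` is the left functional derivative of `G` with respect to `φ_s`: it is left linear over the
coefficients and `d/dt G(φ_s + t ρ) = L(ρ)`, that is, `∫_M ⟨ρ, ∂G/∂φ_s⟩`. -/
structure IsLeftDeriv (G : Functional m M 𝔤 V) (s : Species m) (L : Distribution m M 𝔤 V) :
    Prop where
  natural : L.IsNatural
  map_coeff : ∀ (E : GhostAlgebra) (φ : Config m M 𝔤 E) (e : E) (ρ : SuperForms m M 𝔤 E),
    L E φ (coeffMul _ e ρ) = coeffMul V e (L E φ ρ)
  deriv : ∀ (E : GhostAlgebra) (φ : Config m M 𝔤 E) (ρ : ofBidegree m M 𝔤 E s.deg s.gh),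
    HasDerivAtZero (fun t => G E (φ.shift s ρ t)) (L E φ ρ)

variable [IsManifold (𝓡 m) ∞ M] [T2Space M] [CompactSpace M]

/-- `R` is the (smooth) right functional derivative of `F` with respect to `φ_s`: a form of degree
`m - deg φ_s` with `d/dt F(φ_s + t ρ) = ∫_M ⟨R, ρ⟩`. -/
structure IsRightDeriv (κ : LinearMap.BilinForm ℝ 𝔤) (F : Functional m M 𝔤 ℝ) (s : Species m)
    (R : Functional m M 𝔤 (LieForms m M 𝔤)) : Prop where
  natural : R.IsNatural
  deg : ∀ (E : GhostAlgebra) (φ : Config m M 𝔤 E), R E φ ∈ ofFormDegree m M 𝔤 E (m - s.deg)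
  deriv : ∀ (E : GhostAlgebra) (φ : Config m M 𝔤 E) (ρ : ofBidegree m M 𝔤 E s.deg s.gh),
    HasDerivAtZero (fun t => F E (φ.shift s ρ t)) (pairInt κ (R E φ) ρ)

/-- `K` is the BV antibracket
`(F, G) = ∑ᵢ ∫_M ⟨F∂/∂φⁱ, ∂G/∂φ⁺ᵢ⟩ - (-1)^{(m+1) deg φⁱ} ⟨F∂/∂φ⁺ᵢ, ∂G/∂φⁱ⟩`
of a scalar functional `F` with smooth functional derivatives and a functional `G`. Functional
derivatives, tested with all coefficients `E`, are unique, hence so is `K`. -/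
def IsBVBracket (κ : LinearMap.BilinForm ℝ 𝔤) (F : Functional m M 𝔤 ℝ) (G K : Functional m M 𝔤 V) :
    Prop :=
  ∃ (R : Species m → Functional m M 𝔤 (LieForms m M 𝔤)) (L : Species m → Distribution m M 𝔤 V),
    (∀ s, IsRightDeriv κ F s (R s)) ∧ (∀ s, IsLeftDeriv G s (L s)) ∧
    ∀ (E : GhostAlgebra) (φ : Config m M 𝔤 E),
      K E φ = FieldName.sum fun i =>
        L (.anti i) E φ (R (.field i) E φ) -
          ((-1 : ℝ) ^ ((m + 1) * i.deg)) • L (.field i) E φ (R (.anti i) E φ)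

end Brackets

section SuperFields

variable {m : ℕ} {M : Type*} [TopologicalSpace M] [ChartedSpace (Coord m) M]
  {𝔤 : Type*} [LieRing 𝔤] [LieAlgebra ℝ 𝔤] {E : GhostAlgebra}

/-- The combination
`𝖠 = (-1)^{m+1} c + a + (-1)^m B⁺ + ∑ₖ (-1)^{k(k-1)/2 + m(k+1)} τₖ⁺`
of a family of elements indexed by the fields and antifields. For a configuration this is the
superfield `𝖺`, the variation of the superconnection. -/
def superA (x : Species m → SuperForms m M 𝔤 E) : SuperForms m M 𝔤 E :=
  ((-1 : ℝ) ^ (m + 1)) • x (.field .c) + x (.field .a) + ((-1 : ℝ) ^ m) • x (.anti .B) +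
    ∑ i : Fin (m - 2), ((-1 : ℝ) ^ (((i : ℕ) + 1) * (i : ℕ) / 2 + m * ((i : ℕ) + 2))) • x (.anti (.tau i))

/-- The combination `𝖡 = ∑ₖ (-1)^{k(k-1)/2} τₖ + B + (-1)^m a⁺ + c⁺` of a family of elements
indexed by the fields and antifields. For a configuration this is the superfield `𝖡`. -/
def superB (x : Species m → SuperForms m M 𝔤 E) : SuperForms m M 𝔤 E :=
  ∑ i : Fin (m - 2), ((-1 : ℝ) ^ (((i : ℕ) + 1) * (i : ℕ) / 2)) • x (.field (.tau i)) +
    x (.field .B) + ((-1 : ℝ) ^ m) • x (.anti .a) + x (.anti .c)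

/-- The superfield `𝖺` as a functional of the component fields. -/
def fieldA : Functional m M 𝔤 (LieForms m M 𝔤) := fun _ φ => superA φ.val

/-- The superfield `𝖡` as a functional of the component fields. -/
def fieldB : Functional m M 𝔤 (LieForms m M 𝔤) := fun _ φ => superB φ.val

/-- A single field or antifield as a functional. -/
def fieldComponent (s : Species m) : Functional m M 𝔤 (LieForms m M 𝔤) := fun _ φ => φ.val s

/-- The dot product `ε · x = (-1)^{q · deg x} ε x` with a coefficient `ε` of ghost number `q`;
here `P` is the operator `(-1)^deg` on `V`. -/
def dotCoeffMul {V : Type*} [AddCommGroup V] [Module ℝ V] (P : V →ₗ[ℝ] V) (q : ℤ) (ε : E) :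
    V ⊗[ℝ] E →ₗ[ℝ] V ⊗[ℝ] E :=
  TensorProduct.map (if Even q then LinearMap.id else P) (LinearMap.mulLeft ℝ ε)

/-- `L` is the left functional derivative of `G` with respect to one of the superfields `𝖺`, `𝖡`,
here called `x`, the other one being `y`: for all variations `ρ` of the fields that only affect
`x`, one has `d/dt G(x + t ρ_x) = L(ρ_x)`, that is, `∫_M ⟪ρ_x; ∂G/∂x⟫`. Moreover `L` is
left linear over the coefficients for the dot product, which gives the sign `(-1)^{m q}` since
integration over `M` has degree `-m`. The operator `P` is `(-1)^deg` on the values of `G`. -/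
structure IsSuperLeftDeriv {V : Type*} [AddCommGroup V] [Module ℝ V] (P : V →ₗ[ℝ] V)
    (x y : Functional m M 𝔤 (LieForms m M 𝔤)) (G : Functional m M 𝔤 V)
    (L : Distribution m M 𝔤 V) : Prop where
  natural : L.IsNatural
  map_coeff : ∀ (E : GhostAlgebra) (φ : Config m M 𝔤 E) (q : ℤ), ∀ ε ∈ E.gr q,
    ∀ ρ : SuperForms m M 𝔤 E,
      L E φ (dotCoeffMul (lieParity m M 𝔤) q ε ρ) =
        ((-1 : ℝ) ^ (m * q)) • dotCoeffMul P q ε (L E φ ρ)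
  deriv : ∀ (E : GhostAlgebra) (φ ρ : Config m M 𝔤 E), y E ρ = 0 →
    HasDerivAtZero (fun t : ℝ => G E (φ + t • ρ)) (L E φ (x E ρ))

/-- The covariant derivative `d_{A₀} α = d α + [A₀, α]` on `Ω(M; 𝔤) ⊗ E`. -/
def covD [IsManifold (𝓡 m) ∞ M] (A : SuperForms m M 𝔤 E) (α : SuperForms m M 𝔤 E) :
    SuperForms m M 𝔤 E :=
  superD α + superBracket A α

/-- The curvature `F_A = d A + ½ [A, A]`. -/
def curvature [IsManifold (𝓡 m) ∞ M] (A : SuperForms m M 𝔤 E) : SuperForms m M 𝔤 E :=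
  superD A + (1 / 2 : ℝ) • superBracket A A

/-- A `𝔤`-valued one-form, as an element of `Ω(M; 𝔤) ⊗ E`. -/
def constForm (A₀ : DForm m M 1 ⊗[ℝ] 𝔤) : SuperForms m M 𝔤 E :=
  TensorProduct.map (ofDeg m M 1) LinearMap.id A₀ ⊗ₜ[ℝ] (1 : E)

/-- Flatness of the connection `A₀`. -/
def IsFlat [IsManifold (𝓡 m) ∞ M] (A₀ : DForm m M 1 ⊗[ℝ] 𝔤) : Prop :=
  lieFormD (TensorProduct.map (ofDeg m M 1) LinearMap.id A₀) + (1 / 2 : ℝ) •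
    lieFormBracket (TensorProduct.map (ofDeg m M 1) LinearMap.id A₀)
      (TensorProduct.map (ofDeg m M 1) LinearMap.id A₀) = 0

/-- The supercurvature `𝖥_𝖠 = d_{A₀} 𝖺 + ½ ⟦𝖺; 𝖺⟧` of the superconnection `𝖠 = A₀ + 𝖺`. -/
def superCurvature [IsManifold (𝓡 m) ∞ M] (A₀ : DForm m M 1 ⊗[ℝ] 𝔤) :
    Functional m M 𝔤 (LieForms m M 𝔤) :=
  fun E φ => covD (constForm A₀) (fieldA E φ) + (1 / 2 : ℝ) • dotBracket (fieldA E φ) (fieldA E φ)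

/-- The covariant derivative `d_𝖠 𝖡 = d_{A₀} 𝖡 + ⟦𝖺; 𝖡⟧`. -/
def superCovB [IsManifold (𝓡 m) ∞ M] (A₀ : DForm m M 1 ⊗[ℝ] 𝔤) :
    Functional m M 𝔤 (LieForms m M 𝔤) :=
  fun E φ => covD (constForm A₀) (fieldB E φ) + dotBracket (fieldA E φ) (fieldB E φ)

/-- The ghost for ghost `τ_{k+1}`; it is zero for `k = m - 2`, where there is no such field. -/
def nextTau (φ : Config m M 𝔤 E) (k : ℕ) : SuperForms m M 𝔤 E :=
  if h : k < m - 2 then φ.val (.field (.tau ⟨k, h⟩)) else 0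

/-- The BRST operator on the fields:
`a ↦ d_A c`, `B ↦ [B, c] + d_A τ₁`, `c ↦ -½ [c, c]`, `τ_k ↦ (-1)^k [τ_k, c] + d_A τ_{k+1}`,
where `A = A₀ + a` and `τ_{m-1} = 0`. -/
def brst [IsManifold (𝓡 m) ∞ M] (A₀ : DForm m M 1 ⊗[ℝ] 𝔤) (φ : Config m M 𝔤 E) :
    FieldName m → SuperForms m M 𝔤 E
  | .c => (-(1 / 2) : ℝ) • superBracket (φ.val (.field .c)) (φ.val (.field .c))
  | .a => covD (constForm A₀ + φ.val (.field .a)) (φ.val (.field .c))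
  | .B => superBracket (φ.val (.field .B)) (φ.val (.field .c)) +
      covD (constForm A₀ + φ.val (.field .a)) (nextTau φ 0)
  | .tau i => ((-1 : ℝ) ^ ((i : ℕ) + 1)) •
        superBracket (φ.val (.field (.tau i))) (φ.val (.field .c)) +
      covD (constForm A₀ + φ.val (.field .a)) (nextTau φ ((i : ℕ) + 1))

variable [IsManifold (𝓡 m) ∞ M] [T2Space M] [CompactSpace M]

/-- `R` is the (smooth) right functional derivative of `F` with respect to one of the superfields
`𝖺`, `𝖡`, here called `x`, the other one being `y`: for all variations `ρ` of the fields that only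
affect `x`, one has `d/dt F(x + t ρ_x) = ∫_M ⟪R; ρ_x⟫`. -/
structure IsSuperRightDeriv (κ : LinearMap.BilinForm ℝ 𝔤)
    (x y : Functional m M 𝔤 (LieForms m M 𝔤)) (F : Functional m M 𝔤 ℝ)
    (R : Functional m M 𝔤 (LieForms m M 𝔤)) : Prop where
  natural : R.IsNatural
  deriv : ∀ (E : GhostAlgebra) (φ ρ : Config m M 𝔤 E), y E ρ = 0 →
    HasDerivAtZero (fun t : ℝ => F E (φ + t • ρ)) (dotPairInt κ (R E φ) (x E ρ))

/-- `K` is the super BV antibracket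
`⟪F; G⟫ = ∫_M ⟪F∂/∂𝖡; ∂G/∂𝖺⟫ - (-1)^m ⟪F∂/∂𝖺; ∂G/∂𝖡⟫`
of a scalar functional `F` with smooth functional derivatives and a functional `G`. The operator
`P` is `(-1)^deg` on the values of `G`. -/
def IsSuperBracket (κ : LinearMap.BilinForm ℝ 𝔤) {V : Type*} [AddCommGroup V] [Module ℝ V]
    (P : V →ₗ[ℝ] V) (F : Functional m M 𝔤 ℝ) (G K : Functional m M 𝔤 V) : Prop :=
  ∃ (RA RB : Functional m M 𝔤 (LieForms m M 𝔤)) (LA LB : Distribution m M 𝔤 V),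
    IsSuperRightDeriv κ fieldA fieldB F RA ∧ IsSuperRightDeriv κ fieldB fieldA F RB ∧
    IsSuperLeftDeriv P fieldA fieldB G LA ∧ IsSuperLeftDeriv P fieldB fieldA G LB ∧
    ∀ (E : GhostAlgebra) (φ : Config m M 𝔤 E),
      K E φ = LA E φ (RB E φ) - ((-1 : ℝ) ^ m) • LB E φ (RA E φ)

/-- The BV action `S = ∫_M ⟪𝖡; 𝖥_𝖠⟫`. -/
def bvAction (κ : LinearMap.BilinForm ℝ 𝔤) (A₀ : DForm m M 1 ⊗[ℝ] 𝔤) : Functional m M 𝔤 ℝ :=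
  fun E φ => dotPairInt κ (fieldB E φ) (superCurvature A₀ E φ)

/-- The classical `BF` action `∫_M ⟨B, F_A⟩`. -/
def classicalAction (κ : LinearMap.BilinForm ℝ 𝔤) (A B : SuperForms m M 𝔤 E) : ℝ ⊗[ℝ] E :=
  pairInt κ B (curvature A)

end SuperFields

end BFTheory

end

/-!
The superfields `𝖺` and `𝖡` are built so that, for the dot operations, only the total degree
(form degree plus ghost number) matters: `𝖺` has total degree `1` and `𝖡` total degree `m - 2`,
the dot bracket is a graded Lie bracket for the total degree (`dotBracket_comm`,
`dotBracket_jacobi`), `d` is a derivation of it (`superD_dotBracket`), and the integrated dot pairing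
is graded symmetric, invariant and compatible with `d` (`dotPairInt_comm`, `dotPairInt_dotBracket`,
`dotPairInt_superD`). The last property is Stokes' theorem (`totalIntegral_totalD`), proved here with
the partition of unity that defines the integral; the others rest on the associativity, graded
commutativity and Leibniz rule of the wedge product. Each identity is checked on elements
`η ⊗ X ⊗ e` with `η` a form of fixed degree and `e` of fixed ghost number, which span.

Since `A₀` is flat, `𝖥_𝖠` is the curvature of the superconnection `𝖠 = A₀ + 𝖺`
(`superCurvature_eq`). Hence the first variation of the action along variations `α`, `β` of `𝖺`, `𝖡`
is `∫ ⟪𝖥_𝖠; β⟫ + (-1)^{m+1} ∫ ⟪d_𝖠 𝖡; α⟫` (`hasDerivAtZero_bvAction`), as in ordinary `BF` theory.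
This gives the super antibrackets with `𝖺` and `𝖡`, and `⟪S; S⟫` is a multiple of
`∫ ⟪𝖥_𝖠; d_𝖠 𝖡⟫`, which vanishes after integration by parts by the Bianchi identity
(`dotPairInt_curvature_covB`).

The derivative with respect to a single field or antifield of form degree `p` is, up to sign, the
component of form degree `m - p` of `𝖥_𝖠` or `d_𝖠 𝖡` (`actionRight`). The contribution of a field and
its antifield to `(S, S)` then is twice the contribution of one form degree to
`∫ ⟪𝖥_𝖠; d_𝖠 𝖡⟫`, and every form degree `0, …, m` occurs once, so that the sum is zero. In the same
way `δ_BV` of a field or antifield is a component of `𝖥_𝖠` or `d_𝖠 𝖡`, and the components reassemble to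
the superfield formulas. Without antifields `𝖺 = (-1)^{m+1} c + a`, the components are explicit, and
those of `𝖥_𝖠` stop at form degree two, so that only `B` survives in the action.
-/

set_option linter.unusedSectionVars false

noncomputable section

namespace BFTheory

/-! ### Pointwise exterior algebra -/

section AlternatingAlgebra

variable {V : Type*} [AddCommGroup V] [Module ℝ V]

/-- The tensor product of two scalar multilinear maps, as a multilinear map on `Fin (k + l)`. -/
def tensorMul {k l : ℕ} (a : MultilinearMap ℝ (fun _ : Fin k => V) ℝ)
    (b : MultilinearMap ℝ (fun _ : Fin l => V) ℝ) :
    MultilinearMap ℝ (fun _ : Fin (k + l) => V) ℝ :=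
  ((LinearMap.mul' ℝ ℝ).compMultilinearMap (a.domCoprod b)).domDomCongr finSumFinEquiv

theorem tensorMul_apply {k l : ℕ} (a : MultilinearMap ℝ (fun _ : Fin k => V) ℝ)
    (b : MultilinearMap ℝ (fun _ : Fin l => V) ℝ) (v : Fin (k + l) → V) :
    tensorMul a b v = a (fun i => v (Fin.castAdd l i)) * b (fun i => v (Fin.natAdd k i)) := by
  simp [tensorMul, MultilinearMap.domCoprod_apply]

theorem alternatization_domDomCongr {ι ι' : Type*} [Fintype ι] [DecidableEq ι] [Fintype ι']
    [DecidableEq ι'] (e : ι ≃ ι') (f : MultilinearMap ℝ (fun _ : ι => V) ℝ) :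
    MultilinearMap.alternatization (f.domDomCongr e) =
      (MultilinearMap.alternatization f).domDomCongr e := by
  ext v
  simp only [MultilinearMap.alternatization_apply, AlternatingMap.domDomCongr_apply,
    MultilinearMap.domDomCongr_apply]
  refine Fintype.sum_equiv e.symm.permCongr _ _ fun σ => ?_
  congr 1
  · simp
  · congr 1; ext i; simp

/-- The wedge of two alternatizations is the alternatization of the tensor product. Since over `ℝ` every
alternating map is an alternatization, identities for the wedge reduce to multilinear maps. -/
theorem wedgeAlg_alternatization {k l : ℕ} (a : MultilinearMap ℝ (fun _ : Fin k => V) ℝ)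
    (b : MultilinearMap ℝ (fun _ : Fin l => V) ℝ) :
    wedgeAlg (MultilinearMap.alternatization a) (MultilinearMap.alternatization b) =
      MultilinearMap.alternatization (tensorMul a b) := by
  rw [wedgeAlg, ← MultilinearMap.domCoprod_alternization, tensorMul, alternatization_domDomCongr]
  congr 1
  ext v
  simp [MultilinearMap.alternatization_apply]

/-- In characteristic zero every alternating map is an alternatization. -/
theorem exists_alternatization {k : ℕ} (a : V [⋀^Fin k]→ₗ[ℝ] ℝ) :
    ∃ a' : MultilinearMap ℝ (fun _ : Fin k => V) ℝ, MultilinearMap.alternatization a' = a := by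
  refine ⟨((k.factorial : ℝ)⁻¹ • a : V [⋀^Fin k]→ₗ[ℝ] ℝ).toMultilinearMap, ?_⟩
  have h := AlternatingMap.coe_alternatization ((k.factorial : ℝ)⁻¹ • a)
  refine h.trans ?_
  ext v
  simp [Fintype.card_fin, Nat.cast_ne_zero.2 k.factorial_ne_zero]

theorem wedgeAlg_assoc {k l n : ℕ} (a : V [⋀^Fin k]→ₗ[ℝ] ℝ) (b : V [⋀^Fin l]→ₗ[ℝ] ℝ)
    (c : V [⋀^Fin n]→ₗ[ℝ] ℝ) (v : Fin (k + l + n) → V) :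
    wedgeAlg (wedgeAlg a b) c v =
      wedgeAlg a (wedgeAlg b c) fun i => v (Fin.cast (Nat.add_assoc k l n).symm i) := by
  obtain ⟨a, rfl⟩ := exists_alternatization a
  obtain ⟨b, rfl⟩ := exists_alternatization b
  obtain ⟨c, rfl⟩ := exists_alternatization c
  have h : tensorMul a (tensorMul b c) =
      (tensorMul (tensorMul a b) c).domDomCongr (finCongr (Nat.add_assoc k l n)) := by
    ext v
    rw [tensorMul_apply, tensorMul_apply]
    have h3 : ∀ i : Fin n, Fin.cast (Nat.add_assoc k l n) (Fin.natAdd (k + l) i) =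
        Fin.natAdd k (Fin.natAdd l i) := fun i => Fin.ext (Nat.add_assoc k l i)
    change _ * (_ * _) = tensorMul (tensorMul a b) c fun i => v (Fin.cast (Nat.add_assoc k l n) i)
    simp only [tensorMul_apply, mul_assoc]
    exact congrArg₂ (· * ·) rfl (congrArg₂ (· * ·) rfl
      (congrArg c (funext fun i => congrArg v (h3 i).symm)))
  simp only [wedgeAlg_alternatization, h, alternatization_domDomCongr,
    AlternatingMap.domDomCongr_apply]
  rfl

/-- The permutation that moves a block of `k` letters past a block of `l` letters is a power of the
cyclic rotation of `k + l` letters; this gives its sign. -/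
theorem sign_finAddFlip_cast (k l : ℕ) :
    Equiv.Perm.sign ((finAddFlip : Fin (k + l) ≃ Fin (l + k)).trans
      (finCongr (Nat.add_comm l k))) = (-1) ^ (k * l) := by
  rcases Nat.eq_zero_or_pos (k + l) with h0 | h0
  · obtain ⟨rfl, rfl⟩ : k = 0 ∧ l = 0 := by omega
    have h : ((finAddFlip : Fin (0 + 0) ≃ Fin (0 + 0)).trans (finCongr (Nat.add_comm 0 0))) =
        (1 : Equiv.Perm (Fin (0 + 0))) := Equiv.ext fun i => i.elim0
    rw [h]
    simp
  have : NeZero (k + l) := ⟨h0.ne'⟩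
  have hpow : ∀ (j : ℕ) (i : Fin (k + l)), ((finRotate (k + l) ^ j) i : ℕ) = (i + j) % (k + l) := by
    intro j
    induction j with
    | zero => intro i; simp [Nat.mod_eq_of_lt i.2]
    | succ j ih =>
      intro i
      rw [pow_succ', Equiv.Perm.mul_apply, finRotate_apply, Fin.val_add, ih]
      simp [add_assoc]
  have h : (finAddFlip : Fin (k + l) ≃ Fin (l + k)).trans (finCongr (Nat.add_comm l k)) =
      finRotate (k + l) ^ l := by
    ext i
    rw [hpow]
    induction i using Fin.addCases with
    | left i =>
      have : (i : ℕ) + l < k + l := by omega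
      rw [Fin.val_castAdd, Nat.mod_eq_of_lt this]
      simp [add_comm]
    | right i => simp [add_right_comm k, Nat.mod_eq_of_lt (show (i : ℕ) < k + l by omega)]
  rw [h, map_pow, sign_finRotate, ← pow_mul]
  obtain ⟨n, hn⟩ : ∃ n, k + l = n + 1 := ⟨k + l - 1, by omega⟩
  rw [hn, Nat.add_sub_cancel]
  have : Even (n * l + k * l) := by
    have : n * l + k * l + l * (l + 1) = 2 * ((n + 1) * l) := by
      have : (k + l) * l = (n + 1) * l := by rw [hn]
      linarith
    have h2 := Nat.even_mul_succ_self l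
    by_contra hc
    rw [Nat.not_even_iff_odd] at hc
    have h3 := hc.add_even h2
    rw [this] at h3
    exact (Nat.not_even_iff_odd.2 h3) (even_two_mul _)
  rcases Nat.even_or_odd (k * l) with h1 | h1
  · rw [h1.neg_one_pow, ((Nat.even_add.1 this).2 h1).neg_one_pow]
  · rw [h1.neg_one_pow, Odd.neg_one_pow]
    rw [← Nat.not_even_iff_odd] at h1 ⊢
    exact fun h => h1 ((Nat.even_add.1 this).1 h)

theorem wedgeAlg_comm {k l : ℕ} (a : V [⋀^Fin k]→ₗ[ℝ] ℝ) (b : V [⋀^Fin l]→ₗ[ℝ] ℝ)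
    (v : Fin (k + l) → V) :
    wedgeAlg a b v = (-1) ^ (k * l) * wedgeAlg b a fun i => v (Fin.cast (Nat.add_comm l k) i) := by
  obtain ⟨a, rfl⟩ := exists_alternatization a
  obtain ⟨b, rfl⟩ := exists_alternatization b
  have h : tensorMul b a = (tensorMul a b).domDomCongr finAddFlip := by
    ext v
    change _ = tensorMul a b fun i => v (finAddFlip i)
    have h1 : ∀ i : Fin k, finAddFlip (Fin.castAdd l i) = Fin.natAdd l i := fun i =>
      finAddFlip_apply_castAdd i l
    have h2 : ∀ i : Fin l, finAddFlip (Fin.natAdd k i) = Fin.castAdd k i := fun i =>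
      finAddFlip_apply_natAdd i k
    rw [tensorMul_apply, tensorMul_apply, mul_comm]
    exact congrArg₂ (· * ·) (congrArg a (funext fun i => congrArg v (h1 i).symm))
      (congrArg b (funext fun i => congrArg v (h2 i).symm))
  simp only [wedgeAlg_alternatization, h, alternatization_domDomCongr,
    AlternatingMap.domDomCongr_apply]
  have h2 := (MultilinearMap.alternatization (tensorMul a b)).map_perm v
    ((finAddFlip : Fin (k + l) ≃ Fin (l + k)).trans (finCongr (Nat.add_comm l k)))
  rw [sign_finAddFlip_cast] at h2
  have h3 : ((fun i => v (Fin.cast (Nat.add_comm l k) i)) ∘ ⇑(finAddFlip (m := k) (n := l))) =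
      v ∘ ⇑((finAddFlip : Fin (k + l) ≃ Fin (l + k)).trans (finCongr (Nat.add_comm l k))) := rfl
  rw [h3, h2]
  rcases Nat.even_or_odd (k * l) with h | h <;> simp [h.neg_one_pow]

/-- If `A'` is pointwise the alternatization of `A`, then antisymmetrizing the first slot of `A'` is
the alternatization of `A` as a multilinear map of `k + 1` variables. -/
theorem alternatizeUncurryFin_alternatization {k : ℕ}
    (A : V →ₗ[ℝ] MultilinearMap ℝ (fun _ : Fin k => V) ℝ) (A' : V →ₗ[ℝ] V [⋀^Fin k]→ₗ[ℝ] ℝ)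
    (hA : ∀ x, A' x = MultilinearMap.alternatization (A x)) :
    AlternatingMap.alternatizeUncurryFin A' =
      MultilinearMap.alternatization (LinearMap.uncurryLeft A) := by
  ext v
  rw [AlternatingMap.alternatizeUncurryFin_apply, MultilinearMap.alternatization_apply]
  simp only [hA, MultilinearMap.alternatization_apply, Finset.smul_sum]
  rw [← Fintype.sum_prod_type'
    (f := fun (p : Fin (k + 1)) (σ : Equiv.Perm (Fin k)) => (-1) ^ (p : ℕ) •
      (Equiv.Perm.sign σ • (MultilinearMap.domDomCongr σ (A (v p))) (p.removeNth v)))]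
  -- A permutation of `k + 1` letters is uniquely a permutation of the last `k` letters, followed by
  -- the cycle that inserts the first letter at its image.
  have hbij : Function.Bijective fun q : Fin (k + 1) × Equiv.Perm (Fin k) =>
      q.1.cycleRange.symm * Equiv.Perm.decomposeFin.symm (0, q.2) := by
    rw [Fintype.bijective_iff_injective_and_card]
    constructor
    · rintro ⟨p, σ⟩ ⟨p', σ'⟩ h
      have h0 := congrArg (fun τ : Equiv.Perm (Fin (k + 1)) => τ 0) h
      simp only [Equiv.Perm.mul_apply, Equiv.Perm.decomposeFin_symm_apply_zero,
        Fin.cycleRange_symm_zero] at h0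
      subst h0
      have h1 := mul_left_cancel h
      simpa using h1
    · simp [Fintype.card_perm, Nat.factorial_succ]
  refine Fintype.sum_bijective _ hbij _ _ ?_
  rintro ⟨p, σ⟩
  have hs : Equiv.Perm.sign (p.cycleRange.symm * Equiv.Perm.decomposeFin.symm (0, σ)) =
      (-1) ^ (p : ℕ) * Equiv.Perm.sign σ := by
    rw [Equiv.Perm.sign_mul, Equiv.Perm.decomposeFin.symm_sign, if_pos rfl, one_mul,
      Equiv.Perm.sign_symm, Fin.sign_cycleRange]
  rw [hs, mul_smul]
  have harg : (MultilinearMap.domDomCongr σ (A (v p))) (p.removeNth v) =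
      (MultilinearMap.domDomCongr (p.cycleRange.symm * Equiv.Perm.decomposeFin.symm (0, σ))
        (LinearMap.uncurryLeft A)) v := by
    simp only [MultilinearMap.domDomCongr_apply, LinearMap.uncurryLeft_apply,
      Equiv.Perm.mul_apply, Equiv.Perm.decomposeFin_symm_apply_zero, Fin.cycleRange_symm_zero]
    congr 1
    ext i
    simp [Fin.tail, Fin.removeNth, Equiv.Perm.decomposeFin_symm_apply_succ]
  simp only [harg]
  rcases Nat.even_or_odd (p : ℕ) with h | h <;> simp [h.neg_one_pow]

end AlternatingAlgebra

/-! ### Exterior calculus on the manifold -/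

section AlternatingLeibniz

variable {V : Type*} [AddCommGroup V] [Module ℝ V]

/-- The wedge is bilinear; this is an algebraic fact, so any topology on `V` serves to apply
`wedgeAlg_bilin`. -/
theorem exists_wedgeAlg_bilin (k l : ℕ) :
    ∃ B : (V [⋀^Fin k]→ₗ[ℝ] ℝ) →ₗ[ℝ] (V [⋀^Fin l]→ₗ[ℝ] ℝ) →ₗ[ℝ] (V [⋀^Fin (k + l)]→ₗ[ℝ] ℝ),
      ∀ a b, B a b = wedgeAlg a b :=
  letI : TopologicalSpace V := ⊥
  wedgeAlg_bilin

/-- The Leibniz rule for alternating maps: antisymmetrizing the derivative of the left factor of a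
wedge over all slots gives the wedge with the antisymmetrized left factor. -/
theorem sum_wedgeAlg_left {k l : ℕ} (A : V →ₗ[ℝ] V [⋀^Fin k]→ₗ[ℝ] ℝ) (b : V [⋀^Fin l]→ₗ[ℝ] ℝ)
    (v : Fin (k + l + 1) → V) :
    ∑ i : Fin (k + l + 1), (-1 : ℝ) ^ (i : ℕ) * wedgeAlg (A (v i)) b (i.removeNth v) =
      wedgeAlg (AlternatingMap.alternatizeUncurryFin A) b
        fun i => v (Fin.cast (Nat.add_right_comm k 1 l) i) := by
  obtain ⟨b, rfl⟩ := exists_alternatization b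
  obtain ⟨B, hB⟩ := exists_wedgeAlg_bilin (V := V) k l
  let toMul : (V [⋀^Fin k]→ₗ[ℝ] ℝ) →ₗ[ℝ] MultilinearMap ℝ (fun _ : Fin k => V) ℝ :=
    { toFun := fun a => ((k.factorial : ℝ)⁻¹ • a).toMultilinearMap
      map_add' := fun a b => by ext v; simp
      map_smul' := fun c a => by ext v; simp [mul_left_comm] }
  have hlift : ∀ a, MultilinearMap.alternatization (toMul a) = a := fun a => by
    refine (AlternatingMap.coe_alternatization ((k.factorial : ℝ)⁻¹ • a)).trans ?_
    ext v
    simp [Fintype.card_fin, Nat.cast_ne_zero.2 k.factorial_ne_zero]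
  let T : MultilinearMap ℝ (fun _ : Fin k => V) ℝ →ₗ[ℝ]
      MultilinearMap ℝ (fun _ : Fin (k + l) => V) ℝ :=
    { toFun := fun a => tensorMul a b
      map_add' := fun a a' => by ext v; simp [tensorMul_apply, add_mul]
      map_smul' := fun c a => by ext v; simp [tensorMul_apply, mul_assoc] }
  have h1 := alternatizeUncurryFin_alternatization (toMul ∘ₗ A) A fun x => (hlift (A x)).symm
  have h2 := alternatizeUncurryFin_alternatization (T ∘ₗ toMul ∘ₗ A)
    (B.flip (MultilinearMap.alternatization b) ∘ₗ A) fun x => by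
      change B (A x) _ = MultilinearMap.alternatization (tensorMul (toMul (A x)) b)
      rw [hB, ← wedgeAlg_alternatization, hlift]
  have h3 := congrArg (fun f => f v) h2
  simp only [AlternatingMap.alternatizeUncurryFin_apply] at h3
  rw [h1, wedgeAlg_alternatization]
  have h4 : LinearMap.uncurryLeft (T ∘ₗ toMul ∘ₗ A) =
      (tensorMul (LinearMap.uncurryLeft (toMul ∘ₗ A)) b).domDomCongr
        (finCongr (Nat.add_right_comm k 1 l)) := by
    ext v
    rw [MultilinearMap.domDomCongr_apply, tensorMul_apply]
    change tensorMul (toMul (A (v 0))) b (Fin.tail v) = _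
    rw [tensorMul_apply]
    refine congrArg₂ (· * ·) rfl (congrArg b (funext fun i => congrArg v (Fin.ext ?_)))
    simp [add_right_comm]
  rw [h4, alternatization_domDomCongr] at h3
  refine Eq.trans ?_ h3
  refine Finset.sum_congr rfl fun i _ => ?_
  rw [LinearMap.comp_apply, LinearMap.flip_apply, hB]
  rcases Nat.even_or_odd (i : ℕ) with h | h <;> simp [h.neg_one_pow]

/-- The counterpart of `sum_wedgeAlg_left` for the right factor, obtained by graded commutativity. -/
theorem sum_wedgeAlg_right {k l : ℕ} (a : V [⋀^Fin k]→ₗ[ℝ] ℝ) (A : V →ₗ[ℝ] V [⋀^Fin l]→ₗ[ℝ] ℝ)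
    (v : Fin (k + l + 1) → V) :
    ∑ i : Fin (k + l + 1), (-1 : ℝ) ^ (i : ℕ) * wedgeAlg a (A (v i)) (i.removeNth v) =
      (-1) ^ k * wedgeAlg (l := l + 1) a (AlternatingMap.alternatizeUncurryFin A) v := by
  have hcast : ∀ {n n' : ℕ} (h : n' = n) (v : Fin (n + 1) → V) (F : V → (Fin n' → V) → ℝ),
      ∑ i : Fin (n + 1), (-1 : ℝ) ^ (i : ℕ) *
          F (v i) (fun j => i.removeNth v (Fin.cast h j)) =
        ∑ i : Fin (n' + 1), (-1 : ℝ) ^ (i : ℕ) * F (v (Fin.cast (congrArg (· + 1) h) i))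
          (i.removeNth fun j => v (Fin.cast (congrArg (· + 1) h) j)) := by
    intro n n' h v F
    subst h
    rfl
  have h1 : ∀ i : Fin (k + l + 1), (-1 : ℝ) ^ (i : ℕ) * wedgeAlg a (A (v i)) (i.removeNth v) =
      (-1) ^ (k * l) * ((-1 : ℝ) ^ (i : ℕ) * wedgeAlg (A (v i)) a
        fun j => i.removeNth v (Fin.cast (Nat.add_comm l k) j)) := fun i => by
    rw [wedgeAlg_comm]; ring
  rw [Finset.sum_congr rfl fun i _ => h1 i, ← Finset.mul_sum,
    hcast (Nat.add_comm l k) v fun x w => wedgeAlg (A x) a w, sum_wedgeAlg_left, wedgeAlg_comm a]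
  rw [← mul_assoc, ← pow_add, mul_add_one, add_left_comm, pow_add _ (k * l), ← two_mul k,
    pow_mul (-1 : ℝ) 2 k]
  simp

end AlternatingLeibniz

section SmoothLeibniz

variable {m : ℕ}

/-- The graded Leibniz rule for forms on a coordinate space, at a point of differentiability. -/
theorem extDeriv_wedgePt {k l : ℕ} {f : Coord m → Coord m [⋀^Fin k]→L[ℝ] ℝ}
    {g : Coord m → Coord m [⋀^Fin l]→L[ℝ] ℝ} {z : Coord m} (hf : DifferentiableAt ℝ f z)
    (hg : DifferentiableAt ℝ g z) (v : Fin (k + l + 1) → Coord m) :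
    extDeriv (fun z => wedgePt (f z) (g z)) z v =
      wedgePt (extDeriv f z) (g z) (fun i => v (Fin.cast (Nat.add_right_comm k 1 l) i)) +
        (-1) ^ k * wedgePt (l := l + 1) (f z) (extDeriv g z) v := by
  have := finite_alt m k
  have := finite_alt m l
  have hB := (wedgePtBilin m k l).toContinuousBilinearMap.isBoundedBilinearMap
  have hd0 : HasFDerivAt (fun p : (Coord m [⋀^Fin k]→L[ℝ] ℝ) × (Coord m [⋀^Fin l]→L[ℝ] ℝ) =>
      wedgePt p.1 p.2) (hB.deriv (f z, g z)) (f z, g z) := hB.hasFDerivAt (f z, g z)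
  have hd : HasFDerivAt (fun z => wedgePt (f z) (g z))
      ((hB.deriv (f z, g z)).comp ((fderiv ℝ f z).prod (fderiv ℝ g z))) z :=
    HasFDerivAt.comp (f := fun z => (f z, g z)) z hd0 (hf.hasFDerivAt.prodMk hg.hasFDerivAt)
  let A : Coord m →ₗ[ℝ] Coord m [⋀^Fin k]→ₗ[ℝ] ℝ :=
    { toFun := fun x => (fderiv ℝ f z x).toAlternatingMap
      map_add' := fun x y => by rw [map_add]; rfl
      map_smul' := fun c x => by rw [map_smul]; rfl }
  let A' : Coord m →ₗ[ℝ] Coord m [⋀^Fin l]→ₗ[ℝ] ℝ :=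
    { toFun := fun x => (fderiv ℝ g z x).toAlternatingMap
      map_add' := fun x y => by rw [map_add]; rfl
      map_smul' := fun c x => by rw [map_smul]; rfl }
  have h1 := sum_wedgeAlg_left A (g z).toAlternatingMap v
  have h2 := sum_wedgeAlg_right (f z).toAlternatingMap A' v
  have hA : (extDeriv f z).toAlternatingMap = AlternatingMap.alternatizeUncurryFin A := by
    ext w
    change extDeriv f z w = _
    rw [extDeriv, ContinuousAlternatingMap.alternatizeUncurryFin_apply,
      AlternatingMap.alternatizeUncurryFin_apply]
    rfl
  have hA' : (extDeriv g z).toAlternatingMap = AlternatingMap.alternatizeUncurryFin A' := by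
    ext w
    change extDeriv g z w = _
    rw [extDeriv, ContinuousAlternatingMap.alternatizeUncurryFin_apply,
      AlternatingMap.alternatizeUncurryFin_apply]
    rfl
  change _ = wedgeAlg (extDeriv f z).toAlternatingMap _ _ +
    (-1) ^ k * wedgeAlg (l := l + 1) _ (extDeriv g z).toAlternatingMap _
  rw [hA, hA', ← h1, ← h2, extDeriv, hd.fderiv,
    ContinuousAlternatingMap.alternatizeUncurryFin_apply, ← Finset.sum_add_distrib]
  refine Finset.sum_congr rfl fun i _ => ?_
  have h3 : ((hB.deriv (f z, g z)).comp ((fderiv ℝ f z).prod (fderiv ℝ g z))) (v i) =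
      wedgePt (f z) (fderiv ℝ g z (v i)) + wedgePt (fderiv ℝ f z (v i)) (g z) := rfl
  rw [h3]
  change (-1 : ℤ) ^ (i : ℕ) • (wedgeAlg (f z).toAlternatingMap (A' (v i)) (i.removeNth v) +
    wedgeAlg (A (v i)) (g z).toAlternatingMap (i.removeNth v)) = _
  rcases Nat.even_or_odd (i : ℕ) with h | h <;> simp [h.neg_one_pow] <;> ring

variable {M : Type*} [TopologicalSpace M] [ChartedSpace (Coord m) M]

theorem DForm.eq_zero_of_lt {k : ℕ} (h : m < k) (η : DForm m M k) : η = 0 := by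
  refine Subtype.ext (funext fun x => ?_)
  ext v
  have : FiniteDimensional ℝ (TangentSpace (𝓡 m) x) :=
    inferInstanceAs (FiniteDimensional ℝ (Coord m))
  refine (η.1 x).toAlternatingMap.map_linearDependent v fun hv => ?_
  have := hv.fintype_card_le_finrank
  have h2 : Module.finrank ℝ (TangentSpace (𝓡 m) x) = m := finrank_euclideanSpace_fin
  rw [h2, Fintype.card_fin] at this
  omega

/-- Forms whose degrees are equal but not definitionally so, and which agree up to reindexing of the
arguments, are equal as inhomogeneous forms. -/
theorem ofDeg_eq_of_cast {k l : ℕ} (h : l = k) (η : DForm m M k) (θ : DForm m M l)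
    (hv : ∀ x (v : Fin k → TangentSpace (𝓡 m) x), η.1 x v = θ.1 x fun i => v (Fin.cast h i)) :
    ofDeg m M k η = ofDeg m M l θ := by
  subst h
  congr 1
  refine Subtype.ext (funext fun x => ?_)
  ext v
  exact hv x v

theorem Forms.hom_ext {W : Type*} [AddCommGroup W] [Module ℝ W] {f g : Forms m M →ₗ[ℝ] W}
    (h : ∀ k η, f (ofDeg m M k η) = g (ofDeg m M k η)) : f = g :=
  DirectSum.linearMap_ext ℝ fun k => LinearMap.ext fun η => h k η

theorem Forms.lift_ofDeg {W : Type*} [AddCommGroup W] [Module ℝ W]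
    (f : (k : ℕ) → DForm m M k →ₗ[ℝ] W) (k : ℕ) (η : DForm m M k) :
    Forms.lift m M f (ofDeg m M k η) = f k η :=
  DirectSum.toModule_lof ℝ k η

theorem component_ofDeg_self (k : ℕ) (η : DForm m M k) :
    component m M k (ofDeg m M k η) = η :=
  DirectSum.component.lof_self ℝ (M := fun k => DForm m M k) k η

theorem component_ofDeg_of_ne {k p : ℕ} (h : k ≠ p) (η : DForm m M k) :
    component m M p (ofDeg m M k η) = 0 := by
  have := DirectSum.component.of ℝ (M := fun k => DForm m M k) p k η
  rw [dif_neg h] at this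
  exact this

theorem degProj_ofDeg (k p : ℕ) (η : DForm m M k) :
    degProj m M p (ofDeg m M k η) = if k = p then ofDeg m M k η else 0 := by
  rw [degProj, LinearMap.comp_apply]
  split_ifs with h
  · subst h; rw [component_ofDeg_self]
  · rw [component_ofDeg_of_ne h, map_zero]

theorem degParity_ofDeg (k : ℕ) (η : DForm m M k) :
    degParity m M (ofDeg m M k η) = ((-1 : ℝ) ^ k) • ofDeg m M k η :=
  Forms.lift_ofDeg _ _ _

variable [IsManifold (𝓡 m) ∞ M]

/-- A form is recovered at `x` from its representative in the chart at `x`. -/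
theorem chartRep_self {k : ℕ} (η : RawForm m M k) (x : M) :
    (chartRep η x (extChartAt (𝓡 m) x x)).compContinuousLinearMap
      (mfderiv (𝓡 m) 𝓘(ℝ, Coord m) (extChartAt (𝓡 m) x) x) = η x := by
  have hx := mem_extChartAt_source (I := 𝓡 m) x
  rw [chartRep, mfderiv_symm_eq (mem_extChartAt_target x), mfderiv_chart_eq hx]
  have h := (extChartAt (𝓡 m) x).left_inv hx
  ext v
  change (η ((extChartAt (𝓡 m) x).symm (extChartAt (𝓡 m) x x))) _ = η x v
  rw [h]
  refine congrArg (η x) (funext fun i => ?_)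
  change tangentCoordChange (𝓡 m) x x x (tangentCoordChange (𝓡 m) x x x (v i)) = v i
  exact (congrArg _ (tangentCoordChange_self hx)).trans (tangentCoordChange_self hx)

theorem chartRep_rawWedge {k l : ℕ} (η : RawForm m M k) (θ : RawForm m M l) (x : M) :
    chartRep (rawWedge η θ) x = fun z => wedgePt (chartRep η x z) (chartRep θ x z) :=
  funext fun z => wedgePt_comp (η ((extChartAt (𝓡 m) x).symm z))
    (θ ((extChartAt (𝓡 m) x).symm z)) (mfderiv 𝓘(ℝ, Coord m) (𝓡 m) (extChartAt (𝓡 m) x).symm z)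

theorem rawD_rawWedge {k l : ℕ} {η : RawForm m M k} {θ : RawForm m M l} (hη : IsSmoothForm η)
    (hθ : IsSmoothForm θ) (x : M) (v : Fin (k + l + 1) → TangentSpace (𝓡 m) x) :
    rawD (rawWedge η θ) x v =
      rawWedge (rawD η) θ x (fun i => v (Fin.cast (Nat.add_right_comm k 1 l) i)) +
        (-1) ^ k * rawWedge (l := l + 1) η (rawD θ) x v := by
  set L := mfderiv (𝓡 m) 𝓘(ℝ, Coord m) (extChartAt (𝓡 m) x) x with hL
  have h := extDeriv_wedgePt (differentiableAt_chartRep hη x) (differentiableAt_chartRep hθ x)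
    fun i => L (v i)
  rw [rawD, chartRep_rawWedge]
  refine h.trans ?_
  have h1 : rawWedge (rawD η) θ x = (wedgePt (extDeriv (chartRep η x) (extChartAt (𝓡 m) x x))
      (chartRep θ x (extChartAt (𝓡 m) x x))).compContinuousLinearMap L := by
    refine Eq.trans ?_ (wedgePt_comp (extDeriv (chartRep η x) (extChartAt (𝓡 m) x x))
      (chartRep θ x (extChartAt (𝓡 m) x x)) L).symm
    exact congrArg (wedgePt _) (chartRep_self θ x).symm
  have h2 : rawWedge η (rawD θ) x = (wedgePt (chartRep η x (extChartAt (𝓡 m) x x))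
      (extDeriv (chartRep θ x) (extChartAt (𝓡 m) x x))).compContinuousLinearMap L := by
    refine Eq.trans ?_ (wedgePt_comp (chartRep η x (extChartAt (𝓡 m) x x))
      (extDeriv (chartRep θ x) (extChartAt (𝓡 m) x x)) L).symm
    exact congrArg (fun a => wedgePt a (rawD θ x)) (chartRep_self η x).symm
  rw [h1, h2]
  rfl

theorem rawD_rawD {k : ℕ} {η : RawForm m M k} (hη : IsSmoothForm η) : rawD (rawD η) = 0 := by
  funext x
  have hev : chartRep (rawD η) x =ᶠ[nhds (extChartAt (𝓡 m) x x)] extDeriv (chartRep η x) := by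
    filter_upwards [(isOpen_target x).mem_nhds (mem_extChartAt_target x)] with z hz
    exact chartRep_rawD hη hz
  have h1 : extDeriv (chartRep (rawD η) x) (extChartAt (𝓡 m) x x) = 0 := by
    rw [extDeriv, hev.fderiv_eq, ← extDeriv]
    exact extDeriv_extDeriv_apply ((hη x).contDiffAt
      ((isOpen_target x).mem_nhds (mem_extChartAt_target x))) (by
        simpa using WithTop.coe_le_coe.2 (le_top : (2 : ℕ∞) ≤ ⊤))
  rw [rawD, h1]
  rfl

variable (m M) in
theorem totalD_ofDeg (k : ℕ) (η : DForm m M k) :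
    totalD m M (ofDeg m M k η) = ofDeg m M (k + 1) (extD m M k η) :=
  Forms.lift_ofDeg _ _ _

variable (m M) in
theorem totalWedge_ofDeg (k l : ℕ) (η : DForm m M k) (θ : DForm m M l) :
    totalWedge m M (ofDeg m M k η) (ofDeg m M l θ) = ofDeg m M (k + l) (wedge m M k l η θ) := by
  rw [totalWedge, Forms.lift_ofDeg, LinearMap.flip_apply, Forms.lift_ofDeg]
  rfl

theorem totalWedge_assoc (x y z : Forms m M) :
    totalWedge m M (totalWedge m M x y) z = totalWedge m M x (totalWedge m M y z) := by
  have h : (totalWedge m M).compr₂ (totalWedge m M) =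
      ((LinearMap.llcomp ℝ _ _ _).flip (totalWedge m M)).comp
        ((LinearMap.llcomp ℝ _ _ _).comp (totalWedge m M)) := by
    refine Forms.hom_ext fun k η => Forms.hom_ext fun l θ => Forms.hom_ext fun n ζ => ?_
    change totalWedge m M (totalWedge m M (ofDeg m M k η) (ofDeg m M l θ)) (ofDeg m M n ζ) =
      totalWedge m M (ofDeg m M k η) (totalWedge m M (ofDeg m M l θ) (ofDeg m M n ζ))
    simp only [totalWedge_ofDeg]
    exact ofDeg_eq_of_cast (Nat.add_assoc k l n).symm _ _ fun x v => wedgeAlg_assoc _ _ _ v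
  exact congrArg (fun f => f x y z) h

theorem totalWedge_comm_ofDeg {k l : ℕ} (η : DForm m M k) (θ : DForm m M l) :
    totalWedge m M (ofDeg m M k η) (ofDeg m M l θ) =
      ((-1 : ℝ) ^ (k * l)) • totalWedge m M (ofDeg m M l θ) (ofDeg m M k η) := by
  rw [totalWedge_ofDeg, totalWedge_ofDeg, ← (ofDeg m M (l + k)).map_smul]
  exact ofDeg_eq_of_cast (Nat.add_comm l k) _ _ fun x v => wedgeAlg_comm _ _ v

theorem totalD_wedge_ofDeg {k l : ℕ} (η : DForm m M k) (θ : DForm m M l) :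
    totalD m M (totalWedge m M (ofDeg m M k η) (ofDeg m M l θ)) =
      totalWedge m M (totalD m M (ofDeg m M k η)) (ofDeg m M l θ) +
        ((-1 : ℝ) ^ k) • totalWedge m M (ofDeg m M k η) (totalD m M (ofDeg m M l θ)) := by
  simp only [totalWedge_ofDeg, totalD_ofDeg]
  have h : ofDeg m M (k + 1 + l) (wedge m M (k + 1) l (extD m M k η) θ) =
      ofDeg m M (k + l + 1) (extD m M (k + l) (wedge m M k l η θ) -
        ((-1 : ℝ) ^ k) • wedge m M k (l + 1) η (extD m M l θ)) := by
    refine (ofDeg_eq_of_cast (Nat.add_right_comm k 1 l) _ _ fun x v => ?_).symm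
    exact sub_eq_of_eq_add (rawD_rawWedge η.2 θ.2 x v)
  rw [h, map_sub, map_smul]
  exact (sub_add_cancel _ _).symm

end SmoothLeibniz

/-! ### Stokes' theorem -/

section Stokes

variable {m : ℕ}

/-- The standard frame of `ℝ^m`. -/
def stdFrame (m : ℕ) (i : Fin m) : Coord m := EuclideanSpace.single i 1

theorem apply_comp_stdFrame (a : Coord m [⋀^Fin m]→L[ℝ] ℝ) (L : Coord m →L[ℝ] Coord m) :
    (a fun i => L (stdFrame m i)) = L.det * a (stdFrame m) := by
  set e := (EuclideanSpace.basisFun (Fin m) ℝ).toBasis with he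
  have hstd : (e : Fin m → Coord m) = stdFrame m := by
    ext i
    simp [he, stdFrame]
  have h := a.toAlternatingMap.eq_smul_basis_det e
  have h1 : ∀ v, a v = a (stdFrame m) * e.det v := fun v => by
    have := congrArg (fun f => f v) h
    rw [hstd] at this
    exact this
  rw [h1, show (fun i => L (stdFrame m i)) = (L : Coord m →ₗ[ℝ] Coord m) ∘ e by rw [hstd]; rfl,
    Module.Basis.det_comp, Module.Basis.det_self]
  simp [mul_comm]

theorem integral_fderiv_eq_zero {u : Coord m → ℝ} (hu : ContDiff ℝ 1 u) (hc : HasCompactSupport u)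
    (v : Coord m) : ∫ z, fderiv ℝ u z v = 0 := by
  have hcont : Continuous fun z => fderiv ℝ u z v :=
    (hu.continuous_fderiv (by simp)).clm_apply continuous_const
  have hc' : HasCompactSupport fun z => fderiv ℝ u z v := hc.fderiv_apply ℝ v
  have h := integral_mul_fderiv_eq_neg_fderiv_mul_of_integrable (μ := volume) (f := fun _ => (1 : ℝ))
    (g := u) (v := v) (by simp)
    (by simpa using hcont.integrable_of_hasCompactSupport hc')
    (by simpa using hu.continuous.integrable_of_hasCompactSupport hc)
    (fun _ _ => differentiableAt_const _)
    (fun x _ => hu.differentiable (by simp) x)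
  simpa using h

/-- Stokes' theorem for compactly supported forms on `ℝ^(n+1)`. -/
theorem integral_extDeriv_eq_zero {n : ℕ} {w : Coord (n + 1) → Coord (n + 1) [⋀^Fin n]→L[ℝ] ℝ}
    (hw : ContDiff ℝ 1 w) (hc : HasCompactSupport w) :
    ∫ z, extDeriv w z (stdFrame (n + 1)) = 0 := by
  have happ : ∀ v : Fin n → Coord (n + 1), ContDiff ℝ 1 fun z => w z v := fun v =>
    (ContinuousAlternatingMap.apply ℝ (Coord (n + 1)) ℝ v).contDiff.comp hw
  have hsupp : ∀ v : Fin n → Coord (n + 1), HasCompactSupport fun z => w z v := fun v =>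
    hc.comp_left (g := fun a : Coord (n + 1) [⋀^Fin n]→L[ℝ] ℝ => a v) rfl
  have hfd : ∀ (v : Fin n → Coord (n + 1)) z x, fderiv ℝ (fun z => w z v) z x =
      fderiv ℝ w z x v := fun v z x => by
    have h1 := ((ContinuousAlternatingMap.apply ℝ (Coord (n + 1)) ℝ v).hasFDerivAt.comp z
      (hw.differentiable (by simp) z).hasFDerivAt).fderiv
    exact congrArg (fun f => f x) h1
  have hexp : ∀ z, extDeriv w z (stdFrame (n + 1)) = ∑ i : Fin (n + 1), (-1 : ℝ) ^ (i : ℕ) *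
      fderiv ℝ (fun z => w z (i.removeNth (stdFrame (n + 1)))) z (stdFrame (n + 1) i) := fun z => by
    rw [extDeriv, ContinuousAlternatingMap.alternatizeUncurryFin_apply]
    refine Finset.sum_congr rfl fun i _ => ?_
    rw [hfd]
    rcases Nat.even_or_odd (i : ℕ) with h | h <;> simp [h.neg_one_pow]
  simp only [hexp]
  rw [integral_finsetSum]
  · refine Finset.sum_eq_zero fun i _ => ?_
    rw [integral_const_mul, integral_fderiv_eq_zero (happ _) (hsupp _), mul_zero]
  · intro i _
    refine Integrable.const_mul ?_ _
    exact (((happ _).continuous_fderiv (by simp)).clm_apply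
      continuous_const).integrable_of_hasCompactSupport ((hsupp _).fderiv_apply ℝ _)

variable {M : Type*} [TopologicalSpace M] [ChartedSpace (Coord m) M]

/-- The coefficient of `dz₁ ∧ ⋯ ∧ dz_m` in the chart at `x`. -/
def topCoeff (η : RawForm m M m) (x : M) (z : Coord m) : ℝ := chartRep η x z (stdFrame m)

/-- The part of the target of the chart at `x` that is also covered by the chart at `y`. -/
def overlap (m : ℕ) {M : Type*} [TopologicalSpace M] [ChartedSpace (Coord m) M] (x y : M) :
    Set (Coord m) :=
  (extChartAt (𝓡 m) x).target ∩ (extChartAt (𝓡 m) x).symm ⁻¹' (extChartAt (𝓡 m) y).source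

theorem image_overlap (x y : M) :
    (extChartAt (𝓡 m) y ∘ (extChartAt (𝓡 m) x).symm) '' overlap m x y = overlap m y x := by
  ext w
  constructor
  · rintro ⟨z, ⟨hz, hz'⟩, rfl⟩
    refine ⟨(extChartAt (𝓡 m) y).map_source hz', ?_⟩
    simp only [Function.comp_apply, Set.mem_preimage, (extChartAt (𝓡 m) y).left_inv hz']
    exact (extChartAt (𝓡 m) x).map_target hz
  · rintro ⟨hw, hw'⟩
    refine ⟨extChartAt (𝓡 m) x ((extChartAt (𝓡 m) y).symm w),
      ⟨(extChartAt (𝓡 m) x).map_source hw', ?_⟩, ?_⟩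
    · simp only [Set.mem_preimage, (extChartAt (𝓡 m) x).left_inv hw']
      exact (extChartAt (𝓡 m) y).map_target hw
    · simp only [Function.comp_apply, (extChartAt (𝓡 m) x).left_inv hw']
      exact (extChartAt (𝓡 m) y).right_inv hw

theorem isOpen_overlap (x y : M) : IsOpen (overlap m x y) :=
  (continuousOn_extChartAt_symm x).isOpen_inter_preimage (isOpen_target x)
    (isOpen_extChartAt_source y)

theorem injOn_overlap (x y : M) :
    Set.InjOn (extChartAt (𝓡 m) y ∘ (extChartAt (𝓡 m) x).symm) (overlap m x y) := by
  rintro z ⟨hz, hz'⟩ w ⟨hw, hw'⟩ h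
  have h1 := (extChartAt (𝓡 m) y).injOn hz' hw' h
  exact (extChartAt (𝓡 m) x).symm.injOn hz hw h1

theorem det_pos_of_mem_overlap (hM : OrientedCharts m M) {x y : M} {z : Coord m}
    (hz : z ∈ overlap m x y) :
    0 < (fderiv ℝ (extChartAt (𝓡 m) y ∘ (extChartAt (𝓡 m) x).symm) z).det := by
  have h := hM x y z (by
    obtain ⟨h1, h2⟩ := hz
    simp only [mfld_simps] at h1 h2 ⊢
    exact ⟨h1, h2⟩)
  have he : (extChartAt (𝓡 m) y ∘ (extChartAt (𝓡 m) x).symm : Coord m → Coord m) =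
      chartAt (Coord m) y ∘ (chartAt (Coord m) x).symm := by
    ext w
    simp only [mfld_simps]
  rw [he]
  exact h

variable [IsManifold (𝓡 m) ∞ M]

/-- The integral of a form of top degree over the overlap of two charts does not depend on the chart:
because of the orientation, the Jacobian in the change of variables is its own absolute value. -/
theorem setIntegral_overlap (hM : OrientedCharts m M) (η : RawForm m M m) (x y : M) :
    ∫ z in overlap m y x, topCoeff η y z = ∫ z in overlap m x y, topCoeff η x z := by
  set τ := extChartAt (𝓡 m) y ∘ (extChartAt (𝓡 m) x).symm with hτ
  have hder : ∀ z ∈ overlap m x y, HasFDerivWithinAt τ (fderiv ℝ τ z) (overlap m x y) z := by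
    rintro z ⟨hz, hz'⟩
    have := contDiffWithinAt_ext_coord_change (I := 𝓡 m) (n := ∞) y x (y := z) (by
      rw [PartialEquiv.trans_source, PartialEquiv.symm_source]; exact ⟨hz, hz'⟩)
    rw [modelWithCornersSelf_coe, Set.range_id, contDiffWithinAt_univ] at this
    exact (this.differentiableAt (by simp)).hasFDerivAt.hasFDerivWithinAt
  rw [← image_overlap x y, integral_image_eq_integral_abs_det_fderiv_smul volume
    (isOpen_overlap x y).measurableSet hder (injOn_overlap x y)]
  refine setIntegral_congr_fun (isOpen_overlap x y).measurableSet fun z hz => ?_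
  have h1 : topCoeff η x z = (fderiv ℝ τ z).det * topCoeff η y (τ z) := by
    rw [topCoeff, chartRep_transition η hz.1 hz.2]
    exact apply_comp_stdFrame (chartRep η y (τ z)) (fderiv ℝ τ z)
  have h2 : |(fderiv ℝ τ z).det| = (fderiv ℝ τ z).det := abs_of_pos (det_pos_of_mem_overlap hM hz)
  simp only [h1, smul_eq_mul, h2]

variable (m) in
/-- The product of a smooth function and a smooth form. -/
def smulForm {k : ℕ} (f : C^∞⟮𝓡 m, M; 𝓘(ℝ, ℝ), ℝ⟯) (η : DForm m M k) : DForm m M k :=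
  ⟨fun p => f p • η.1 p, fun x => by
    have h1 : ContDiffOn ℝ ∞ (fun z => f ((extChartAt (𝓡 m) x).symm z))
        (extChartAt (𝓡 m) x).target :=
      contMDiffOn_iff_contDiffOn.1 (f.contMDiff.comp_contMDiffOn (contMDiffOn_extChartAt_symm x))
    exact h1.smul (η.2 x)⟩

/-- The exterior derivative is local: it vanishes off any closed set off which the form vanishes. -/
theorem rawD_eq_zero {k : ℕ} {η : RawForm m M k} {K : Set M} (hK : IsClosed K)
    (h0 : ∀ p ∉ K, η p = 0) {p : M} (hp : p ∉ K) : rawD η p = 0 := by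
  have hev : chartRep η p =ᶠ[nhds (extChartAt (𝓡 m) p p)] 0 := by
    have hc : ContinuousAt (extChartAt (𝓡 m) p).symm (extChartAt (𝓡 m) p p) :=
      continuousAt_extChartAt_symm p
    filter_upwards [hc.preimage_mem_nhds (hK.isOpen_compl.mem_nhds (by
      simpa using hp))] with z hz
    rw [chartRep, h0 _ hz]
    rfl
  rw [rawD, extDeriv, hev.fderiv_eq]
  simp only [Pi.zero_def, fderiv_fun_const]
  change (ContinuousAlternatingMap.alternatizeUncurryFin 0).compContinuousLinearMap _ = 0
  rw [← ContinuousAlternatingMap.alternatizeUncurryFinCLM_apply, map_zero]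
  rfl

theorem chartRep_eq_zero {k : ℕ} {η : RawForm m M k} {x : M} {z : Coord m}
    (h : η ((extChartAt (𝓡 m) x).symm z) = 0) : chartRep η x z = 0 := by
  rw [chartRep, h]; rfl

variable [T2Space M] [CompactSpace M]

theorem isCompact_image_chart {K : Set M} (hK : IsClosed K) {x : M}
    (hs : K ⊆ (extChartAt (𝓡 m) x).source) : IsCompact (extChartAt (𝓡 m) x '' K) :=
  hK.isCompact.image_of_continuousOn ((continuousOn_extChartAt x).mono hs)

theorem integrableOn_topCoeff {K : Set M} (hK : IsClosed K) {x : M}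
    (hs : K ⊆ (extChartAt (𝓡 m) x).source) (η : DForm m M m) (h0 : ∀ p ∉ K, η.1 p = 0) :
    IntegrableOn (topCoeff η.1 x) (extChartAt (𝓡 m) x).target := by
  have hKt : extChartAt (𝓡 m) x '' K ⊆ (extChartAt (𝓡 m) x).target := by
    rintro _ ⟨p, hp, rfl⟩; exact (extChartAt (𝓡 m) x).map_source (hs hp)
  have hcont : ContinuousOn (topCoeff η.1 x) (extChartAt (𝓡 m) x).target :=
    (ContinuousAlternatingMap.apply ℝ (Coord m) ℝ (stdFrame m)).continuous.comp_continuousOn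
      (η.2 x).continuousOn
  refine ((hcont.mono hKt).integrableOn_compact
    (isCompact_image_chart hK hs)).of_forall_sdiff_eq_zero
    (isOpen_target x).measurableSet fun z hz => ?_
  rw [topCoeff, chartRep_eq_zero (h0 _ fun h => hz.2 ⟨_, h, (extChartAt (𝓡 m) x).right_inv hz.1⟩)]
  rfl

theorem sum_unityPartition (p : M) :
    ∑ x ∈ (finite_support_unityPartition (m := m) (M := M)).toFinset, unityPartition m M x p = 1 := by
  refine (unityPartition m M).sum_finsupport' p (Set.mem_univ p) ?_
  intro y hy
  rw [Set.Finite.mem_toFinset, Function.mem_support]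
  intro h
  exact ((SmoothPartitionOfUnity.mem_finsupport _ _).1 hy) (congrFun h p)

/-- The integral of a top form supported in one chart is computed in that chart. -/
theorem formIntegral_eq_chart (hM : OrientedCharts m M) {K : Set M} (hK : IsClosed K) {x : M}
    (hs : K ⊆ (extChartAt (𝓡 m) x).source) (η : DForm m M m) (h0 : ∀ p ∉ K, η.1 p = 0) :
    formIntegral m M η = ∫ z in (extChartAt (𝓡 m) x).target, topCoeff η.1 x z := by
  set I : Finset M := (finite_support_unityPartition (m := m) (M := M)).toFinset with hI
  have hI0 : ∀ y ∉ I, ∀ p, unityPartition m M y p = 0 := fun y hy p => by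
    simp only [hI, Set.Finite.mem_toFinset, Function.mem_support, not_not] at hy
    exact congrFun hy p
  -- Each summand is an integral over an overlap, where it can be moved to the chart at `x`.
  have hterm : ∀ y, ∫ z in (extChartAt (𝓡 m) y).target, chartDensity η y z =
      ∫ z in (extChartAt (𝓡 m) x).target,
        topCoeff (smulForm m (unityPartition m M y) η).1 x z := fun y => by
    have e1 : ∫ z in (extChartAt (𝓡 m) y).target, chartDensity η y z =
        ∫ z in overlap m y x, topCoeff (smulForm m (unityPartition m M y) η).1 y z := by
      refine (setIntegral_eq_of_subset_of_forall_sdiff_eq_zero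
        (isOpen_target y).measurableSet Set.inter_subset_left fun z hz => ?_)
      rw [chartDensity, chartRep_eq_zero (h0 _ fun h => hz.2 ⟨hz.1, hs h⟩)]
      exact mul_zero _
    rw [e1, setIntegral_overlap hM]
    refine (setIntegral_eq_of_subset_of_forall_sdiff_eq_zero
        (isOpen_target x).measurableSet Set.inter_subset_left fun z hz => ?_).symm
    have hz0 : unityPartition m M y ((extChartAt (𝓡 m) x).symm z) = 0 := by
      by_contra h
      refine hz.2 ⟨hz.1, ?_⟩
      have := unityPartition_subordinate y (subset_tsupport _ h)
      simpa using this
    rw [topCoeff, chartRep_eq_zero]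
    · rfl
    · change unityPartition m M y ((extChartAt (𝓡 m) x).symm z) • _ = _
      rw [hz0, zero_smul]
  change ∑ᶠ y : M, ∫ z in (extChartAt (𝓡 m) y).target, chartDensity η y z = _
  simp only [hterm]
  rw [finsum_eq_sum_of_support_subset (s := I) _ fun y hy => by
    by_contra hyI
    refine hy ?_
    refine (setIntegral_congr_fun (isOpen_target x).measurableSet fun z _ => ?_).trans
      (integral_zero _ _)
    rw [topCoeff, chartRep_eq_zero]
    · rfl
    · change unityPartition m M y ((extChartAt (𝓡 m) x).symm z) • _ = _
      rw [hI0 y hyI, zero_smul]]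
  rw [← integral_finsetSum]
  · refine setIntegral_congr_fun (isOpen_target x).measurableSet fun z _ => ?_
    have h1 : ∀ y, topCoeff (smulForm m (unityPartition m M y) η).1 x z =
        unityPartition m M y ((extChartAt (𝓡 m) x).symm z) * topCoeff η.1 x z := fun y => rfl
    simp only [h1]
    rw [← Finset.sum_mul, hI, sum_unityPartition, one_mul]
  · intro y _
    refine integrableOn_topCoeff hK hs _ fun p hp => ?_
    change _ • η.1 p = 0
    rw [h0 p hp, smul_zero]

end Stokes

section StokesTheorem

variable {n : ℕ} {M : Type*} [TopologicalSpace M] [ChartedSpace (Coord (n + 1)) M]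
  [IsManifold (𝓡 (n + 1)) ∞ M] [T2Space M] [CompactSpace M]

/-- Stokes' theorem for a form supported in a single chart: its representative, extended by zero, is
smooth with compact support. -/
theorem setIntegral_topCoeff_rawD {K : Set M} (hK : IsClosed K) {x : M}
    (hs : K ⊆ (extChartAt (𝓡 (n + 1)) x).source) (η : DForm (n + 1) M n)
    (h0 : ∀ p ∉ K, η.1 p = 0) :
    ∫ z in (extChartAt (𝓡 (n + 1)) x).target, topCoeff (rawD η.1) x z = 0 := by
  classical
  set e := extChartAt (𝓡 (n + 1)) x with he
  have hcK := isCompact_image_chart hK hs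
  set w : Coord (n + 1) → Coord (n + 1) [⋀^Fin n]→L[ℝ] ℝ :=
    e.target.indicator (chartRep η.1 x) with hw
  have hw0 : ∀ z ∉ e '' K, w z = 0 := fun z hz => by
    by_cases hzt : z ∈ e.target
    · rw [hw, Set.indicator_of_mem hzt]
      exact chartRep_eq_zero (h0 _ fun h => hz ⟨_, h, e.right_inv hzt⟩)
    · exact Set.indicator_of_notMem hzt _
  have hwev : ∀ z ∈ e.target, w =ᶠ[nhds z] chartRep η.1 x := fun z hz => by
    filter_upwards [(isOpen_target (m := n + 1) x).mem_nhds hz] with z' hz'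
    exact Set.indicator_of_mem hz' _
  have hsm : ContDiff ℝ 1 w := by
    rw [contDiff_iff_contDiffAt]
    intro z
    by_cases hz : z ∈ e.target
    · exact (((η.2 x).contDiffAt ((isOpen_target (m := n + 1) x).mem_nhds hz)).of_le (by
        simp)).congr_of_eventuallyEq (hwev z hz)
    · have hzK : z ∉ e '' K := by
        rintro ⟨p, hp, rfl⟩
        exact hz (e.map_source (hs hp))
      refine ContDiffAt.congr_of_eventuallyEq (f := fun _ => 0) contDiffAt_const ?_
      filter_upwards [hcK.isClosed.isOpen_compl.mem_nhds hzK] with z' hz'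
      exact hw0 z' hz'
  have hc : HasCompactSupport w := HasCompactSupport.intro hcK hw0
  have hout : ∀ z ∉ e.target, extDeriv w z (stdFrame (n + 1)) = 0 := by
    intro z hz
    have hzK : z ∉ e '' K := by
      rintro ⟨p, hp, rfl⟩
      exact hz (e.map_source (hs hp))
    have hev : w =ᶠ[nhds z] fun _ => 0 := by
      filter_upwards [hcK.isClosed.isOpen_compl.mem_nhds hzK] with z' hz'
      exact hw0 z' hz'
    have h : fderiv ℝ w z = 0 := by rw [hev.fderiv_eq, fderiv_fun_const, Pi.zero_apply]
    change ContinuousAlternatingMap.alternatizeUncurryFin (fderiv ℝ w z) _ = 0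
    rw [h, ContinuousAlternatingMap.alternatizeUncurryFin_apply]
    simp
  rw [← integral_extDeriv_eq_zero hsm hc,
    ← setIntegral_eq_integral_of_forall_compl_eq_zero (μ := volume) hout]
  refine setIntegral_congr_fun (isOpen_target (m := n + 1) x).measurableSet fun z hz => ?_
  simp only [topCoeff]
  rw [chartRep_rawD η.2 hz]
  have h := (hwev z hz).fderiv_eq (𝕜 := ℝ)
  exact congrArg (fun f => ContinuousAlternatingMap.alternatizeUncurryFin f (stdFrame (n + 1)))
    h.symm

/-- Stokes' theorem on `M`: a partition of unity splits the form into pieces supported in one chart. -/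
theorem formIntegral_extD (hM : OrientedCharts (n + 1) M) (η : DForm (n + 1) M n) :
    formIntegral (n + 1) M (extD (n + 1) M n η) = 0 := by
  set I : Finset M := (finite_support_unityPartition (m := n + 1) (M := M)).toFinset with hI
  have hsum : η = ∑ x ∈ I, smulForm (n + 1) (unityPartition (n + 1) M x) η := by
    refine Subtype.ext (funext fun p => ?_)
    have h1 : (∑ x ∈ I, smulForm (n + 1) (unityPartition (n + 1) M x) η).1 p =
        ∑ x ∈ I, unityPartition (n + 1) M x p • η.1 p := by
      have := map_sum ((LinearMap.proj (R := ℝ) p).comp (smoothForms (n + 1) M n).subtype)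
        (fun x => (smulForm (n + 1) (unityPartition (n + 1) M x) η : DForm (n + 1) M n)) I
      exact this
    rw [h1, ← Finset.sum_smul, hI, sum_unityPartition, one_smul]
  rw [hsum, map_sum, map_sum]
  refine Finset.sum_eq_zero fun x _ => ?_
  have hs : tsupport (unityPartition (n + 1) M x) ⊆ (extChartAt (𝓡 (n + 1)) x).source := by
    simpa using unityPartition_subordinate (m := n + 1) x
  have h0 : ∀ p ∉ tsupport (unityPartition (n + 1) M x),
      (smulForm (n + 1) (unityPartition (n + 1) M x) η).1 p = 0 := fun p hp => by
    change unityPartition (n + 1) M x p • η.1 p = 0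
    rw [image_eq_zero_of_notMem_tsupport hp, zero_smul]
  rw [formIntegral_eq_chart hM (isClosed_tsupport _) hs _ fun p hp =>
    rawD_eq_zero (isClosed_tsupport _) h0 hp]
  exact setIntegral_topCoeff_rawD (isClosed_tsupport _) hs _ h0

end StokesTheorem

/-- Stokes' theorem on a compact manifold without boundary. -/
theorem totalIntegral_totalD {m : ℕ} {M : Type*} [TopologicalSpace M] [ChartedSpace (Coord m) M]
    [IsManifold (𝓡 m) ∞ M] [T2Space M] [CompactSpace M] (hM : OrientedCharts m M)
    (x : Forms m M) : totalIntegral m M (totalD m M x) = 0 := by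
  have h : totalIntegral m M ∘ₗ totalD m M = 0 := Forms.hom_ext fun k η => by
    rw [LinearMap.comp_apply, totalD_ofDeg, totalIntegral, LinearMap.comp_apply]
    by_cases hk : k + 1 = m
    · subst hk
      rw [component_ofDeg_self, formIntegral_extD hM]
      rfl
    · rw [component_ofDeg_of_ne hk, map_zero]
      rfl
  exact congrArg (fun f => f x) h

/-! ### Decomposable elements, degrees and projections -/

section Signs

theorem neg_one_zpow_congr {a b : ℤ} (h : Even (a - b)) : (-1 : ℝ) ^ a = (-1) ^ b := by
  have : a = (a - b) + b := by ring
  rw [this, zpow_add₀ (by norm_num), h.neg_one_zpow, one_mul]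

end Signs

section SuperSpace

variable {m : ℕ} {M : Type*} [TopologicalSpace M] [ChartedSpace (Coord m) M]
  {𝔤 : Type*} [LieRing 𝔤] [LieAlgebra ℝ 𝔤] {E : GhostAlgebra}
  {W : Type*} [AddCommGroup W] [Module ℝ W]

/-- The decomposable element `η ⊗ X ⊗ e` of `Ω(M; 𝔤) ⊗ E`. -/
def pureForm {p : ℕ} (η : DForm m M p) (X : 𝔤) (e : E) : SuperForms m M 𝔤 E :=
  (ofDeg m M p η ⊗ₜ[ℝ] X) ⊗ₜ[ℝ] e

variable (m M 𝔤 E) in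
/-- The elements of total degree `n`, the total degree being the sum of the form degree and the
ghost number. -/
def totalDegree (n : ℤ) : Submodule ℝ (SuperForms m M 𝔤 E) :=
  Submodule.span ℝ {x | ∃ (p : ℕ) (q : ℤ) (η : DForm m M p) (X : 𝔤) (e : E),
    e ∈ E.gr q ∧ p + q = n ∧ x = pureForm η X e}

theorem Forms.mem_of_ofDeg {N : Submodule ℝ (Forms m M)} (h : ∀ k η, ofDeg m M k η ∈ N)
    (w : Forms m M) : w ∈ N := by
  have h0 : N.mkQ = 0 := Forms.hom_ext fun k η => (Submodule.Quotient.mk_eq_zero N).2 (h k η)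
  exact (Submodule.Quotient.mk_eq_zero N).1 (congrArg (fun f => f w) h0)

theorem lieForms_range_le {p : ℕ} {N : Submodule ℝ (LieForms m M 𝔤)}
    (h : ∀ (η : DForm m M p) (X : 𝔤), ofDeg m M p η ⊗ₜ[ℝ] X ∈ N) (u : DForm m M p ⊗[ℝ] 𝔤) :
    TensorProduct.map (ofDeg m M p) (LinearMap.id : 𝔤 →ₗ[ℝ] 𝔤) u ∈ N := by
  induction u using TensorProduct.induction_on with
  | zero => rw [map_zero]; exact N.zero_mem
  | add x y hx hy => rw [map_add]; exact N.add_mem hx hy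
  | tmul η X => exact h η X

theorem ofBidegree_le {p : ℕ} {q : ℤ} {N : Submodule ℝ (SuperForms m M 𝔤 E)}
    (h : ∀ (η : DForm m M p) (X : 𝔤), ∀ e ∈ E.gr q, pureForm η X e ∈ N) :
    ofBidegree m M 𝔤 E p q ≤ N := by
  rintro _ ⟨x, rfl⟩
  induction x using TensorProduct.induction_on with
  | zero => rw [map_zero]; exact N.zero_mem
  | add x y hx hy => rw [map_add]; exact N.add_mem hx hy
  | tmul u e =>
    exact lieForms_range_le (N := N.comap ((TensorProduct.mk ℝ (LieForms m M 𝔤) E).flip e.1))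
      (fun η X => h η X e e.2) u

theorem ofFormDegree_le {p : ℕ} {N : Submodule ℝ (SuperForms m M 𝔤 E)}
    (h : ∀ (η : DForm m M p) (X : 𝔤) (q : ℤ), ∀ e ∈ E.gr q, pureForm η X e ∈ N) :
    ofFormDegree m M 𝔤 E p ≤ N := by
  rintro _ ⟨x, rfl⟩
  induction x using TensorProduct.induction_on with
  | zero => rw [map_zero]; exact N.zero_mem
  | add x y hx hy => rw [map_add]; exact N.add_mem hx hy
  | tmul u e =>
    refine lieForms_range_le (N := N.comap ((TensorProduct.mk ℝ (LieForms m M 𝔤) E).flip e))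
      (fun η X => ?_) u
    change pureForm η X e ∈ N
    have key : (⊤ : Submodule ℝ E) ≤ N.comap (TensorProduct.mk ℝ _ _ (ofDeg m M p η ⊗ₜ[ℝ] X)) := by
      intro e _
      induction e using DirectSum.Decomposition.inductionOn E.gr with
      | zero => exact Submodule.zero_mem _
      | homogeneous e => exact h η X _ e e.2
      | add x y hx hy => exact Submodule.add_mem _ (hx trivial) (hy trivial)
    exact key (x := e) trivial

theorem eq_top_of_pureForm {N : Submodule ℝ (SuperForms m M 𝔤 E)}
    (h : ∀ (p : ℕ) (η : DForm m M p) (X : 𝔤) (q : ℤ), ∀ e ∈ E.gr q, pureForm η X e ∈ N)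
    (x : SuperForms m M 𝔤 E) : x ∈ N := by
  induction x using TensorProduct.induction_on with
  | zero => exact N.zero_mem
  | add x y hx hy => exact N.add_mem hx hy
  | tmul u e =>
    induction u using TensorProduct.induction_on with
    | zero => rw [TensorProduct.zero_tmul]; exact N.zero_mem
    | add x y hx hy => rw [TensorProduct.add_tmul]; exact N.add_mem hx hy
    | tmul w X =>
      exact Forms.mem_of_ofDeg (N := N.comap
        ((TensorProduct.mk ℝ (LieForms m M 𝔤) E).flip e ∘ₗ
          (TensorProduct.mk ℝ (Forms m M) 𝔤).flip X))
        (fun p η => ofFormDegree_le (h p) ⟨(η ⊗ₜ X) ⊗ₜ e, rfl⟩) w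

theorem totalDegree_le {n : ℤ} {N : Submodule ℝ (SuperForms m M 𝔤 E)}
    (h : ∀ (p : ℕ) (η : DForm m M p) (X : 𝔤) (q : ℤ), ∀ e ∈ E.gr q, p + q = n → pureForm η X e ∈ N) :
    totalDegree m M 𝔤 E n ≤ N := by
  refine Submodule.span_le.2 ?_
  rintro _ ⟨p, q, η, X, e, he, hn, rfl⟩
  exact h p η X q e he hn

theorem pureForm_mem_totalDegree {p : ℕ} {q : ℤ} (η : DForm m M p) (X : 𝔤) {e : E}
    (he : e ∈ E.gr q) : pureForm η X e ∈ totalDegree m M 𝔤 E (p + q) :=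
  Submodule.subset_span ⟨p, q, η, X, e, he, rfl, rfl⟩

theorem pureForm_mem_ofBidegree {p : ℕ} {q : ℤ} (η : DForm m M p) (X : 𝔤) {e : E}
    (he : e ∈ E.gr q) : pureForm η X e ∈ ofBidegree m M 𝔤 E p q :=
  ⟨(η ⊗ₜ X) ⊗ₜ ⟨e, he⟩, rfl⟩

theorem pureForm_mem_ofFormDegree {p : ℕ} (η : DForm m M p) (X : 𝔤) (e : E) :
    pureForm η X e ∈ ofFormDegree m M 𝔤 E p :=
  ⟨(η ⊗ₜ X) ⊗ₜ e, rfl⟩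

theorem ofBidegree_le_totalDegree {p : ℕ} {q n : ℤ} (h : p + q = n) :
    ofBidegree m M 𝔤 E p q ≤ totalDegree m M 𝔤 E n :=
  ofBidegree_le fun η X _ he => h ▸ pureForm_mem_totalDegree η X he

theorem ofBidegree_le_ofFormDegree {p : ℕ} {q : ℤ} :
    ofBidegree m M 𝔤 E p q ≤ ofFormDegree m M 𝔤 E p :=
  ofBidegree_le fun η X e _ => pureForm_mem_ofFormDegree η X e

theorem mem_ker_sub {A B : Type*} [AddCommGroup A] [Module ℝ A] [AddCommGroup B] [Module ℝ B]
    {f g : A →ₗ[ℝ] B} {x : A} : x ∈ LinearMap.ker (f - g) ↔ f x = g x := by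
  rw [LinearMap.mem_ker, LinearMap.sub_apply, sub_eq_zero]

theorem eqOn_ofBidegree {p : ℕ} {q : ℤ} {f g : SuperForms m M 𝔤 E →ₗ[ℝ] W}
    (h : ∀ (η : DForm m M p) (X : 𝔤), ∀ e ∈ E.gr q, f (pureForm η X e) = g (pureForm η X e))
    {x : SuperForms m M 𝔤 E} (hx : x ∈ ofBidegree m M 𝔤 E p q) : f x = g x :=
  mem_ker_sub.1 (ofBidegree_le (N := LinearMap.ker (f - g))
    (fun η X e he => mem_ker_sub.2 (h η X e he)) hx)

theorem eqOn_ofFormDegree {p : ℕ} {f g : SuperForms m M 𝔤 E →ₗ[ℝ] W}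
    (h : ∀ (η : DForm m M p) (X : 𝔤) (q : ℤ), ∀ e ∈ E.gr q,
      f (pureForm η X e) = g (pureForm η X e))
    {x : SuperForms m M 𝔤 E} (hx : x ∈ ofFormDegree m M 𝔤 E p) : f x = g x :=
  mem_ker_sub.1 (ofFormDegree_le (N := LinearMap.ker (f - g))
    (fun η X q e he => mem_ker_sub.2 (h η X q e he)) hx)

/-- Linear maps that agree on homogeneous decomposable elements of total degree `n` agree on all
elements of total degree `n`. -/
theorem eqOn_totalDegree {n : ℤ} {f g : SuperForms m M 𝔤 E →ₗ[ℝ] W}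
    (h : ∀ (p : ℕ) (η : DForm m M p) (X : 𝔤) (q : ℤ), ∀ e ∈ E.gr q, p + q = n →
      f (pureForm η X e) = g (pureForm η X e))
    {x : SuperForms m M 𝔤 E} (hx : x ∈ totalDegree m M 𝔤 E n) : f x = g x :=
  mem_ker_sub.1 (totalDegree_le (N := LinearMap.ker (f - g))
    (fun p η X q e he hn => mem_ker_sub.2 (h p η X q e he hn)) hx)

/-- Linear maps that agree on homogeneous decomposable elements are equal. -/
theorem superForms_hom_ext {f g : SuperForms m M 𝔤 E →ₗ[ℝ] W}
    (h : ∀ (p : ℕ) (η : DForm m M p) (X : 𝔤) (q : ℤ), ∀ e ∈ E.gr q,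
      f (pureForm η X e) = g (pureForm η X e)) : f = g :=
  LinearMap.ext fun x => mem_ker_sub.1 (eq_top_of_pureForm (N := LinearMap.ker (f - g))
    (fun p η X q e he => mem_ker_sub.2 (h p η X q e he)) x)

theorem pureForm_eq_zero {p : ℕ} (h : m < p) (η : DForm m M p) (X : 𝔤) (e : E) :
    pureForm η X e = 0 := by
  rw [pureForm, DForm.eq_zero_of_lt h η, map_zero, TensorProduct.zero_tmul, TensorProduct.zero_tmul]

theorem ghostParity_apply {q : ℤ} {e : E} (he : e ∈ E.gr q) :
    E.ghostParity e = ((-1 : ℝ) ^ q) • e := by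
  simp only [GhostAlgebra.ghostParity, LinearMap.comp_apply, LinearEquiv.coe_coe,
    DirectSum.decomposeLinearEquiv_apply]
  rw [DirectSum.decompose_of_mem _ he]
  have h1 := DirectSum.lmap_lof (R := ℝ)
    (fun q : ℤ => ((-1 : ℝ) ^ q) • (LinearMap.id : E.gr q →ₗ[ℝ] E.gr q)) (i := q) ⟨e, he⟩
  rw [DirectSum.lof_eq_of] at h1
  rw [h1, DirectSum.lof_eq_of, DirectSum.coeLinearMap_of]
  rfl

theorem ghostParity_pow_apply {q : ℤ} {e : E} (he : e ∈ E.gr q) (r : ℕ) :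
    (E.ghostParity ^ r) e = ((-1 : ℝ) ^ (q * r)) • e := by
  induction r with
  | zero => simp
  | succ r ih =>
    rw [pow_succ', Module.End.mul_apply, ih, map_smul, ghostParity_apply he, smul_smul,
      ← zpow_add₀ (by norm_num)]
    congr 2; push_cast; ring

/-! #### Projections to form degrees -/

variable (m M 𝔤 E) in
/-- The projection of `Ω(M; 𝔤) ⊗ E` to form degree `r`. -/
def formProj (r : ℕ) : SuperForms m M 𝔤 E →ₗ[ℝ] SuperForms m M 𝔤 E :=
  TensorProduct.map (TensorProduct.map (degProj m M r) LinearMap.id) LinearMap.id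

theorem formProj_pureForm (r : ℕ) {p : ℕ} (η : DForm m M p) (X : 𝔤) (e : E) :
    formProj m M 𝔤 E r (pureForm η X e) = if p = r then pureForm η X e else 0 := by
  rw [formProj, pureForm, TensorProduct.map_tmul, TensorProduct.map_tmul, degProj_ofDeg]
  split_ifs
  · rfl
  · rw [TensorProduct.zero_tmul, TensorProduct.zero_tmul]

theorem formProj_of_mem {r : ℕ} {x : SuperForms m M 𝔤 E} (hx : x ∈ ofFormDegree m M 𝔤 E r) :
    formProj m M 𝔤 E r x = x :=
  eqOn_ofFormDegree (g := LinearMap.id) (fun η X q e _ => by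
    rw [formProj_pureForm, if_pos rfl]; rfl) hx

theorem formProj_of_mem_ne {p r : ℕ} (h : p ≠ r) {x : SuperForms m M 𝔤 E}
    (hx : x ∈ ofFormDegree m M 𝔤 E p) : formProj m M 𝔤 E r x = 0 :=
  eqOn_ofFormDegree (g := 0) (fun η X q e _ => by
    rw [formProj_pureForm, if_neg h]; rfl) hx

theorem formProj_mem (r : ℕ) (x : SuperForms m M 𝔤 E) :
    formProj m M 𝔤 E r x ∈ ofFormDegree m M 𝔤 E r :=
  eq_top_of_pureForm (N := (ofFormDegree m M 𝔤 E r).comap (formProj m M 𝔤 E r))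
    (fun p η X q e _ => by
      rw [Submodule.mem_comap, formProj_pureForm]
      split_ifs with h
      · subst h; exact pureForm_mem_ofFormDegree η X e
      · exact Submodule.zero_mem _) x

theorem formProj_mem_ofBidegree {n q : ℤ} {r : ℕ} (h : r + q = n) {x : SuperForms m M 𝔤 E}
    (hx : x ∈ totalDegree m M 𝔤 E n) : formProj m M 𝔤 E r x ∈ ofBidegree m M 𝔤 E r q :=
  totalDegree_le (N := (ofBidegree m M 𝔤 E r q).comap (formProj m M 𝔤 E r))
    (fun p η X q' e he hn => by
      rw [Submodule.mem_comap, formProj_pureForm]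
      split_ifs with h'
      · subst h'
        obtain rfl : q' = q := by omega
        exact pureForm_mem_ofBidegree η X he
      · exact Submodule.zero_mem _) hx

theorem sum_formProj (x : SuperForms m M 𝔤 E) :
    ∑ r ∈ Finset.range (m + 1), formProj m M 𝔤 E r x = x := by
  have h : ∑ r ∈ Finset.range (m + 1), formProj m M 𝔤 E r = LinearMap.id :=
    superForms_hom_ext fun p η X q e _ => by
      rw [LinearMap.sum_apply]
      simp only [formProj_pureForm, LinearMap.id_apply]
      rw [Finset.sum_ite_eq]
      split_ifs with hp
      · rfl
      · rw [pureForm_eq_zero (by simpa using hp)]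
  have := congrArg (fun f => f x) h
  simpa using this

/-! #### The extended and the dot bilinear operations -/

theorem superExt_pureForm (b : LieForms m M 𝔤 →ₗ[ℝ] LieForms m M 𝔤 →ₗ[ℝ] W) {p p' : ℕ}
    (η : DForm m M p) (θ : DForm m M p') (X Y : 𝔤) (e f : E) :
    superExt b (pureForm η X e) (pureForm θ Y f) =
      b (ofDeg m M p η ⊗ₜ X) (ofDeg m M p' θ ⊗ₜ Y) ⊗ₜ (e * f) := by
  rw [superExt, pureForm, pureForm, TensorProduct.map₂_apply_tmul]
  rfl

/-- On decomposable elements the dot extension of `b` carries the sign `(-1)^(gh α · deg β)`. -/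
theorem dotExt_pureForm (b : LieForms m M 𝔤 →ₗ[ℝ] LieForms m M 𝔤 →ₗ[ℝ] W) {p p' : ℕ} {q : ℤ}
    (η : DForm m M p) (θ : DForm m M p') (X Y : 𝔤) {e : E} (he : e ∈ E.gr q) (f : E) :
    dotExt b (pureForm η X e) (pureForm θ Y f) =
      ((-1 : ℝ) ^ (q * p')) • superExt b (pureForm η X e) (pureForm θ Y f) := by
  have hterm : ∀ r, (superExt b).compl₁₂ (TensorProduct.map LinearMap.id (E.ghostParity ^ r))
      (TensorProduct.map (TensorProduct.map (degProj m M r) LinearMap.id) LinearMap.id)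
      (pureForm η X e) (pureForm θ Y f) =
      if p' = r then ((-1 : ℝ) ^ (q * p')) • superExt b (pureForm η X e) (pureForm θ Y f)
        else 0 := fun r => by
    have h1 := formProj_pureForm r θ Y f
    rw [formProj] at h1
    rw [LinearMap.compl₁₂_apply, h1]
    split_ifs with h
    · subst h
      conv_lhs => rw [pureForm, TensorProduct.map_tmul, ghostParity_pow_apply he,
        TensorProduct.tmul_smul, map_smul, LinearMap.smul_apply]
      rfl
    · rw [map_zero]
  rw [dotExt, LinearMap.sum_apply, LinearMap.sum_apply, Finset.sum_congr rfl fun r _ => hterm r,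
    Finset.sum_ite_eq]
  split_ifs with hp
  · rfl
  · rw [pureForm_eq_zero (by simpa using hp) θ, map_zero, smul_zero]

theorem dotExt_eq_superExt (b : LieForms m M 𝔤 →ₗ[ℝ] LieForms m M 𝔤 →ₗ[ℝ] W) {p p' : ℕ} {q : ℤ}
    {α β : SuperForms m M 𝔤 E} (hα : α ∈ ofBidegree m M 𝔤 E p q)
    (hβ : β ∈ ofFormDegree m M 𝔤 E p') :
    dotExt b α β = ((-1 : ℝ) ^ (q * p')) • superExt b α β := by
  refine eqOn_ofBidegree (f := (dotExt b).flip β)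
    (g := (((-1 : ℝ) ^ (q * p')) • superExt b).flip β) (fun η X e he => ?_) hα
  refine eqOn_ofFormDegree (f := dotExt b (pureForm η X e))
    (g := (((-1 : ℝ) ^ (q * p')) • superExt b) (pureForm η X e)) (fun θ Y q' f _ => ?_) hβ
  exact dotExt_pureForm b η θ X Y he f

/-- For a first argument of ghost number zero there is no sign in the dot operations. -/
theorem dotExt_of_ghost_zero (b : LieForms m M 𝔤 →ₗ[ℝ] LieForms m M 𝔤 →ₗ[ℝ] W) {p : ℕ}
    {α : SuperForms m M 𝔤 E} (hα : α ∈ ofBidegree m M 𝔤 E p 0) (β : SuperForms m M 𝔤 E) :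
    dotExt b α β = superExt b α β := by
  have h : dotExt b α = superExt b α := superForms_hom_ext fun p' θ Y q f _ => by
    rw [dotExt_eq_superExt b hα (pureForm_mem_ofFormDegree θ Y f), zero_mul, zpow_zero, one_smul]
  rw [h]

/-! #### Extension of coefficients -/

theorem changeCoeff_pureForm {E' : GhostAlgebra} (f : E.Hom E') {p : ℕ} (η : DForm m M p) (X : 𝔤)
    (e : E) : changeCoeff (LieForms m M 𝔤) f (pureForm η X e) = pureForm η X (f.toAlgHom e) := rfl

theorem changeCoeff_map {V V' : Type*} [AddCommGroup V] [Module ℝ V] [AddCommGroup V']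
    [Module ℝ V'] {E' : GhostAlgebra} (f : E.Hom E') (g : V →ₗ[ℝ] V') (x : V ⊗[ℝ] E) :
    changeCoeff V' f (TensorProduct.map g LinearMap.id x) =
      TensorProduct.map g LinearMap.id (changeCoeff V f x) := by
  induction x using TensorProduct.induction_on with
  | zero => simp
  | add x y hx hy => simp only [map_add, hx, hy]
  | tmul v e => rfl

theorem changeCoeff_superExt {E' : GhostAlgebra} (f : E.Hom E')
    (b : LieForms m M 𝔤 →ₗ[ℝ] LieForms m M 𝔤 →ₗ[ℝ] W) (α β : SuperForms m M 𝔤 E) :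
    changeCoeff W f (superExt b α β) =
      superExt b (changeCoeff _ f α) (changeCoeff _ f β) := by
  have h : (superExt b).compr₂ (changeCoeff W f) =
      (superExt b).compl₁₂ (changeCoeff _ f) (changeCoeff _ f) :=
    superForms_hom_ext fun p η X q e _ => superForms_hom_ext fun p' θ Y q' e' _ => by
      rw [LinearMap.compr₂_apply, LinearMap.compl₁₂_apply, changeCoeff_pureForm,
        changeCoeff_pureForm, superExt_pureForm, superExt_pureForm, ← map_mul]
      rfl
  exact congrArg (fun g => g α β) h

theorem changeCoeff_dotExt {E' : GhostAlgebra} (f : E.Hom E')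
    (b : LieForms m M 𝔤 →ₗ[ℝ] LieForms m M 𝔤 →ₗ[ℝ] W) (α β : SuperForms m M 𝔤 E) :
    changeCoeff W f (dotExt b α β) =
      dotExt b (changeCoeff _ f α) (changeCoeff _ f β) := by
  have h : (dotExt b).compr₂ (changeCoeff W f) =
      (dotExt b).compl₁₂ (changeCoeff _ f) (changeCoeff _ f) :=
    superForms_hom_ext fun p η X q e he => superForms_hom_ext fun p' θ Y q' e' _ => by
      rw [LinearMap.compr₂_apply, LinearMap.compl₁₂_apply, changeCoeff_pureForm,
        changeCoeff_pureForm, dotExt_pureForm b η θ X Y he,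
        dotExt_pureForm b η θ X Y (f.map_gr q e he), map_smul, changeCoeff_superExt]
      rfl
  exact congrArg (fun g => g α β) h

end SuperSpace

/-! ### The bracket and the pairing as graded structures -/

theorem neg_neg_one_zpow (a : ℤ) : -((-1 : ℝ) ^ a) = (-1) ^ (a + 1) := by
  rw [zpow_add₀ (by norm_num)]; simp

section DotAlgebra

variable {m : ℕ} {M : Type*} [TopologicalSpace M] [ChartedSpace (Coord m) M]
  {𝔤 : Type*} [LieRing 𝔤] [LieAlgebra ℝ 𝔤] {E : GhostAlgebra}

/-- The decomposable element `w ⊗ X ⊗ e`, with `w` an inhomogeneous form. -/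
def tripleTensor (w : Forms m M) (X : 𝔤) (e : E) : SuperForms m M 𝔤 E := (w ⊗ₜ[ℝ] X) ⊗ₜ[ℝ] e

theorem tripleTensor_smul_form (c : ℝ) (w : Forms m M) (X : 𝔤) (e : E) :
    tripleTensor (c • w) X e = c • tripleTensor w X e := by
  rw [tripleTensor, ← TensorProduct.smul_tmul', ← TensorProduct.smul_tmul']; rfl

theorem tripleTensor_smul_coeff (c : ℝ) (w : Forms m M) (X : 𝔤) (e : E) :
    tripleTensor w X (c • e) = c • tripleTensor w X e := by
  rw [tripleTensor, TensorProduct.tmul_smul]; rfl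

theorem tripleTensor_neg_lie (w : Forms m M) (X : 𝔤) (e : E) :
    tripleTensor w (-X) e = -tripleTensor w X e := by
  rw [tripleTensor, TensorProduct.tmul_neg, TensorProduct.neg_tmul]; rfl

theorem tripleTensor_add_lie (w : Forms m M) (X Y : 𝔤) (e : E) :
    tripleTensor w (X + Y) e = tripleTensor w X e + tripleTensor w Y e := by
  rw [tripleTensor, TensorProduct.tmul_add, TensorProduct.add_tmul]; rfl

theorem tripleTensor_add_form (w w' : Forms m M) (X : 𝔤) (e : E) :
    tripleTensor (w + w') X e = tripleTensor w X e + tripleTensor w' X e := by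
  rw [tripleTensor, TensorProduct.add_tmul, TensorProduct.add_tmul]; rfl

variable [IsManifold (𝓡 m) ∞ M]

theorem pureForm_wedge {p p' : ℕ} (η : DForm m M p) (θ : DForm m M p') (X : 𝔤) (e : E) :
    pureForm (wedge m M p p' η θ) X e =
      tripleTensor (totalWedge m M (ofDeg m M p η) (ofDeg m M p' θ)) X e := by
  rw [totalWedge_ofDeg]; rfl

theorem superD_pureForm {p : ℕ} (η : DForm m M p) (X : 𝔤) (e : E) :
    superD (pureForm η X e) = pureForm (extD m M p η) X e := by
  rw [pureForm, superD, TensorProduct.map_tmul, lieFormD, TensorProduct.map_tmul, totalD_ofDeg]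
  rfl

theorem superBracket_pureForm {p p' : ℕ} (η : DForm m M p) (θ : DForm m M p') (X Y : 𝔤) (e f : E) :
    superExt lieFormBracket (pureForm η X e) (pureForm θ Y f) =
      pureForm (wedge m M p p' η θ) ⁅X, Y⁆ (e * f) := by
  rw [superExt_pureForm, lieFormBracket, TensorProduct.map₂_apply_tmul]
  change (totalWedge m M _ _ ⊗ₜ _) ⊗ₜ _ = _
  rw [totalWedge_ofDeg]
  rfl

theorem dotBracket_pureForm {p p' : ℕ} {q : ℤ} (η : DForm m M p) (θ : DForm m M p') (X Y : 𝔤)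
    {e : E} (he : e ∈ E.gr q) (f : E) :
    dotExt lieFormBracket (pureForm η X e) (pureForm θ Y f) =
      ((-1 : ℝ) ^ (q * p')) • pureForm (wedge m M p p' η θ) ⁅X, Y⁆ (e * f) := by
  rw [dotExt_pureForm _ η θ X Y he, superBracket_pureForm]

theorem superExt_pairing_pureForm (κ : LinearMap.BilinForm ℝ 𝔤) {U : Type*} [AddCommGroup U]
    [Module ℝ U] (I : Forms m M →ₗ[ℝ] U) {p p' : ℕ} (η : DForm m M p) (θ : DForm m M p') (X Y : 𝔤)
    (e f : E) :
    superExt ((lieFormPairing κ).compr₂ I) (pureForm η X e) (pureForm θ Y f) =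
      (κ X Y • I (totalWedge m M (ofDeg m M p η) (ofDeg m M p' θ))) ⊗ₜ (e * f) := by
  rw [superExt_pureForm, LinearMap.compr₂_apply, lieFormPairing, LinearMap.compr₂_apply,
    TensorProduct.map₂_apply_tmul]
  change I (TensorProduct.rid ℝ _ (totalWedge m M _ _ ⊗ₜ _)) ⊗ₜ _ = _
  rw [TensorProduct.rid_tmul, map_smul]

theorem mem_totalDegree_of_eq {n n' : ℤ} (h : n = n') {x : SuperForms m M 𝔤 E}
    (hx : x ∈ totalDegree m M 𝔤 E n) : x ∈ totalDegree m M 𝔤 E n' := h ▸ hx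

theorem map_mem_of_totalDegree {W : Type*} [AddCommGroup W] [Module ℝ W] {n : ℤ}
    {N : Submodule ℝ W} (f : SuperForms m M 𝔤 E →ₗ[ℝ] W)
    (h : ∀ (p : ℕ) (η : DForm m M p) (X : 𝔤) (q : ℤ), ∀ e ∈ E.gr q, p + q = n →
      f (pureForm η X e) ∈ N)
    {x : SuperForms m M 𝔤 E} (hx : x ∈ totalDegree m M 𝔤 E n) : f x ∈ N :=
  Submodule.mem_comap.1 (totalDegree_le (N := N.comap f)
    (fun p η X q e he hn => Submodule.mem_comap.2 (h p η X q e he hn)) hx)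

theorem map_mem_of_ofFormDegree {W : Type*} [AddCommGroup W] [Module ℝ W] {p : ℕ}
    {N : Submodule ℝ W} (f : SuperForms m M 𝔤 E →ₗ[ℝ] W)
    (h : ∀ (η : DForm m M p) (X : 𝔤) (q : ℤ), ∀ e ∈ E.gr q, f (pureForm η X e) ∈ N)
    {x : SuperForms m M 𝔤 E} (hx : x ∈ ofFormDegree m M 𝔤 E p) : f x ∈ N :=
  Submodule.mem_comap.1 (ofFormDegree_le (N := N.comap f)
    (fun η X q e he => Submodule.mem_comap.2 (h η X q e he)) hx)

theorem superD_mem_totalDegree {n : ℤ} {x : SuperForms m M 𝔤 E}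
    (hx : x ∈ totalDegree m M 𝔤 E n) : superD x ∈ totalDegree m M 𝔤 E (n + 1) := by
  refine map_mem_of_totalDegree superD (fun p η X q e he hn => ?_) hx
  rw [superD_pureForm]
  refine mem_totalDegree_of_eq ?_ (pureForm_mem_totalDegree _ X he)
  push_cast; omega

theorem superD_mem_ofFormDegree {p : ℕ} {x : SuperForms m M 𝔤 E}
    (hx : x ∈ ofFormDegree m M 𝔤 E p) : superD x ∈ ofFormDegree m M 𝔤 E (p + 1) := by
  refine map_mem_of_ofFormDegree superD (fun η X q e _ => ?_) hx
  rw [superD_pureForm]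
  exact pureForm_mem_ofFormDegree _ X e

theorem dotBracket_mem_totalDegree {n n' : ℤ} {x y : SuperForms m M 𝔤 E}
    (hx : x ∈ totalDegree m M 𝔤 E n) (hy : y ∈ totalDegree m M 𝔤 E n') :
    dotBracket x y ∈ totalDegree m M 𝔤 E (n + n') := by
  set D : SuperForms m M 𝔤 E →ₗ[ℝ] SuperForms m M 𝔤 E →ₗ[ℝ] SuperForms m M 𝔤 E :=
    dotExt lieFormBracket with hD
  change D.flip y x ∈ _
  refine map_mem_of_totalDegree (D.flip y) (fun p η X q e he hn => ?_) hx
  rw [LinearMap.flip_apply]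
  refine map_mem_of_totalDegree (D (pureForm η X e)) (fun p' θ Y q' f hf hn' => ?_) hy
  rw [hD, dotBracket_pureForm η θ X Y he]
  refine Submodule.smul_mem _ _ (mem_totalDegree_of_eq ?_
    (pureForm_mem_totalDegree _ _ (SetLike.mul_mem_graded he hf)))
  push_cast; omega

theorem superBracket_mem_ofFormDegree {p p' : ℕ} {x y : SuperForms m M 𝔤 E}
    (hx : x ∈ ofFormDegree m M 𝔤 E p) (hy : y ∈ ofFormDegree m M 𝔤 E p') :
    superBracket x y ∈ ofFormDegree m M 𝔤 E (p + p') := by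
  set D : SuperForms m M 𝔤 E →ₗ[ℝ] SuperForms m M 𝔤 E →ₗ[ℝ] SuperForms m M 𝔤 E :=
    superExt lieFormBracket with hD
  change D.flip y x ∈ _
  refine map_mem_of_ofFormDegree (D.flip y) (fun η X q e he => ?_) hx
  rw [LinearMap.flip_apply]
  refine map_mem_of_ofFormDegree (D (pureForm η X e)) (fun θ Y q' f hf => ?_) hy
  rw [hD, superBracket_pureForm]
  exact pureForm_mem_ofFormDegree _ _ _

theorem superD_superD (x : SuperForms m M 𝔤 E) : superD (superD x) = 0 := by
  have h : (superD ∘ₗ superD : SuperForms m M 𝔤 E →ₗ[ℝ] _) = 0 :=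
    superForms_hom_ext fun p η X q e _ => by
      rw [LinearMap.comp_apply, superD_pureForm, superD_pureForm]
      have : extD m M (p + 1) (extD m M p η) = 0 := Subtype.ext (rawD_rawD η.2)
      rw [this, pureForm, map_zero, TensorProduct.zero_tmul, TensorProduct.zero_tmul]
      rfl
  exact congrArg (fun f => f x) h

/-- Graded antisymmetry of the bracket on bihomogeneous elements. -/
theorem superBracket_comm {p p' : ℕ} {q q' : ℤ} {x y : SuperForms m M 𝔤 E}
    (hx : x ∈ ofBidegree m M 𝔤 E p q) (hy : y ∈ ofBidegree m M 𝔤 E p' q') :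
    superBracket x y = -(((-1 : ℝ) ^ ((p : ℤ) * p' + q * q')) • superBracket y x) := by
  refine eqOn_ofBidegree (f := (superExt lieFormBracket).flip y)
    (g := -(((-1 : ℝ) ^ ((p : ℤ) * p' + q * q')) • superExt lieFormBracket y))
    (fun η X e he => ?_) hx
  refine eqOn_ofBidegree (f := superExt lieFormBracket (pureForm η X e))
    (g := -(((-1 : ℝ) ^ ((p : ℤ) * p' + q * q')) • (superExt lieFormBracket).flip (pureForm η X e)))
    (fun θ Y f hf => ?_) hy
  simp only [LinearMap.neg_apply, LinearMap.smul_apply, LinearMap.flip_apply,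
    superBracket_pureForm, pureForm_wedge]
  rw [totalWedge_comm_ofDeg η θ, E.supercomm q q' e he f hf, ← lie_skew Y X,
    tripleTensor_smul_form, tripleTensor_smul_coeff, tripleTensor_neg_lie, smul_neg, neg_neg,
    smul_smul, zpow_add₀ (by norm_num)]
  norm_cast

/-- Graded antisymmetry of the dot bracket with respect to the total degree. -/
theorem dotBracket_comm {n n' : ℤ} {x y : SuperForms m M 𝔤 E}
    (hx : x ∈ totalDegree m M 𝔤 E n) (hy : y ∈ totalDegree m M 𝔤 E n') :
    dotBracket x y = -(((-1 : ℝ) ^ (n * n')) • dotBracket y x) := by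
  refine eqOn_totalDegree (f := (dotExt lieFormBracket).flip y)
    (g := -(((-1 : ℝ) ^ (n * n')) • dotExt lieFormBracket y)) (fun p η X q e he hn => ?_) hx
  refine eqOn_totalDegree (f := dotExt lieFormBracket (pureForm η X e))
    (g := -(((-1 : ℝ) ^ (n * n')) • (dotExt lieFormBracket).flip (pureForm η X e)))
    (fun p' θ Y q' f hf hn' => ?_) hy
  simp only [LinearMap.neg_apply, LinearMap.smul_apply, LinearMap.flip_apply]
  rw [dotExt_pureForm _ η θ X Y he, dotExt_pureForm _ θ η Y X hf]
  have h := superBracket_comm (pureForm_mem_ofBidegree η X he) (pureForm_mem_ofBidegree θ Y hf)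
  rw [superBracket, superBracket] at h
  rw [h, smul_neg, smul_smul, smul_smul, ← zpow_add₀ (by norm_num), ← zpow_add₀ (by norm_num)]
  congr 2
  refine neg_one_zpow_congr ?_
  subst hn hn'
  exact ⟨-(q' * p), by ring⟩

/-- The graded Leibniz rule for the dot bracket. -/
theorem superD_dotBracket {n : ℤ} {x : SuperForms m M 𝔤 E} (hx : x ∈ totalDegree m M 𝔤 E n)
    (y : SuperForms m M 𝔤 E) :
    superD (dotBracket x y) =
      dotBracket (superD x) y + ((-1 : ℝ) ^ n) • dotBracket x (superD y) := by
  refine eqOn_totalDegree (f := superD ∘ₗ (dotExt lieFormBracket).flip y)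
    (g := (dotExt lieFormBracket).flip y ∘ₗ superD +
      ((-1 : ℝ) ^ n) • (dotExt lieFormBracket).flip (superD y)) (fun p η X q e he hn => ?_) hx
  refine congrArg (fun g => g y) (superForms_hom_ext
    (f := superD ∘ₗ dotExt lieFormBracket (pureForm η X e))
    (g := dotExt lieFormBracket (superD (pureForm η X e)) +
      ((-1 : ℝ) ^ n) • (dotExt lieFormBracket (pureForm η X e) ∘ₗ superD))
    fun p' θ Y q' f hf => ?_)
  simp only [LinearMap.comp_apply, LinearMap.add_apply, LinearMap.smul_apply, superD_pureForm]
  rw [dotBracket_pureForm η θ X Y he, dotBracket_pureForm _ θ X Y he,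
    dotBracket_pureForm η _ X Y he, map_smul, superD_pureForm]
  have h1 : pureForm (extD m M (p + p') (wedge m M p p' η θ)) ⁅X, Y⁆ (e * f) =
      pureForm (wedge m M (p + 1) p' (extD m M p η) θ) ⁅X, Y⁆ (e * f) +
      ((-1 : ℝ) ^ p) • pureForm (wedge m M p (p' + 1) η (extD m M p' θ)) ⁅X, Y⁆ (e * f) := by
    have h := totalD_wedge_ofDeg η θ
    rw [totalWedge_ofDeg, totalD_ofDeg, totalD_ofDeg, totalD_ofDeg] at h
    rw [pureForm_wedge, pureForm_wedge, ← tripleTensor_smul_form, ← tripleTensor_add_form, ← h]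
    rfl
  rw [h1, smul_add, smul_smul, smul_smul]
  congr 2
  rw [← zpow_natCast, ← zpow_add₀ (by norm_num), ← zpow_add₀ (by norm_num)]
  refine neg_one_zpow_congr ?_
  subst hn
  exact ⟨-q, by push_cast; ring⟩

/-- The Jacobi identity of the dot bracket for two elements of total degree one. -/
theorem dotBracket_jacobi {x y : SuperForms m M 𝔤 E} (hx : x ∈ totalDegree m M 𝔤 E 1)
    (hy : y ∈ totalDegree m M 𝔤 E 1) (z : SuperForms m M 𝔤 E) :
    dotBracket x (dotBracket y z) =
      dotBracket (dotBracket x y) z - dotBracket y (dotBracket x z) := by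
  set D : SuperForms m M 𝔤 E →ₗ[ℝ] SuperForms m M 𝔤 E →ₗ[ℝ] SuperForms m M 𝔤 E :=
    dotExt lieFormBracket with hD
  refine eqOn_totalDegree (f := D.flip (D y z))
    (g := D.flip z ∘ₗ D.flip y - D y ∘ₗ D.flip z) (fun p η X q e he hn => ?_) hx
  refine eqOn_totalDegree (f := D (pureForm η X e) ∘ₗ D.flip z)
    (g := D.flip z ∘ₗ D (pureForm η X e) - D.flip (D (pureForm η X e) z))
    (fun p' θ Y q' f hf hn' => ?_) hy
  refine congrArg (fun g => g z) (superForms_hom_ext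
    (f := D (pureForm η X e) ∘ₗ D (pureForm θ Y f))
    (g := D (D (pureForm η X e) (pureForm θ Y f)) - D (pureForm θ Y f) ∘ₗ D (pureForm η X e))
    fun p'' ζ Z q'' g hg => ?_)
  simp only [LinearMap.comp_apply, LinearMap.sub_apply, hD]
  have hef := SetLike.mul_mem_graded he hf
  rw [dotBracket_pureForm η θ X Y he, dotBracket_pureForm θ ζ Y Z hf,
    dotBracket_pureForm η ζ X Z he, map_smul, map_smul, map_smul, LinearMap.smul_apply,
    dotBracket_pureForm η _ X _ he, dotBracket_pureForm θ _ Y _ hf,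
    dotBracket_pureForm _ ζ _ Z hef]
  simp only [pureForm_wedge, ← totalWedge_ofDeg]
  rw [← totalWedge_assoc, ← totalWedge_assoc, totalWedge_comm_ofDeg θ η, map_smul,
    LinearMap.smul_apply, tripleTensor_smul_form, ← mul_assoc f e g,
    E.supercomm q' q f hf e he, smul_mul_assoc, tripleTensor_smul_coeff, ← mul_assoc e f g,
    leibniz_lie X Y Z, tripleTensor_add_lie]
  simp only [smul_smul, smul_add, sub_eq_add_neg, ← neg_smul]
  simp only [← zpow_natCast, ← zpow_add₀ (show (-1 : ℝ) ≠ 0 by norm_num)]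
  congr 2
  · refine neg_one_zpow_congr ?_
    exact ⟨0, by push_cast; ring⟩
  · rw [neg_neg_one_zpow]
    refine neg_one_zpow_congr ?_
    obtain rfl : q = 1 - p := by omega
    obtain rfl : q' = 1 - p' := by omega
    exact ⟨p' - p * p' - 1, by push_cast; ring⟩

/-- By the Jacobi identity, `3 ⟦x; ⟦x; x⟧⟧ = 0` for `x` of total degree one. -/
theorem dotBracket_self_self {x : SuperForms m M 𝔤 E} (hx : x ∈ totalDegree m M 𝔤 E 1) :
    dotBracket x (dotBracket x x) = 0 := by
  have h1 := dotBracket_jacobi hx hx x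
  have h2 := dotBracket_comm (dotBracket_mem_totalDegree hx hx) hx
  rw [show ((-1 : ℝ) ^ (((1 : ℤ) + 1) * 1)) = 1 by norm_num, one_smul] at h2
  rw [h2] at h1
  have h3 : (3 : ℝ) • dotBracket x (dotBracket x x) = 0 := by
    have : (3 : ℝ) • dotBracket x (dotBracket x x) = dotBracket x (dotBracket x x) -
        (-dotBracket x (dotBracket x x) - dotBracket x (dotBracket x x)) := by module
    rw [this, ← h1, sub_self]
  exact (smul_eq_zero.1 h3).resolve_left (by norm_num)

variable [T2Space M] [CompactSpace M] {κ : LinearMap.BilinForm ℝ 𝔤}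

/-- Only elements of complementary form degrees have a nonzero integrated pairing. -/
theorem pairInt_eq_zero {p p' : ℕ} (h : p + p' ≠ m) {x y : SuperForms m M 𝔤 E}
    (hx : x ∈ ofFormDegree m M 𝔤 E p) (hy : y ∈ ofFormDegree m M 𝔤 E p') : pairInt κ x y = 0 := by
  refine eqOn_ofFormDegree
    (f := (superExt ((lieFormPairing κ).compr₂ (totalIntegral m M))).flip y) (g := 0)
    (fun η X q e he => ?_) hx
  refine eqOn_ofFormDegree
    (f := superExt ((lieFormPairing κ).compr₂ (totalIntegral m M)) (pureForm η X e)) (g := 0)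
    (fun θ Y q' f hf => ?_) hy
  rw [superExt_pairing_pureForm, totalWedge_ofDeg, totalIntegral, LinearMap.comp_apply,
    component_ofDeg_of_ne h, map_zero, smul_zero, TensorProduct.zero_tmul]
  rfl

/-- Graded symmetry of the integrated pairing. -/
theorem pairInt_comm (hκ : κ.IsSymm) {p p' : ℕ} {q q' : ℤ} {x y : SuperForms m M 𝔤 E}
    (hx : x ∈ ofBidegree m M 𝔤 E p q) (hy : y ∈ ofBidegree m M 𝔤 E p' q') :
    pairInt κ x y = ((-1 : ℝ) ^ ((p : ℤ) * p' + q * q')) • pairInt κ y x := by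
  set P : SuperForms m M 𝔤 E →ₗ[ℝ] SuperForms m M 𝔤 E →ₗ[ℝ] ℝ ⊗[ℝ] E :=
    superExt ((lieFormPairing κ).compr₂ (totalIntegral m M)) with hP
  refine eqOn_ofBidegree (f := P.flip y)
    (g := ((-1 : ℝ) ^ ((p : ℤ) * p' + q * q')) • P y) (fun η X e he => ?_) hx
  refine eqOn_ofBidegree (f := P (pureForm η X e))
    (g := ((-1 : ℝ) ^ ((p : ℤ) * p' + q * q')) • P.flip (pureForm η X e))
    (fun θ Y f hf => ?_) hy
  simp only [LinearMap.smul_apply, LinearMap.flip_apply, hP, superExt_pairing_pureForm]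
  rw [totalWedge_comm_ofDeg η θ, E.supercomm q q' e he f hf, hκ.eq X Y, map_smul,
    TensorProduct.tmul_smul, smul_comm, ← TensorProduct.smul_tmul', smul_smul,
    zpow_add₀ (by norm_num), mul_comm]
  norm_cast

theorem dotPairInt_comm (hκ : κ.IsSymm) {n n' : ℤ} {x y : SuperForms m M 𝔤 E}
    (hx : x ∈ totalDegree m M 𝔤 E n) (hy : y ∈ totalDegree m M 𝔤 E n') :
    dotPairInt κ x y = ((-1 : ℝ) ^ (n * n')) • dotPairInt κ y x := by
  set b := (lieFormPairing κ).compr₂ (totalIntegral m M) with hb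
  refine eqOn_totalDegree (f := (dotExt b).flip y)
    (g := ((-1 : ℝ) ^ (n * n')) • dotExt b y) (fun p η X q e he hn => ?_) hx
  refine eqOn_totalDegree (f := dotExt b (pureForm η X e))
    (g := ((-1 : ℝ) ^ (n * n')) • (dotExt b).flip (pureForm η X e))
    (fun p' θ Y q' f hf hn' => ?_) hy
  simp only [LinearMap.smul_apply, LinearMap.flip_apply]
  rw [dotExt_pureForm _ η θ X Y he, dotExt_pureForm _ θ η Y X hf]
  have h := pairInt_comm hκ (pureForm_mem_ofBidegree η X he) (pureForm_mem_ofBidegree θ Y hf)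
  rw [pairInt, pairInt, ← hb] at h
  rw [h, smul_smul, smul_smul, ← zpow_add₀ (by norm_num), ← zpow_add₀ (by norm_num)]
  congr 1
  refine neg_one_zpow_congr ?_
  subst hn hn'
  exact ⟨-(q' * p), by ring⟩

/-- Invariance of the pairing under the dot bracket. -/
theorem dotPairInt_dotBracket (hκ : κ.lieInvariant 𝔤) (x y z : SuperForms m M 𝔤 E) :
    dotPairInt κ (dotBracket x y) z = dotPairInt κ x (dotBracket y z) := by
  set D : SuperForms m M 𝔤 E →ₗ[ℝ] SuperForms m M 𝔤 E →ₗ[ℝ] SuperForms m M 𝔤 E :=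
    dotExt lieFormBracket with hD
  set P : SuperForms m M 𝔤 E →ₗ[ℝ] SuperForms m M 𝔤 E →ₗ[ℝ] ℝ ⊗[ℝ] E :=
    dotExt ((lieFormPairing κ).compr₂ (totalIntegral m M)) with hP
  refine congrArg (fun g => g x) (superForms_hom_ext (f := P.flip z ∘ₗ D.flip y)
    (g := P.flip (D y z)) fun p η X q e he => ?_)
  refine congrArg (fun g => g y) (superForms_hom_ext (f := P.flip z ∘ₗ D (pureForm η X e))
    (g := P (pureForm η X e) ∘ₗ D.flip z) fun p' θ Y q' f hf => ?_)
  refine congrArg (fun g => g z) (superForms_hom_ext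
    (f := P (D (pureForm η X e) (pureForm θ Y f)))
    (g := P (pureForm η X e) ∘ₗ D (pureForm θ Y f)) fun p'' ζ Z q'' g hg => ?_)
  have hef := SetLike.mul_mem_graded he hf
  simp only [LinearMap.comp_apply, hD, hP]
  rw [dotBracket_pureForm η θ X Y he, dotBracket_pureForm θ ζ Y Z hf, map_smul, map_smul,
    LinearMap.smul_apply, dotExt_pureForm _ η _ X _ he, dotExt_pureForm _ _ ζ _ Z hef,
    superExt_pairing_pureForm, superExt_pairing_pureForm, smul_smul, smul_smul,
    ← zpow_add₀ (by norm_num), ← zpow_add₀ (by norm_num), ← totalWedge_ofDeg, ← totalWedge_ofDeg,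
    totalWedge_assoc, mul_assoc]
  have hk : κ ⁅X, Y⁆ Z = κ X ⁅Y, Z⁆ := by
    rw [← lie_skew, map_neg, LinearMap.neg_apply, hκ Y X Z, neg_neg]
  rw [hk]
  congr 2
  push_cast; ring

/-- Integration by parts for the dot pairing, from Stokes' theorem. -/
theorem dotPairInt_superD (hM : OrientedCharts m M) {n : ℤ} {x : SuperForms m M 𝔤 E}
    (hx : x ∈ totalDegree m M 𝔤 E n) (y : SuperForms m M 𝔤 E) :
    dotPairInt κ (superD x) y = -(((-1 : ℝ) ^ n) • dotPairInt κ x (superD y)) := by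
  set P : SuperForms m M 𝔤 E →ₗ[ℝ] SuperForms m M 𝔤 E →ₗ[ℝ] ℝ ⊗[ℝ] E :=
    dotExt ((lieFormPairing κ).compr₂ (totalIntegral m M)) with hP
  refine eqOn_totalDegree (f := P.flip y ∘ₗ superD)
    (g := -(((-1 : ℝ) ^ n) • P.flip (superD y))) (fun p η X q e he hn => ?_) hx
  refine congrArg (fun g => g y) (superForms_hom_ext (f := P (superD (pureForm η X e)))
    (g := -(((-1 : ℝ) ^ n) • (P (pureForm η X e) ∘ₗ superD))) fun p' θ Y q' f hf => ?_)
  simp only [LinearMap.comp_apply, LinearMap.neg_apply, LinearMap.smul_apply, superD_pureForm, hP]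
  rw [dotExt_pureForm _ _ θ X Y he, dotExt_pureForm _ η _ X Y he, superExt_pairing_pureForm,
    superExt_pairing_pureForm, ← totalD_ofDeg, ← totalD_ofDeg]
  have h := totalIntegral_totalD hM (totalWedge m M (ofDeg m M p η) (ofDeg m M p' θ))
  rw [totalD_wedge_ofDeg, map_add, map_smul] at h
  rw [eq_neg_of_add_eq_zero_left h]
  simp only [TensorProduct.smul_tmul', smul_eq_mul]
  rw [← TensorProduct.neg_tmul]
  congr 1
  have hs : (-1 : ℝ) ^ (q * (p' : ℤ)) * (-1) ^ p =
      (-1) ^ n * (-1) ^ (q * ((p' + 1 : ℕ) : ℤ)) := by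
    rw [← zpow_natCast, ← zpow_add₀ (by norm_num), ← zpow_add₀ (by norm_num)]
    refine neg_one_zpow_congr ?_
    subst hn
    exact ⟨-q, by push_cast; ring⟩
  linear_combination (-(κ X Y * (totalIntegral m M) (totalWedge m M (ofDeg m M p η)
    (totalD m M (ofDeg m M p' θ))))) * hs

/-- Comparison of the dot pairing with the ordinary one. -/
theorem dotPairInt_eq_pairInt {n : ℤ} {p : ℕ} (hp : p ≤ m) {x y : SuperForms m M 𝔤 E}
    (hx : x ∈ totalDegree m M 𝔤 E n) (hy : y ∈ ofFormDegree m M 𝔤 E p) :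
    dotPairInt κ x y =
      ((-1 : ℝ) ^ ((n - (m - p)) * p)) • pairInt κ (formProj m M 𝔤 E (m - p) x) y := by
  set b := (lieFormPairing κ).compr₂ (totalIntegral m M) with hb
  refine eqOn_totalDegree (f := (dotExt b).flip y)
    (g := ((-1 : ℝ) ^ ((n - (m - p)) * p)) • ((superExt b).flip y ∘ₗ formProj m M 𝔤 E (m - p)))
    (fun p' η X q e he hn => ?_) hx
  simp only [LinearMap.smul_apply, LinearMap.flip_apply, LinearMap.comp_apply, formProj_pureForm]
  rw [dotExt_eq_superExt b (pureForm_mem_ofBidegree η X he) hy]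
  split_ifs with h
  · congr 2
    have : (p' : ℤ) = m - p := by omega
    rw [← this, ← hn]; ring
  · rw [map_zero, LinearMap.zero_apply, smul_zero]
    have := pairInt_eq_zero (κ := κ) (by omega) (pureForm_mem_ofFormDegree η X e) hy
    rw [pairInt, ← hb] at this
    rw [this, smul_zero]

end DotAlgebra

/-! ### The superconnection and the first variation of the action -/

theorem hasDerivAtZero_of_cubic {W : Type*} [AddCommGroup W] [Module ℝ W] {u : ℝ → W}
    (w₀ w₁ w₂ w₃ : W) (h : ∀ t, u t = w₀ + t • w₁ + t ^ 2 • w₂ + t ^ 3 • w₃) :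
    HasDerivAtZero u w₁ := by
  intro ℓ
  have h1 : (fun t => ℓ (u t)) = fun t => ℓ w₀ + t * ℓ w₁ + t ^ 2 * ℓ w₂ + t ^ 3 * ℓ w₃ := by
    funext t
    simp only [h, map_add, map_smul, smul_eq_mul]
  rw [h1]
  have h2 := ((((hasDerivAt_id (0 : ℝ)).mul_const (ℓ w₁)).const_add (ℓ w₀)).add
    ((hasDerivAt_pow 2 (0 : ℝ)).mul_const (ℓ w₂))).add ((hasDerivAt_pow 3 (0 : ℝ)).mul_const (ℓ w₃))
  exact h2.congr_deriv (by simp)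

theorem hasDerivAtZero_of_affine {W : Type*} [AddCommGroup W] [Module ℝ W] {u : ℝ → W}
    (w₀ w₁ : W) (h : ∀ t, u t = w₀ + t • w₁) : HasDerivAtZero u w₁ :=
  hasDerivAtZero_of_cubic w₀ w₁ 0 0 fun t => by rw [h]; simp

section SuperFieldAlgebra

variable {m : ℕ} {M : Type*} [TopologicalSpace M] [ChartedSpace (Coord m) M]
  {𝔤 : Type*} [LieRing 𝔤] [LieAlgebra ℝ 𝔤] {E : GhostAlgebra}

theorem superA_add (x y : Species m → SuperForms m M 𝔤 E) :
    superA (fun s => x s + y s) = superA x + superA y := by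
  simp only [superA, smul_add, Finset.sum_add_distrib]
  abel

theorem superB_add (x y : Species m → SuperForms m M 𝔤 E) :
    superB (fun s => x s + y s) = superB x + superB y := by
  simp only [superB, smul_add, Finset.sum_add_distrib]
  abel

theorem superA_map {E' : GhostAlgebra}
    (f : SuperForms m M 𝔤 E →ₗ[ℝ] SuperForms m M 𝔤 E') (x : Species m → SuperForms m M 𝔤 E) :
    superA (fun s => f (x s)) = f (superA x) := by
  simp only [superA, map_add, map_smul, map_sum]

theorem superB_map {E' : GhostAlgebra}
    (f : SuperForms m M 𝔤 E →ₗ[ℝ] SuperForms m M 𝔤 E') (x : Species m → SuperForms m M 𝔤 E) :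
    superB (fun s => f (x s)) = f (superB x) := by
  simp only [superB, map_add, map_smul, map_sum]

theorem fieldA_add_smul (φ ρ : Config m M 𝔤 E) (t : ℝ) :
    fieldA E (φ + t • ρ) = fieldA E φ + t • fieldA E ρ := by
  have h := superA_map (t • LinearMap.id) ρ.val
  exact (superA_add φ.val fun s => t • ρ.val s).trans (congrArg (_ + ·) h)

theorem fieldB_add_smul (φ ρ : Config m M 𝔤 E) (t : ℝ) :
    fieldB E (φ + t • ρ) = fieldB E φ + t • fieldB E ρ := by
  have h := superB_map (t • LinearMap.id) ρ.val
  exact (superB_add φ.val fun s => t • ρ.val s).trans (congrArg (_ + ·) h)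

theorem fieldA_isNatural : (fieldA : Functional m M 𝔤 (LieForms m M 𝔤)).IsNatural :=
  fun _ _ f φ => superA_map (changeCoeff (LieForms m M 𝔤) f) φ.val

theorem fieldB_isNatural : (fieldB : Functional m M 𝔤 (LieForms m M 𝔤)).IsNatural :=
  fun _ _ f φ => superB_map (changeCoeff (LieForms m M 𝔤) f) φ.val

theorem Config.val_mem_totalDegree (φ : Config m M 𝔤 E) (s : Species m) {n : ℤ}
    (h : (s.deg : ℤ) + s.gh = n) : φ.val s ∈ totalDegree m M 𝔤 E n :=
  ofBidegree_le_totalDegree h (φ s).2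

theorem fieldA_mem (hm : 2 ≤ m) (φ : Config m M 𝔤 E) :
    fieldA E φ ∈ totalDegree m M 𝔤 E 1 := by
  refine add_mem (add_mem (add_mem ?_ ?_) ?_) (Submodule.sum_mem _ fun i _ => ?_)
  · exact Submodule.smul_mem _ _ (φ.val_mem_totalDegree _ rfl)
  · exact φ.val_mem_totalDegree _ rfl
  · refine Submodule.smul_mem _ _ (φ.val_mem_totalDegree _ ?_)
    simp only [Species.deg, Species.gh, FieldName.deg, FieldName.gh]
    omega
  · refine Submodule.smul_mem _ _ (φ.val_mem_totalDegree _ ?_)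
    simp only [Species.deg, Species.gh, FieldName.deg, FieldName.gh]
    omega

theorem fieldB_mem (hm : 2 ≤ m) (φ : Config m M 𝔤 E) :
    fieldB E φ ∈ totalDegree m M 𝔤 E (m - 2) := by
  refine add_mem (add_mem (add_mem (Submodule.sum_mem _ fun i _ => ?_) ?_) ?_) ?_
  · refine Submodule.smul_mem _ _ (φ.val_mem_totalDegree _ ?_)
    simp only [Species.deg, Species.gh, FieldName.deg, FieldName.gh]
    omega
  · refine φ.val_mem_totalDegree _ ?_
    simp only [Species.deg, Species.gh, FieldName.deg, FieldName.gh]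
    omega
  · refine Submodule.smul_mem _ _ (φ.val_mem_totalDegree _ ?_)
    simp only [Species.deg, Species.gh, FieldName.deg, FieldName.gh]
    omega
  · refine φ.val_mem_totalDegree _ ?_
    simp only [Species.deg, Species.gh, FieldName.deg, FieldName.gh]
    omega

theorem constForm_mem (A₀ : DForm m M 1 ⊗[ℝ] 𝔤) :
    (constForm A₀ : SuperForms m M 𝔤 E) ∈ ofBidegree m M 𝔤 E 1 0 :=
  ⟨A₀ ⊗ₜ ⟨1, SetLike.GradedOne.one_mem⟩, rfl⟩

theorem constForm_mem_totalDegree (A₀ : DForm m M 1 ⊗[ℝ] 𝔤) :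
    (constForm A₀ : SuperForms m M 𝔤 E) ∈ totalDegree m M 𝔤 E 1 :=
  ofBidegree_le_totalDegree (by norm_num) (constForm_mem A₀)

theorem changeCoeff_constForm {E' : GhostAlgebra} (f : E.Hom E') (A₀ : DForm m M 1 ⊗[ℝ] 𝔤) :
    changeCoeff (LieForms m M 𝔤) f (constForm A₀) = constForm A₀ := by
  change _ ⊗ₜ f.toAlgHom 1 = _
  rw [map_one]; rfl

variable [IsManifold (𝓡 m) ∞ M]

theorem covD_constForm (A₀ : DForm m M 1 ⊗[ℝ] 𝔤) (x : SuperForms m M 𝔤 E) :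
    covD (constForm A₀) x = superD x + dotBracket (constForm A₀) x := by
  rw [covD, dotBracket, dotExt_of_ghost_zero _ (constForm_mem A₀)]
  rfl

theorem dotBracket_add_left (x y z : SuperForms m M 𝔤 E) :
    dotBracket (x + y) z = dotBracket x z + dotBracket y z := by
  rw [dotBracket, map_add]; rfl

theorem dotBracket_add_right (x y z : SuperForms m M 𝔤 E) :
    dotBracket x (y + z) = dotBracket x y + dotBracket x z := map_add _ _ _

theorem dotBracket_smul_left (c : ℝ) (x y : SuperForms m M 𝔤 E) :
    dotBracket (c • x) y = c • dotBracket x y := by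
  rw [dotBracket, map_smul]; rfl

theorem dotBracket_smul_right (c : ℝ) (x y : SuperForms m M 𝔤 E) :
    dotBracket x (c • y) = c • dotBracket x y := map_smul _ _ _

theorem superBracket_add_left (x y z : SuperForms m M 𝔤 E) :
    superBracket (x + y) z = superBracket x z + superBracket y z := by
  rw [superBracket, map_add]; rfl

theorem superBracket_add_right (x y z : SuperForms m M 𝔤 E) :
    superBracket x (y + z) = superBracket x y + superBracket x z := map_add _ _ _

theorem superBracket_smul_right (c : ℝ) (x y : SuperForms m M 𝔤 E) :
    superBracket x (c • y) = c • superBracket x y := map_smul _ _ _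

theorem dotBracket_comm_one {x y : SuperForms m M 𝔤 E} (hx : x ∈ totalDegree m M 𝔤 E 1)
    (hy : y ∈ totalDegree m M 𝔤 E 1) : dotBracket x y = dotBracket y x := by
  rw [dotBracket_comm hx hy, show ((-1 : ℝ) ^ ((1 : ℤ) * 1)) = -1 by norm_num]
  module

/-- The superconnection `𝖠 = A₀ + 𝖺`. -/
def superConnection (A₀ : DForm m M 1 ⊗[ℝ] 𝔤) (φ : Config m M 𝔤 E) : SuperForms m M 𝔤 E :=
  constForm A₀ + fieldA E φ

theorem superConnection_mem (hm : 2 ≤ m) (A₀ : DForm m M 1 ⊗[ℝ] 𝔤) (φ : Config m M 𝔤 E) :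
    superConnection A₀ φ ∈ totalDegree m M 𝔤 E 1 :=
  add_mem (constForm_mem_totalDegree A₀) (fieldA_mem hm φ)

theorem superCovB_eq (A₀ : DForm m M 1 ⊗[ℝ] 𝔤) (φ : Config m M 𝔤 E) :
    superCovB A₀ E φ = superD (fieldB E φ) + dotBracket (superConnection A₀ φ) (fieldB E φ) := by
  rw [superCovB, covD_constForm, superConnection, dotBracket_add_left]
  abel

theorem superD_constForm {A₀ : DForm m M 1 ⊗[ℝ] 𝔤} (hA₀ : IsFlat A₀) :
    (superD (constForm A₀) : SuperForms m M 𝔤 E) +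
      (1 / 2 : ℝ) • superBracket (constForm A₀) (constForm A₀) = 0 := by
  have h := congrArg (fun u : LieForms m M 𝔤 => (u ⊗ₜ[ℝ] (1 : E) : SuperForms m M 𝔤 E)) hA₀
  simp only [TensorProduct.zero_tmul] at h
  rw [TensorProduct.add_tmul, ← TensorProduct.smul_tmul'] at h
  rw [← h, constForm, superBracket, superExt, TensorProduct.map₂_apply_tmul]
  change _ + (1 / 2 : ℝ) • (_ ⊗ₜ ((1 : E) * 1)) = _
  rw [mul_one]
  rfl

/-- The supercurvature is the curvature of the superconnection, since the background is flat. -/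
theorem superCurvature_eq (hm : 2 ≤ m) {A₀ : DForm m M 1 ⊗[ℝ] 𝔤} (hA₀ : IsFlat A₀)
    (φ : Config m M 𝔤 E) :
    superCurvature A₀ E φ = superD (superConnection A₀ φ) +
      (1 / 2 : ℝ) • dotBracket (superConnection A₀ φ) (superConnection A₀ φ) := by
  have h := superD_constForm (E := E) hA₀
  have h1 : superBracket (constForm A₀ : SuperForms m M 𝔤 E) (constForm A₀) =
      dotBracket (constForm A₀) (constForm A₀) := by
    rw [dotBracket, dotExt_of_ghost_zero _ (constForm_mem A₀)]; rfl
  rw [h1] at h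
  rw [superCurvature, covD_constForm, superConnection, map_add, dotBracket_add_left,
    dotBracket_add_right, dotBracket_add_right,
    dotBracket_comm_one (fieldA_mem hm φ) (constForm_mem_totalDegree A₀)]
  rw [← sub_eq_zero, ← neg_eq_zero, ← h]
  module

theorem superCurvature_mem (hm : 2 ≤ m) {A₀ : DForm m M 1 ⊗[ℝ] 𝔤} (hA₀ : IsFlat A₀)
    (φ : Config m M 𝔤 E) : superCurvature A₀ E φ ∈ totalDegree m M 𝔤 E 2 := by
  have h := superConnection_mem hm A₀ φ
  rw [superCurvature_eq hm hA₀]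
  exact add_mem (mem_totalDegree_of_eq (by norm_num) (superD_mem_totalDegree h))
    (Submodule.smul_mem _ _ (mem_totalDegree_of_eq (by norm_num) (dotBracket_mem_totalDegree h h)))

theorem superCovB_mem (hm : 2 ≤ m) (A₀ : DForm m M 1 ⊗[ℝ] 𝔤) (φ : Config m M 𝔤 E) :
    superCovB A₀ E φ ∈ totalDegree m M 𝔤 E (m - 1) := by
  have h := superConnection_mem hm A₀ φ
  have hB := fieldB_mem hm φ
  rw [superCovB_eq]
  exact add_mem (mem_totalDegree_of_eq (by ring) (superD_mem_totalDegree hB))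
    (mem_totalDegree_of_eq (by ring) (dotBracket_mem_totalDegree h hB))

/-- The Bianchi identity of the superconnection. -/
theorem bianchi (hm : 2 ≤ m) {A₀ : DForm m M 1 ⊗[ℝ] 𝔤} (hA₀ : IsFlat A₀) (φ : Config m M 𝔤 E) :
    superD (superCurvature A₀ E φ) + dotBracket (superConnection A₀ φ) (superCurvature A₀ E φ) =
      0 := by
  have hA := superConnection_mem hm A₀ φ
  rw [superCurvature_eq hm hA₀]
  set A := superConnection A₀ φ
  have h1 := dotBracket_comm (superD_mem_totalDegree hA) hA
  rw [show ((-1 : ℝ) ^ (((1 : ℤ) + 1) * 1)) = 1 by norm_num, one_smul] at h1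
  rw [map_add, superD_superD, map_smul, superD_dotBracket hA, h1, dotBracket_add_right,
    dotBracket_smul_right, dotBracket_self_self hA, zpow_one]
  module

theorem superCurvature_isNatural (A₀ : DForm m M 1 ⊗[ℝ] 𝔤) :
    (superCurvature A₀ : Functional m M 𝔤 (LieForms m M 𝔤)).IsNatural := fun E E' f φ => by
  simp only [superCurvature, covD_constForm, map_add, map_smul]
  rw [fieldA_isNatural, dotBracket, dotBracket, dotBracket, dotBracket, changeCoeff_dotExt,
    changeCoeff_dotExt, changeCoeff_constForm]
  congr 2
  exact (changeCoeff_map f lieFormD _).symm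

theorem superCovB_isNatural (A₀ : DForm m M 1 ⊗[ℝ] 𝔤) :
    (superCovB A₀ : Functional m M 𝔤 (LieForms m M 𝔤)).IsNatural := fun E E' f φ => by
  simp only [superCovB, covD_constForm, map_add]
  rw [fieldA_isNatural, fieldB_isNatural, dotBracket, dotBracket, dotBracket, dotBracket,
    changeCoeff_dotExt, changeCoeff_dotExt, changeCoeff_constForm]
  congr 2
  exact (changeCoeff_map f lieFormD _).symm

variable [T2Space M] [CompactSpace M] {κ : LinearMap.BilinForm ℝ 𝔤}

theorem dotPairInt_add_left (x y z : SuperForms m M 𝔤 E) :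
    dotPairInt κ (x + y) z = dotPairInt κ x z + dotPairInt κ y z := by
  rw [dotPairInt, map_add]; rfl

theorem dotPairInt_add_right (x y z : SuperForms m M 𝔤 E) :
    dotPairInt κ x (y + z) = dotPairInt κ x y + dotPairInt κ x z := map_add _ _ _

theorem dotPairInt_smul_left (c : ℝ) (x y : SuperForms m M 𝔤 E) :
    dotPairInt κ (c • x) y = c • dotPairInt κ x y := by
  rw [dotPairInt, map_smul]; rfl

theorem dotPairInt_smul_right (c : ℝ) (x y : SuperForms m M 𝔤 E) :
    dotPairInt κ x (c • y) = c • dotPairInt κ x y := map_smul _ _ _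

theorem dotPairInt_zero_right (x : SuperForms m M 𝔤 E) : dotPairInt κ x 0 = 0 := map_zero _

/-- Integration by parts for the covariant derivative of the superconnection. -/
theorem dotPairInt_covariant (hM : OrientedCharts m M) (hκ : κ.lieInvariant 𝔤) {n : ℤ}
    {A x : SuperForms m M 𝔤 E} (hA : A ∈ totalDegree m M 𝔤 E 1)
    (hx : x ∈ totalDegree m M 𝔤 E n) (y : SuperForms m M 𝔤 E) :
    dotPairInt κ (superD x + dotBracket A x) y =
      -(((-1 : ℝ) ^ n) • dotPairInt κ x (superD y + dotBracket A y)) := by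
  have hc : dotBracket A x = (-((-1 : ℝ) ^ n)) • dotBracket x A := by
    rw [dotBracket_comm hA hx, one_mul]; module
  rw [dotPairInt_add_left, dotPairInt_add_right, dotPairInt_superD hM hx,
    ← dotPairInt_dotBracket hκ x A y, hc, dotPairInt_smul_left]
  module

/-- The integrated pairing of the supercurvature with `d_𝖠 𝖡` vanishes, by the Bianchi identity. -/
theorem dotPairInt_curvature_covB (hm : 2 ≤ m) (hM : OrientedCharts m M)
    (hκ : κ.lieInvariant 𝔤) {A₀ : DForm m M 1 ⊗[ℝ] 𝔤} (hA₀ : IsFlat A₀) (φ : Config m M 𝔤 E) :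
    dotPairInt κ (superCurvature A₀ E φ) (superCovB A₀ E φ) = 0 := by
  have h := dotPairInt_covariant hM hκ (superConnection_mem hm A₀ φ)
    (superCurvature_mem hm hA₀ φ) (fieldB E φ)
  rw [bianchi hm hA₀, ← superCovB_eq] at h
  have h0 : dotPairInt κ (0 : SuperForms m M 𝔤 E) (fieldB E φ) = 0 := by
    rw [dotPairInt, map_zero]; rfl
  rw [h0] at h
  norm_num at h
  exact h

/-- The right derivative of the action with respect to `𝖺`. -/
def actionRightA (A₀ : DForm m M 1 ⊗[ℝ] 𝔤) : Functional m M 𝔤 (LieForms m M 𝔤) :=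
  fun E φ => ((-1 : ℝ) ^ (m + 1)) • superCovB A₀ E φ

theorem actionRightA_mem (hm : 2 ≤ m) (A₀ : DForm m M 1 ⊗[ℝ] 𝔤) (φ : Config m M 𝔤 E) :
    actionRightA A₀ E φ ∈ totalDegree m M 𝔤 E (m - 1) :=
  Submodule.smul_mem _ _ (superCovB_mem hm A₀ φ)

theorem actionRightA_isNatural (A₀ : DForm m M 1 ⊗[ℝ] 𝔤) :
    (actionRightA A₀ : Functional m M 𝔤 (LieForms m M 𝔤)).IsNatural := fun E E' f φ => by
  rw [actionRightA, actionRightA, superCovB_isNatural, map_smul]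

/-- The first variation of the action. -/
theorem hasDerivAtZero_bvAction (hm : 2 ≤ m) (hM : OrientedCharts m M) (hκs : κ.IsSymm)
    (hκ : κ.lieInvariant 𝔤) {A₀ : DForm m M 1 ⊗[ℝ] 𝔤} (hA₀ : IsFlat A₀) (φ ρ : Config m M 𝔤 E) :
    HasDerivAtZero (fun t : ℝ => bvAction κ A₀ E (φ + t • ρ))
      (dotPairInt κ (superCurvature A₀ E φ) (fieldB E ρ) +
        dotPairInt κ (actionRightA A₀ E φ) (fieldA E ρ)) := by
  set A := superConnection A₀ φ with hA
  have hAm := superConnection_mem hm A₀ φ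
  set D := superD (fieldA E ρ) + dotBracket A (fieldA E ρ) with hD
  set Q := dotBracket (fieldA E ρ) (fieldA E ρ) with hQ
  have hF : ∀ t : ℝ, superCurvature A₀ E (φ + t • ρ) =
      superCurvature A₀ E φ + t • D + (t ^ 2 / 2) • Q := fun t => by
    have hc : superConnection A₀ (φ + t • ρ) = A + t • fieldA E ρ := by
      rw [hA, superConnection, superConnection, fieldA_add_smul, add_assoc]
    rw [superCurvature_eq hm hA₀, superCurvature_eq hm hA₀, hc, map_add, map_smul,
      dotBracket_add_left, dotBracket_add_right, dotBracket_add_right, dotBracket_smul_left,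
      dotBracket_smul_left, dotBracket_smul_right, dotBracket_smul_right,
      dotBracket_comm_one (fieldA_mem hm ρ) hAm, hD]
    module
  have h1 : dotPairInt κ (superCurvature A₀ E φ) (fieldB E ρ) =
      dotPairInt κ (fieldB E ρ) (superCurvature A₀ E φ) := by
    rw [dotPairInt_comm hκs (superCurvature_mem hm hA₀ φ) (fieldB_mem hm ρ),
      (even_two_mul ((m : ℤ) - 2)).neg_one_zpow, one_smul]
  have h2 : dotPairInt κ (actionRightA A₀ E φ) (fieldA E ρ) = dotPairInt κ (fieldB E φ) D := by
    rw [actionRightA, superCovB_eq, dotPairInt_smul_left,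
      dotPairInt_covariant hM hκ hAm (fieldB_mem hm φ), smul_neg, smul_smul, ← neg_smul,
      ← zpow_natCast, ← zpow_add₀ (by norm_num), neg_neg_one_zpow, Even.neg_one_zpow, one_smul]
    exact ⟨m, by push_cast; ring⟩
  rw [h1, h2]
  refine hasDerivAtZero_of_cubic (dotPairInt κ (fieldB E φ) (superCurvature A₀ E φ)) _
    (dotPairInt κ (fieldB E ρ) D + (1 / 2 : ℝ) • dotPairInt κ (fieldB E φ) Q)
    ((1 / 2 : ℝ) • dotPairInt κ (fieldB E ρ) Q) fun t => ?_
  rw [bvAction, hF, fieldB_add_smul]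
  simp only [dotPairInt_add_left, dotPairInt_add_right, dotPairInt_smul_left,
    dotPairInt_smul_right]
  module

theorem isSuperRightDeriv_fieldA (hm : 2 ≤ m) (hM : OrientedCharts m M) (hκs : κ.IsSymm)
    (hκ : κ.lieInvariant 𝔤) {A₀ : DForm m M 1 ⊗[ℝ] 𝔤} (hA₀ : IsFlat A₀) :
    IsSuperRightDeriv κ (fieldA (M := M)) fieldB (bvAction κ A₀) (actionRightA A₀) where
  natural := actionRightA_isNatural A₀
  deriv E φ ρ h := by
    have := hasDerivAtZero_bvAction hm hM hκs hκ hA₀ φ ρ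
    rwa [h, dotPairInt_zero_right, zero_add] at this

theorem isSuperRightDeriv_fieldB (hm : 2 ≤ m) (hM : OrientedCharts m M) (hκs : κ.IsSymm)
    (hκ : κ.lieInvariant 𝔤) {A₀ : DForm m M 1 ⊗[ℝ] 𝔤} (hA₀ : IsFlat A₀) :
    IsSuperRightDeriv κ (fieldB (M := M)) fieldA (bvAction κ A₀) (superCurvature A₀) where
  natural := superCurvature_isNatural A₀
  deriv E φ ρ h := by
    have := hasDerivAtZero_bvAction hm hM hκs hκ hA₀ φ ρ
    rwa [h, dotPairInt_zero_right, add_zero] at this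

end SuperFieldAlgebra

/-! ### The super antibracket -/

section SuperBrackets

variable {m : ℕ} {M : Type*} [TopologicalSpace M] [ChartedSpace (Coord m) M]
  {𝔤 : Type*} [LieRing 𝔤] [LieAlgebra ℝ 𝔤] {E : GhostAlgebra}

theorem lieParity_pureForm {p : ℕ} (η : DForm m M p) (X : 𝔤) (e : E) :
    TensorProduct.map (lieParity m M 𝔤) LinearMap.id (pureForm η X e) =
      ((-1 : ℝ) ^ p) • pureForm η X e := by
  rw [pureForm, TensorProduct.map_tmul, lieParity, TensorProduct.map_tmul, degParity_ofDeg,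
    TensorProduct.smul_tmul', TensorProduct.smul_tmul']
  rfl

theorem lieParity_of_mem {p : ℕ} {x : SuperForms m M 𝔤 E} (hx : x ∈ ofFormDegree m M 𝔤 E p) :
    TensorProduct.map (lieParity m M 𝔤) LinearMap.id x = ((-1 : ℝ) ^ p) • x :=
  eqOn_ofFormDegree (g := ((-1 : ℝ) ^ p) • LinearMap.id)
    (fun η X _ e _ => lieParity_pureForm η X e) hx

theorem dotCoeffMul_pureForm {p : ℕ} {q : ℤ} (ε : E) (η : DForm m M p) (X : 𝔤) (e : E) :
    dotCoeffMul (lieParity m M 𝔤) q ε (pureForm η X e) =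
      ((-1 : ℝ) ^ (q * p)) • pureForm η X (ε * e) := by
  have h := lieParity_pureForm η X (ε * e)
  rw [dotCoeffMul]
  split_ifs with hq
  · rw [(hq.mul_right _).neg_one_zpow, one_smul]
    rfl
  · rw [neg_one_zpow_congr (b := (p : ℤ)), zpow_natCast, ← h]
    · rfl
    · obtain ⟨k, rfl⟩ := Int.not_even_iff_odd.1 hq
      exact ⟨k * p, by ring⟩

variable (m M 𝔤 E) in
/-- The operator `(-1)^{m (n + deg + gh)}`, the identity on elements of total degree `n`. It is the
left derivative of a superfield of total degree `n` with respect to itself: dot linearity with the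
sign `(-1)^{m q}` of the integration forces the factor `(-1)^{m (deg + gh)}`. -/
def degreeTwist (n : ℤ) : SuperForms m M 𝔤 E →ₗ[ℝ] SuperForms m M 𝔤 E :=
  ((-1 : ℝ) ^ (m * n)) • TensorProduct.map (lieParity m M 𝔤 ^ m) (E.ghostParity ^ m)

theorem lieParity_pow_apply {p : ℕ} (η : DForm m M p) (X : 𝔤) (r : ℕ) :
    (lieParity m M 𝔤 ^ r) (ofDeg m M p η ⊗ₜ X) = ((-1 : ℝ) ^ (p * r)) • (ofDeg m M p η ⊗ₜ X) := by
  induction r with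
  | zero => simp
  | succ r ih =>
    rw [pow_succ', Module.End.mul_apply, ih, map_smul, lieParity, TensorProduct.map_tmul,
      degParity_ofDeg, ← TensorProduct.smul_tmul', smul_smul, ← pow_add]
    rfl

theorem degreeTwist_pureForm (n : ℤ) {p : ℕ} {q : ℤ} (η : DForm m M p) (X : 𝔤) {e : E}
    (he : e ∈ E.gr q) : degreeTwist m M 𝔤 E n (pureForm η X e) =
      ((-1 : ℝ) ^ (m * (n + (p + q)))) • pureForm η X e := by
  rw [degreeTwist, LinearMap.smul_apply, pureForm, TensorProduct.map_tmul,
    ghostParity_pow_apply he, lieParity_pow_apply, TensorProduct.tmul_smul,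
    ← TensorProduct.smul_tmul', smul_smul, smul_smul, ← zpow_natCast, ← zpow_add₀ (by norm_num),
    ← zpow_add₀ (by norm_num)]
  congr 2
  push_cast; ring

theorem degreeTwist_of_mem (n : ℤ) {k : ℤ} {x : SuperForms m M 𝔤 E}
    (hx : x ∈ totalDegree m M 𝔤 E k) :
    degreeTwist m M 𝔤 E n x = ((-1 : ℝ) ^ (m * (n + k))) • x :=
  eqOn_totalDegree (g := ((-1 : ℝ) ^ (m * (n + k))) • LinearMap.id) (fun p η X q e he hn => by
    rw [degreeTwist_pureForm n η X he, hn]; rfl) hx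

theorem degreeTwist_self {n : ℤ} {x : SuperForms m M 𝔤 E} (hx : x ∈ totalDegree m M 𝔤 E n) :
    degreeTwist m M 𝔤 E n x = x := by
  rw [degreeTwist_of_mem n hx, Even.neg_one_zpow ⟨m * n, by ring⟩, one_smul]

theorem changeCoeff_degreeTwist {E' : GhostAlgebra} (f : E.Hom E') (n : ℤ)
    (x : SuperForms m M 𝔤 E) : degreeTwist m M 𝔤 E' n (changeCoeff _ f x) =
      changeCoeff _ f (degreeTwist m M 𝔤 E n x) := by
  refine congrArg (fun g => g x) (superForms_hom_ext
    (f := degreeTwist m M 𝔤 E' n ∘ₗ changeCoeff _ f)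
    (g := changeCoeff _ f ∘ₗ degreeTwist m M 𝔤 E n) fun p η X q e he => ?_)
  rw [LinearMap.comp_apply, LinearMap.comp_apply, changeCoeff_pureForm,
    degreeTwist_pureForm n η X he, degreeTwist_pureForm n η X (f.map_gr q e he), map_smul,
    changeCoeff_pureForm]

theorem degreeTwist_dotCoeffMul (n : ℤ) {q : ℤ} {ε : E} (hε : ε ∈ E.gr q)
    (x : SuperForms m M 𝔤 E) :
    degreeTwist m M 𝔤 E n (dotCoeffMul (lieParity m M 𝔤) q ε x) =
      ((-1 : ℝ) ^ (m * q)) • dotCoeffMul (lieParity m M 𝔤) q ε (degreeTwist m M 𝔤 E n x) := by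
  refine congrArg (fun g => g x) (superForms_hom_ext
    (f := degreeTwist m M 𝔤 E n ∘ₗ dotCoeffMul (lieParity m M 𝔤) q ε)
    (g := ((-1 : ℝ) ^ (m * q)) • (dotCoeffMul (lieParity m M 𝔤) q ε ∘ₗ degreeTwist m M 𝔤 E n))
    fun p η X r e he => ?_)
  rw [LinearMap.smul_apply, LinearMap.comp_apply, LinearMap.comp_apply, dotCoeffMul_pureForm,
    map_smul, degreeTwist_pureForm n η X he, map_smul, dotCoeffMul_pureForm,
    degreeTwist_pureForm n η X (SetLike.mul_mem_graded hε he), smul_smul, smul_smul, smul_smul,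
    ← zpow_add₀ (by norm_num), ← zpow_add₀ (by norm_num), ← zpow_add₀ (by norm_num)]
  congr 2
  ring

/-- The left derivative of a superfield with respect to itself. -/
theorem isSuperLeftDeriv_self {n : ℤ} {x : Functional m M 𝔤 (LieForms m M 𝔤)}
    (y : Functional m M 𝔤 (LieForms m M 𝔤))
    (hadd : ∀ (E : GhostAlgebra) (φ ρ : Config m M 𝔤 E) (t : ℝ),
      x E (φ + t • ρ) = x E φ + t • x E ρ)
    (hdeg : ∀ (E : GhostAlgebra) (ρ : Config m M 𝔤 E), x E ρ ∈ totalDegree m M 𝔤 E n) :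
    IsSuperLeftDeriv (lieParity m M 𝔤) x y x fun E _ => degreeTwist m M 𝔤 E n where
  natural _ _ f _ ρ := changeCoeff_degreeTwist f n ρ
  map_coeff _ _ _ _ hε ρ := degreeTwist_dotCoeffMul n hε ρ
  deriv E φ ρ _ := hasDerivAtZero_of_affine (x E φ) _ fun t => by
    rw [hadd, degreeTwist_self (hdeg E ρ)]

/-- The left derivative of a superfield with respect to the other one vanishes. -/
theorem isSuperLeftDeriv_other (x : Functional m M 𝔤 (LieForms m M 𝔤))
    {y : Functional m M 𝔤 (LieForms m M 𝔤)}
    (hadd : ∀ (E : GhostAlgebra) (φ ρ : Config m M 𝔤 E) (t : ℝ),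
      y E (φ + t • ρ) = y E φ + t • y E ρ) :
    IsSuperLeftDeriv (lieParity m M 𝔤) x y y fun _ _ => 0 where
  natural E E' f _ _ := by simp only [LinearMap.zero_apply, map_zero]
  map_coeff _ _ _ _ _ _ := by simp only [LinearMap.zero_apply, map_zero, smul_zero]
  deriv E φ ρ h := hasDerivAtZero_of_affine (y E φ) _ fun t => by rw [hadd, h]; rfl

variable [IsManifold (𝓡 m) ∞ M] [T2Space M] [CompactSpace M] {κ : LinearMap.BilinForm ℝ 𝔤}

/-- The dot pairing is linear over the coefficients up to the sign of the integration. -/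
theorem dotPairInt_dotCoeffMul {q : ℤ} {ε : E} (hε : ε ∈ E.gr q) (x y : SuperForms m M 𝔤 E) :
    dotPairInt κ (dotCoeffMul (lieParity m M 𝔤) q ε x) y =
      ((-1 : ℝ) ^ (m * q)) • dotCoeffMul LinearMap.id q ε (dotPairInt κ x y) := by
  set P : SuperForms m M 𝔤 E →ₗ[ℝ] SuperForms m M 𝔤 E →ₗ[ℝ] ℝ ⊗[ℝ] E :=
    dotExt ((lieFormPairing κ).compr₂ (totalIntegral m M)) with hP
  refine congrArg (fun g => g x) (superForms_hom_ext
    (f := P.flip y ∘ₗ dotCoeffMul (lieParity m M 𝔤) q ε)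
    (g := ((-1 : ℝ) ^ (m * q)) • (dotCoeffMul LinearMap.id q ε ∘ₗ P.flip y))
    fun p η X r e he => ?_)
  refine congrArg (fun g => g y) (superForms_hom_ext
    (f := P (dotCoeffMul (lieParity m M 𝔤) q ε (pureForm η X e)))
    (g := ((-1 : ℝ) ^ (m * q)) • (dotCoeffMul LinearMap.id q ε ∘ₗ P (pureForm η X e)))
    fun p' θ Y r' f hf => ?_)
  simp only [LinearMap.comp_apply, LinearMap.smul_apply, hP]
  rw [dotCoeffMul_pureForm, map_smul, LinearMap.smul_apply,
    dotExt_pureForm _ η θ X Y he, dotExt_pureForm _ η θ X Y (SetLike.mul_mem_graded hε he),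
    superExt_pairing_pureForm, superExt_pairing_pureForm, map_smul, smul_smul, smul_smul,
    ← zpow_add₀ (by norm_num), ← zpow_add₀ (by norm_num), dotCoeffMul, ite_self,
    TensorProduct.map_tmul, LinearMap.id_apply, LinearMap.mulLeft_apply, mul_assoc]
  by_cases h : p + p' = m
  · congr 2
    subst h
    push_cast; ring
  · rw [totalWedge_ofDeg, totalIntegral, LinearMap.comp_apply, component_ofDeg_of_ne h, map_zero,
      smul_zero, TensorProduct.zero_tmul, smul_zero, smul_zero]

/-- The distribution `ρ ↦ ∫_M ⟪ρ; D⟫` attached to a smooth derivative `D`. -/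
def smoothDistribution (κ : LinearMap.BilinForm ℝ 𝔤) (D : Functional m M 𝔤 (LieForms m M 𝔤)) :
    Distribution m M 𝔤 ℝ :=
  fun E φ => (dotExt ((lieFormPairing κ).compr₂ (totalIntegral m M))).flip (D E φ)

theorem smoothDistribution_apply (D : Functional m M 𝔤 (LieForms m M 𝔤)) (φ : Config m M 𝔤 E)
    (ρ : SuperForms m M 𝔤 E) : smoothDistribution κ D E φ ρ = dotPairInt κ ρ (D E φ) := rfl

theorem smoothDistribution_isNatural {D : Functional m M 𝔤 (LieForms m M 𝔤)} (hD : D.IsNatural) :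
    (smoothDistribution κ D).IsNatural := fun E E' f φ ρ => by
  rw [smoothDistribution_apply, smoothDistribution_apply, hD, dotPairInt, dotPairInt,
    changeCoeff_dotExt]

theorem isSuperLeftDeriv_bvAction_fieldA (hm : 2 ≤ m) (hM : OrientedCharts m M) (hκs : κ.IsSymm)
    (hκ : κ.lieInvariant 𝔤) {A₀ : DForm m M 1 ⊗[ℝ] 𝔤} (hA₀ : IsFlat A₀) :
    IsSuperLeftDeriv LinearMap.id (fieldA (M := M)) fieldB (bvAction κ A₀)
      (smoothDistribution κ (superCovB A₀)) where
  natural := smoothDistribution_isNatural (superCovB_isNatural A₀)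
  map_coeff _ _ _ _ hε ρ := dotPairInt_dotCoeffMul hε ρ _
  deriv E φ ρ h := by
    have h1 := (isSuperRightDeriv_fieldA hm hM hκs hκ hA₀).deriv E φ ρ h
    rw [dotPairInt_comm hκs (actionRightA_mem hm A₀ φ) (fieldA_mem hm ρ), actionRightA,
      dotPairInt_smul_right, smul_smul, ← zpow_natCast, ← zpow_add₀ (by norm_num),
      Even.neg_one_zpow ⟨m, by push_cast; ring⟩, one_smul] at h1
    exact h1

theorem isSuperLeftDeriv_bvAction_fieldB (hm : 2 ≤ m) (hM : OrientedCharts m M) (hκs : κ.IsSymm)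
    (hκ : κ.lieInvariant 𝔤) {A₀ : DForm m M 1 ⊗[ℝ] 𝔤} (hA₀ : IsFlat A₀) :
    IsSuperLeftDeriv LinearMap.id (fieldB (M := M)) fieldA (bvAction κ A₀)
      (smoothDistribution κ (superCurvature A₀)) where
  natural := smoothDistribution_isNatural (superCurvature_isNatural A₀)
  map_coeff _ _ _ _ hε ρ := dotPairInt_dotCoeffMul hε ρ _
  deriv E φ ρ h := by
    have h1 := (isSuperRightDeriv_fieldB hm hM hκs hκ hA₀).deriv E φ ρ h
    rw [dotPairInt_comm hκs (superCurvature_mem hm hA₀ φ) (fieldB_mem hm ρ),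
      Even.neg_one_zpow ⟨(m : ℤ) - 2, by ring⟩, one_smul] at h1
    exact h1

theorem isSuperBracket_bvAction_self (hm : 2 ≤ m) (hM : OrientedCharts m M) (hκs : κ.IsSymm)
    (hκ : κ.lieInvariant 𝔤) {A₀ : DForm m M 1 ⊗[ℝ] 𝔤} (hA₀ : IsFlat A₀) :
    IsSuperBracket κ LinearMap.id (bvAction (M := M) κ A₀) (bvAction κ A₀) fun _ _ => 0 := by
  refine ⟨_, _, _, _, isSuperRightDeriv_fieldA hm hM hκs hκ hA₀,
    isSuperRightDeriv_fieldB hm hM hκs hκ hA₀, isSuperLeftDeriv_bvAction_fieldA hm hM hκs hκ hA₀,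
    isSuperLeftDeriv_bvAction_fieldB hm hM hκs hκ hA₀, fun E φ => ?_⟩
  have h := dotPairInt_curvature_covB hm hM hκ hA₀ φ
  rw [smoothDistribution_apply, smoothDistribution_apply, h,
    dotPairInt_comm hκs (actionRightA_mem hm A₀ φ) (superCurvature_mem hm hA₀ φ), actionRightA,
    dotPairInt_smul_right, h, smul_zero, smul_zero, smul_zero, sub_zero]

theorem isSuperBracket_bvAction_fieldA (hm : 2 ≤ m) (hM : OrientedCharts m M) (hκs : κ.IsSymm)
    (hκ : κ.lieInvariant 𝔤) {A₀ : DForm m M 1 ⊗[ℝ] 𝔤} (hA₀ : IsFlat A₀) :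
    IsSuperBracket κ (lieParity m M 𝔤) (bvAction (M := M) κ A₀) fieldA
      fun E φ => ((-1 : ℝ) ^ m) • superCurvature A₀ E φ := by
  refine ⟨_, _, _, _, isSuperRightDeriv_fieldA hm hM hκs hκ hA₀,
    isSuperRightDeriv_fieldB hm hM hκs hκ hA₀,
    isSuperLeftDeriv_self fieldB (fun _ => fieldA_add_smul) (fun _ => fieldA_mem hm),
    isSuperLeftDeriv_other fieldB (fun _ => fieldA_add_smul), fun E φ => ?_⟩
  rw [degreeTwist_of_mem 1 (superCurvature_mem hm hA₀ φ), LinearMap.zero_apply, smul_zero,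
    sub_zero, ← zpow_natCast, neg_one_zpow_congr]
  exact ⟨-(m : ℤ), by ring⟩

theorem isSuperBracket_bvAction_fieldB (hm : 2 ≤ m) (hM : OrientedCharts m M) (hκs : κ.IsSymm)
    (hκ : κ.lieInvariant 𝔤) {A₀ : DForm m M 1 ⊗[ℝ] 𝔤} (hA₀ : IsFlat A₀) :
    IsSuperBracket κ (lieParity m M 𝔤) (bvAction (M := M) κ A₀) fieldB
      fun E φ => ((-1 : ℝ) ^ m) • superCovB A₀ E φ := by
  refine ⟨_, _, _, _, isSuperRightDeriv_fieldA hm hM hκs hκ hA₀,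
    isSuperRightDeriv_fieldB hm hM hκs hκ hA₀,
    isSuperLeftDeriv_other fieldA (fun _ => fieldB_add_smul),
    isSuperLeftDeriv_self fieldA (fun _ => fieldB_add_smul) (fun _ => fieldB_mem hm),
    fun E φ => ?_⟩
  rw [degreeTwist_of_mem _ (actionRightA_mem hm A₀ φ), LinearMap.zero_apply, zero_sub,
    actionRightA, smul_smul, smul_smul, ← neg_smul, ← zpow_natCast, ← zpow_natCast,
    ← zpow_add₀ (by norm_num), ← zpow_add₀ (by norm_num), neg_neg_one_zpow, neg_one_zpow_congr]
  exact ⟨(m : ℤ) - 1 - m * m, by push_cast; ring⟩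

end SuperBrackets

/-! ### Functional derivatives with respect to the component fields -/

section Components

variable {m : ℕ} {M : Type*} [TopologicalSpace M] [ChartedSpace (Coord m) M]
  {𝔤 : Type*} [LieRing 𝔤] [LieAlgebra ℝ 𝔤] {E : GhostAlgebra}

theorem FieldName.deg_le (hm : 2 ≤ m) (i : FieldName m) : i.deg ≤ m := by
  cases i <;> simp only [FieldName.deg] <;> omega

theorem Species.deg_le (hm : 2 ≤ m) (s : Species m) : s.deg ≤ m := by
  cases s with
  | field i => exact i.deg_le hm
  | anti i => exact Nat.sub_le _ _

/-- The coefficient with which a field or antifield enters the superfield `𝖺`. -/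
def coeffA : Species m → ℝ
  | .field .c => (-1) ^ (m + 1)
  | .field .a => 1
  | .anti .B => (-1) ^ m
  | .anti (.tau i) => (-1) ^ (((i : ℕ) + 1) * (i : ℕ) / 2 + m * ((i : ℕ) + 2))
  | _ => 0

/-- The coefficient with which a field or antifield enters the superfield `𝖡`. -/
def coeffB : Species m → ℝ
  | .field (.tau i) => (-1) ^ (((i : ℕ) + 1) * (i : ℕ) / 2)
  | .field .B => 1
  | .anti .a => (-1) ^ m
  | .anti .c => 1
  | _ => 0

theorem deg_add_gh_of_coeffA (hm : 2 ≤ m) {s : Species m} (h : coeffA s ≠ 0) :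
    (s.deg : ℤ) + s.gh = 1 := by
  rcases s with (_ | _ | _ | i) | (_ | _ | _ | i) <;>
    simp only [coeffA, ne_eq, not_true_eq_false] at h <;>
    simp only [Species.deg, Species.gh, FieldName.deg, FieldName.gh] <;> omega

theorem deg_add_gh_of_coeffB (hm : 2 ≤ m) {s : Species m} (h : coeffB s ≠ 0) :
    (s.deg : ℤ) + s.gh = m - 2 := by
  rcases s with (_ | _ | _ | i) | (_ | _ | _ | i) <;>
    simp only [coeffB, ne_eq, not_true_eq_false] at h <;>
    simp only [Species.deg, Species.gh, FieldName.deg, FieldName.gh] <;> omega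

open Classical in
theorem superA_single (s : Species m) (x : SuperForms m M 𝔤 E) :
    superA (fun s' => if s' = s then x else 0) = coeffA s • x := by
  rcases s with (_ | _ | _ | i) | (_ | _ | _ | i) <;> simp [superA, coeffA]

open Classical in
theorem superB_single (s : Species m) (x : SuperForms m M 𝔤 E) :
    superB (fun s' => if s' = s then x else 0) = coeffB s • x := by
  rcases s with (_ | _ | _ | i) | (_ | _ | _ | i) <;> simp [superB, coeffB]

open Classical in
theorem Config.shift_eq (φ : Config m M 𝔤 E) (s : Species m)
    (ρ : ofBidegree m M 𝔤 E s.deg s.gh) (t : ℝ) :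
    φ.shift s ρ t = φ + t • (Pi.single s ρ : Config m M 𝔤 E) := by
  funext s'
  rw [Config.shift]
  by_cases h : s' = s
  · subst h; simp
  · simp [h]

open Classical in
theorem Config.single_val (s : Species m) (ρ : ofBidegree m M 𝔤 E s.deg s.gh) :
    Config.val (Pi.single s ρ : Config m M 𝔤 E) = fun s' =>
      if s' = s then (ρ : SuperForms m M 𝔤 E) else 0 := by
  funext s'
  rw [Config.val]
  split_ifs with h
  · subst h; simp
  · simp [h]

open Classical in
theorem fieldA_single (s : Species m) (ρ : ofBidegree m M 𝔤 E s.deg s.gh) :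
    fieldA E (Pi.single s ρ : Config m M 𝔤 E) = coeffA s • (ρ : SuperForms m M 𝔤 E) := by
  rw [fieldA, Config.single_val, superA_single]

open Classical in
theorem fieldB_single (s : Species m) (ρ : ofBidegree m M 𝔤 E s.deg s.gh) :
    fieldB E (Pi.single s ρ : Config m M 𝔤 E) = coeffB s • (ρ : SuperForms m M 𝔤 E) := by
  rw [fieldB, Config.single_val, superB_single]

theorem changeCoeff_formProj {E' : GhostAlgebra} (f : E.Hom E') (r : ℕ) (x : SuperForms m M 𝔤 E) :
    changeCoeff _ f (formProj m M 𝔤 E r x) = formProj m M 𝔤 E' r (changeCoeff _ f x) :=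
  changeCoeff_map f _ x

theorem coeffMul_pureForm {p : ℕ} (ε : E) (η : DForm m M p) (X : 𝔤) (e : E) :
    coeffMul (LieForms m M 𝔤) ε (pureForm η X e) = pureForm η X (ε * e) := rfl

/-- The extended bilinear operations are left linear over the coefficients. -/
theorem superExt_coeffMul {W : Type*} [AddCommGroup W] [Module ℝ W]
    (b : LieForms m M 𝔤 →ₗ[ℝ] LieForms m M 𝔤 →ₗ[ℝ] W) (ε : E) (x y : SuperForms m M 𝔤 E) :
    superExt b (coeffMul _ ε x) y = coeffMul W ε (superExt b x y) := by
  refine congrArg (fun g => g x) (superForms_hom_ext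
    (f := (superExt b).flip y ∘ₗ coeffMul _ ε)
    (g := coeffMul W ε ∘ₗ (superExt b).flip y) fun p η X q e _ => ?_)
  refine congrArg (fun g => g y) (superForms_hom_ext
    (f := superExt b (coeffMul _ ε (pureForm η X e)))
    (g := coeffMul W ε ∘ₗ superExt b (pureForm η X e)) fun p' θ Y q' f _ => ?_)
  rw [LinearMap.comp_apply, coeffMul_pureForm, superExt_pureForm, superExt_pureForm, mul_assoc]
  rfl

open Classical in
/-- The left derivative of a single field or antifield. -/
theorem isLeftDeriv_fieldComponent (s s' : Species m) :
    IsLeftDeriv (fieldComponent (M := M) (𝔤 := 𝔤) s) s'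
      fun _ _ => if s = s' then LinearMap.id else 0 where
  natural E E' f φ ρ := by
    split_ifs
    · rfl
    · rw [LinearMap.zero_apply, LinearMap.zero_apply, map_zero]
  map_coeff E φ e ρ := by
    split_ifs
    · rfl
    · rw [LinearMap.zero_apply, LinearMap.zero_apply, map_zero]
  deriv E φ ρ := hasDerivAtZero_of_affine (φ.val s) _ fun t => by
    rw [fieldComponent, Config.shift, Config.val]
    split_ifs with h
    · subst h; rw [Function.update_self]; rfl
    · rw [Function.update_of_ne h, LinearMap.zero_apply, smul_zero, add_zero]; rfl

variable [IsManifold (𝓡 m) ∞ M]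

/-- The right derivative of the action with respect to a field or antifield `s`. The sign in the
second summand comes from the comparison of the dot pairing with the ordinary one. -/
def actionRight (A₀ : DForm m M 1 ⊗[ℝ] 𝔤) (s : Species m) :
    Functional m M 𝔤 (LieForms m M 𝔤) := fun E φ =>
  coeffA s • formProj m M 𝔤 E (m - s.deg) (actionRightA A₀ E φ) +
    (coeffB s * (-1) ^ (s.deg * (m + s.deg))) •
      formProj m M 𝔤 E (m - s.deg) (superCurvature A₀ E φ)

theorem actionRight_mem_ofFormDegree (A₀ : DForm m M 1 ⊗[ℝ] 𝔤) (s : Species m)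
    (φ : Config m M 𝔤 E) : actionRight A₀ s E φ ∈ ofFormDegree m M 𝔤 E (m - s.deg) :=
  add_mem (Submodule.smul_mem _ _ (formProj_mem _ _)) (Submodule.smul_mem _ _ (formProj_mem _ _))

theorem smul_mem_of_ne_zero {W : Type*} [AddCommGroup W] [Module ℝ W] {N : Submodule ℝ W} {c : ℝ}
    {x : W} (h : c ≠ 0 → x ∈ N) : c • x ∈ N := by
  rcases eq_or_ne c 0 with rfl | hc
  · rw [zero_smul]; exact N.zero_mem
  · exact N.smul_mem c (h hc)

/-- The component form of the differential `δ_BV = (S, ·)`. -/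
def bvDelta (A₀ : DForm m M 1 ⊗[ℝ] 𝔤) : Species m → Functional m M 𝔤 (LieForms m M 𝔤)
  | .field i => fun E φ => (-((-1) ^ ((m + 1) * i.deg)) : ℝ) • actionRight A₀ (.anti i) E φ
  | .anti i => actionRight A₀ (.field i)

variable [T2Space M] [CompactSpace M] {κ : LinearMap.BilinForm ℝ 𝔤}

theorem actionRight_isNatural (A₀ : DForm m M 1 ⊗[ℝ] 𝔤) (s : Species m) :
    (actionRight A₀ s : Functional m M 𝔤 (LieForms m M 𝔤)).IsNatural := fun E E' f φ => by
  rw [actionRight, actionRight, actionRightA_isNatural, superCurvature_isNatural, map_add,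
    map_smul, map_smul, changeCoeff_formProj, changeCoeff_formProj]

theorem actionRight_mem (hm : 2 ≤ m) {A₀ : DForm m M 1 ⊗[ℝ] 𝔤} (hA₀ : IsFlat A₀) (s : Species m)
    (φ : Config m M 𝔤 E) : actionRight A₀ s E φ ∈ ofBidegree m M 𝔤 E (m - s.deg) (-s.gh) := by
  have hs := s.deg_le hm
  refine add_mem (smul_mem_of_ne_zero fun h => ?_) (smul_mem_of_ne_zero fun h => ?_)
  · refine formProj_mem_ofBidegree ?_ (actionRightA_mem hm A₀ φ)
    have := deg_add_gh_of_coeffA hm h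
    omega
  · refine formProj_mem_ofBidegree ?_ (superCurvature_mem hm hA₀ φ)
    have := deg_add_gh_of_coeffB hm (left_ne_zero_of_mul h)
    omega

theorem pairInt_add_left (x y z : SuperForms m M 𝔤 E) :
    pairInt κ (x + y) z = pairInt κ x z + pairInt κ y z := by
  rw [pairInt, map_add]; rfl

theorem pairInt_smul_left (c : ℝ) (x y : SuperForms m M 𝔤 E) :
    pairInt κ (c • x) y = c • pairInt κ x y := by
  rw [pairInt, map_smul]; rfl

theorem pairInt_smul_right (c : ℝ) (x y : SuperForms m M 𝔤 E) :
    pairInt κ x (c • y) = c • pairInt κ x y := map_smul _ _ _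

theorem isRightDeriv_bvAction (hm : 2 ≤ m) (hM : OrientedCharts m M) (hκs : κ.IsSymm)
    (hκ : κ.lieInvariant 𝔤) {A₀ : DForm m M 1 ⊗[ℝ] 𝔤} (hA₀ : IsFlat A₀) (s : Species m) :
    IsRightDeriv κ (bvAction (M := M) κ A₀) s (actionRight A₀ s) where
  natural := actionRight_isNatural A₀ s
  deg _ φ := actionRight_mem_ofFormDegree A₀ s φ
  deriv E φ ρ := by
    classical
    have hs := s.deg_le hm
    have hρ := ofBidegree_le_ofFormDegree ρ.2
    have h := hasDerivAtZero_bvAction hm hM hκs hκ hA₀ φ (Pi.single s ρ)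
    simp only [← Config.shift_eq] at h
    rw [fieldA_single, fieldB_single, dotPairInt_smul_right, dotPairInt_smul_right,
      dotPairInt_eq_pairInt hs (superCurvature_mem hm hA₀ φ) hρ,
      dotPairInt_eq_pairInt hs (actionRightA_mem hm A₀ φ) hρ,
      Even.neg_one_zpow (n := ((m : ℤ) - 1 - (m - s.deg)) * s.deg), one_smul, smul_smul,
      neg_one_zpow_congr (b := ((s.deg * (m + s.deg) : ℕ) : ℤ)), zpow_natCast, add_comm] at h
    · rw [actionRight, pairInt_add_left, pairInt_smul_left, pairInt_smul_left]
      exact h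
    · exact ⟨s.deg - s.deg * m, by push_cast; ring⟩
    · have := Int.even_mul_pred_self (s.deg : ℤ)
      rwa [show ((m : ℤ) - 1 - (m - s.deg)) * s.deg = s.deg * (s.deg - 1) by ring]

/-- The left derivative of the action with respect to a field or antifield. -/
def actionLeft (κ : LinearMap.BilinForm ℝ 𝔤) (A₀ : DForm m M 1 ⊗[ℝ] 𝔤) (s : Species m) :
    Distribution m M 𝔤 ℝ := fun E φ =>
  ((-1 : ℝ) ^ ((s.deg : ℤ) * (m - s.deg) + s.gh)) •
    (superExt ((lieFormPairing κ).compr₂ (totalIntegral m M))).flip (actionRight A₀ s E φ)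

theorem actionLeft_apply (A₀ : DForm m M 1 ⊗[ℝ] 𝔤) (s : Species m) (φ : Config m M 𝔤 E)
    (ρ : SuperForms m M 𝔤 E) : actionLeft κ A₀ s E φ ρ =
      ((-1 : ℝ) ^ ((s.deg : ℤ) * (m - s.deg) + s.gh)) • pairInt κ ρ (actionRight A₀ s E φ) := rfl

theorem isLeftDeriv_bvAction (hm : 2 ≤ m) (hM : OrientedCharts m M) (hκs : κ.IsSymm)
    (hκ : κ.lieInvariant 𝔤) {A₀ : DForm m M 1 ⊗[ℝ] 𝔤} (hA₀ : IsFlat A₀) (s : Species m) :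
    IsLeftDeriv (bvAction (M := M) κ A₀) s (actionLeft κ A₀ s) where
  natural E E' f φ ρ := by
    rw [actionLeft_apply, actionLeft_apply, actionRight_isNatural, map_smul, pairInt, pairInt,
      changeCoeff_superExt]
  map_coeff E φ e ρ := by
    rw [actionLeft_apply, actionLeft_apply, pairInt, pairInt, superExt_coeffMul, map_smul]
  deriv E φ ρ := by
    have hs := s.deg_le hm
    have h := (isRightDeriv_bvAction hm hM hκs hκ hA₀ s).deriv E φ ρ
    rw [pairInt_comm hκs (actionRight_mem hm hA₀ s φ) ρ.2] at h
    rw [actionLeft_apply, neg_one_zpow_congr (b := ((m - s.deg : ℕ) : ℤ) * s.deg + -s.gh * s.gh)]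
    · exact h
    · obtain ⟨k, hk⟩ := Int.even_mul_succ_self s.gh
      exact ⟨k, by rw [← hk, Nat.cast_sub hs]; ring⟩

theorem isBVBracket_bvAction_fieldComponent (hm : 2 ≤ m) (hM : OrientedCharts m M)
    (hκs : κ.IsSymm) (hκ : κ.lieInvariant 𝔤) {A₀ : DForm m M 1 ⊗[ℝ] 𝔤} (hA₀ : IsFlat A₀)
    (s : Species m) : IsBVBracket κ (bvAction (M := M) κ A₀) (fieldComponent s) (bvDelta A₀ s) := by
  classical
  refine ⟨_, _, isRightDeriv_bvAction hm hM hκs hκ hA₀, isLeftDeriv_fieldComponent s,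
    fun E φ => ?_⟩
  have hite : ∀ (p : Prop) [Decidable p] (x : SuperForms m M 𝔤 E),
      (if p then LinearMap.id else 0 : SuperForms m M 𝔤 E →ₗ[ℝ] SuperForms m M 𝔤 E) x =
        if p then x else 0 := fun p _ x => by split_ifs <;> rfl
  rcases s with (_ | _ | _ | i) | (_ | _ | _ | i) <;>
    simp [FieldName.sum, bvDelta, hite] <;> module

end Components

/-! ### The component master equation and the component differential -/

section MasterEquation

theorem sum_range_split {W : Type*} [AddCommMonoid W] {m : ℕ} (hm : 2 ≤ m) (f : ℕ → W) :
    ∑ r ∈ Finset.range (m + 1), f r = f 0 + f 1 + f 2 + ∑ i : Fin (m - 2), f (i + 3) := by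
  obtain ⟨n, rfl⟩ := Nat.exists_eq_add_of_le hm
  rw [Nat.add_sub_cancel_left, Fin.sum_univ_eq_sum_range (fun i => f (i + 3)),
    show 2 + n + 1 = 3 + n by ring, Finset.sum_range_add]
  simp only [Finset.sum_range_succ, Finset.sum_range_zero, zero_add, add_comm]

theorem neg_one_pow_congr {a b : ℕ} (h : Even ((a : ℤ) - b)) : (-1 : ℝ) ^ a = (-1) ^ b := by
  rw [← zpow_natCast, ← zpow_natCast, neg_one_zpow_congr h]

variable {m : ℕ} {M : Type*} [TopologicalSpace M] [ChartedSpace (Coord m) M]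
  {𝔤 : Type*} [LieRing 𝔤] [LieAlgebra ℝ 𝔤] {E : GhostAlgebra}

/-- The product of the coefficients of a field occurring in `𝖺` and of its antifield. -/
theorem coeffA_field_mul {i : FieldName m} (h : coeffB (.field i) = 0) :
    coeffA (.field i) * coeffB (.anti i) = (-1) ^ (m + i.deg + 1) := by
  rcases i with _ | _ | _ | i
  · simp [coeffA, coeffB, FieldName.deg]
  · simp [coeffA, coeffB, FieldName.deg]; ring
  · simp [coeffB] at h
  · simp [coeffB] at h

/-- The product of the coefficients of a field occurring in `𝖡` and of its antifield. -/
theorem coeffB_field_mul (hm : 2 ≤ m) {i : FieldName m} (h : coeffA (.field i) = 0) :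
    coeffA (.anti i) * coeffB (.field i) = (-1) ^ (m * i.deg) := by
  rcases i with _ | _ | _ | i
  · simp [coeffA] at h
  · simp [coeffA] at h
  · simp only [coeffA, coeffB, mul_one, FieldName.deg]
    refine neg_one_pow_congr ?_
    obtain ⟨k, hk⟩ := Int.even_mul_succ_self (m : ℤ)
    exact ⟨2 * m - k, by push_cast [Nat.cast_sub hm]; linear_combination -hk⟩
  · simp only [coeffA, coeffB, FieldName.deg, ← pow_add]
    refine neg_one_pow_congr ?_
    obtain ⟨k, hk⟩ := Int.even_mul_succ_self (m : ℤ)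
    have hi : (i : ℕ) + 1 ≤ m - 2 := i.2
    generalize ((i : ℕ) + 1) * i / 2 = t
    exact ⟨t + m * (i + 3) - k, by
      push_cast [Nat.cast_sub hi, Nat.cast_sub hm]; linear_combination -hk⟩

variable [IsManifold (𝓡 m) ∞ M]

theorem actionRight_of_coeffB {A₀ : DForm m M 1 ⊗[ℝ] 𝔤} {s : Species m} (h : coeffB s = 0)
    (φ : Config m M 𝔤 E) : actionRight A₀ s E φ =
      (coeffA s * (-1) ^ (m + 1)) • formProj m M 𝔤 E (m - s.deg) (superCovB A₀ E φ) := by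
  rw [actionRight, h, zero_mul, zero_smul, add_zero, actionRightA, map_smul, smul_smul]

theorem actionRight_of_coeffA {A₀ : DForm m M 1 ⊗[ℝ] 𝔤} {s : Species m} (h : coeffA s = 0)
    (φ : Config m M 𝔤 E) : actionRight A₀ s E φ =
      (coeffB s * (-1) ^ (s.deg * (m + s.deg))) •
        formProj m M 𝔤 E (m - s.deg) (superCurvature A₀ E φ) := by
  rw [actionRight, h, zero_smul, zero_add]

theorem bvDelta_field (A₀ : DForm m M 1 ⊗[ℝ] 𝔤) (i : FieldName m) (φ : Config m M 𝔤 E) :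
    bvDelta A₀ (.field i) E φ =
      (-((-1) ^ ((m + 1) * i.deg)) : ℝ) • actionRight A₀ (.anti i) E φ := rfl

theorem bvDelta_field_of_coeffA (hm : 2 ≤ m) (A₀ : DForm m M 1 ⊗[ℝ] 𝔤) {i : FieldName m}
    (h : coeffA (.anti i) = 0) (φ : Config m M 𝔤 E) :
    bvDelta A₀ (.field i) E φ =
      (-coeffB (.anti i)) • formProj m M 𝔤 E i.deg (superCurvature A₀ E φ) := by
  have hi := i.deg_le hm
  have hs : (-1 : ℝ) ^ ((m + 1) * i.deg) * (-1) ^ ((m - i.deg) * (m + (m - i.deg))) = 1 := by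
    rw [← pow_add, neg_one_pow_congr (b := 0), pow_zero]
    obtain ⟨k, hk⟩ := Int.even_mul_succ_self (i.deg : ℤ)
    exact ⟨k + m * m - m * i.deg, by push_cast [Nat.cast_sub hi]; linear_combination hk⟩
  rw [bvDelta_field, actionRight_of_coeffA h, Species.deg, Nat.sub_sub_self hi, smul_smul]
  congr 1
  linear_combination (-coeffB (.anti i)) * hs

theorem bvDelta_field_of_coeffB (hm : 2 ≤ m) (A₀ : DForm m M 1 ⊗[ℝ] 𝔤) {i : FieldName m}
    (h : coeffB (.anti i) = 0) (φ : Config m M 𝔤 E) :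
    bvDelta A₀ (.field i) E φ = (coeffA (.anti i) * (-1) ^ (m * (i.deg + 1) + i.deg)) •
      formProj m M 𝔤 E i.deg (superCovB A₀ E φ) := by
  have hi := i.deg_le hm
  rw [bvDelta_field, actionRight_of_coeffB h, Species.deg, Nat.sub_sub_self hi, smul_smul]
  congr 1
  ring

theorem lieParity_smul_formProj {r : ℕ} {c d : ℝ} (h : c * (-1) ^ r = d) (x : SuperForms m M 𝔤 E) :
    TensorProduct.map (lieParity m M 𝔤) LinearMap.id (c • formProj m M 𝔤 E r x) =
      d • formProj m M 𝔤 E r x := by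
  rw [map_smul, lieParity_of_mem (formProj_mem r x), smul_smul, h]

theorem lieParity_bvDelta_field_of_coeffA (hm : 2 ≤ m) (A₀ : DForm m M 1 ⊗[ℝ] 𝔤)
    {i : FieldName m} (hA : coeffA (.anti i) = 0) (hB : coeffB (.field i) = 0)
    (φ : Config m M 𝔤 E) :
    TensorProduct.map (lieParity m M 𝔤) LinearMap.id
        (coeffA (.field i) • bvDelta A₀ (.field i) E φ) =
      ((-1 : ℝ) ^ m) • formProj m M 𝔤 E i.deg (superCurvature A₀ E φ) := by
  rw [bvDelta_field_of_coeffA hm A₀ hA, smul_smul]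
  refine lieParity_smul_formProj ?_ _
  have h1 : (-1 : ℝ) ^ (m + i.deg + 1) * (-1) ^ i.deg = -(-1) ^ m := by
    rw [← pow_add, show -(-1 : ℝ) ^ m = (-1) ^ (m + 1) by ring]
    exact neg_one_pow_congr ⟨i.deg, by push_cast; ring⟩
  linear_combination (-(-1) ^ i.deg) * coeffA_field_mul hB - h1

theorem lieParity_bvDelta_anti_of_coeffB (hm : 2 ≤ m) (A₀ : DForm m M 1 ⊗[ℝ] 𝔤)
    {i : FieldName m} (hA : coeffA (.field i) = 0) (φ : Config m M 𝔤 E) :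
    TensorProduct.map (lieParity m M 𝔤) LinearMap.id
        (coeffA (.anti i) • bvDelta A₀ (.anti i) E φ) =
      ((-1 : ℝ) ^ m) • formProj m M 𝔤 E (m - i.deg) (superCurvature A₀ E φ) := by
  have hi := i.deg_le hm
  rw [bvDelta, actionRight_of_coeffA hA, smul_smul, ← mul_assoc, coeffB_field_mul hm hA]
  refine lieParity_smul_formProj ?_ _
  rw [Species.deg, ← pow_add, ← pow_add]
  refine neg_one_pow_congr ?_
  obtain ⟨k, hk⟩ := Int.even_mul_pred_self (i.deg : ℤ)
  exact ⟨m * i.deg + k, by push_cast [Nat.cast_sub hi]; linear_combination hk⟩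

theorem lieParity_bvDelta_field_of_coeffB (hm : 2 ≤ m) (A₀ : DForm m M 1 ⊗[ℝ] 𝔤)
    {i : FieldName m} (hA : coeffA (.field i) = 0) (hB : coeffB (.anti i) = 0)
    (φ : Config m M 𝔤 E) :
    TensorProduct.map (lieParity m M 𝔤) LinearMap.id
        (coeffB (.field i) • bvDelta A₀ (.field i) E φ) =
      ((-1 : ℝ) ^ m) • formProj m M 𝔤 E i.deg (superCovB A₀ E φ) := by
  rw [bvDelta_field_of_coeffB hm A₀ hB, smul_smul, ← mul_assoc, mul_comm (coeffB _),
    coeffB_field_mul hm hA]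
  refine lieParity_smul_formProj ?_ _
  rw [← pow_add, ← pow_add]
  refine neg_one_pow_congr ⟨m * i.deg + i.deg, by push_cast; ring⟩

theorem lieParity_bvDelta_anti_of_coeffA (hm : 2 ≤ m) (A₀ : DForm m M 1 ⊗[ℝ] 𝔤)
    {i : FieldName m} (hB : coeffB (.field i) = 0) (φ : Config m M 𝔤 E) :
    TensorProduct.map (lieParity m M 𝔤) LinearMap.id
        (coeffB (.anti i) • bvDelta A₀ (.anti i) E φ) =
      ((-1 : ℝ) ^ m) • formProj m M 𝔤 E (m - i.deg) (superCovB A₀ E φ) := by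
  have hi := i.deg_le hm
  rw [bvDelta, actionRight_of_coeffB hB, smul_smul, ← mul_assoc, mul_comm (coeffB _),
    coeffA_field_mul hB]
  refine lieParity_smul_formProj ?_ _
  rw [Species.deg, ← pow_add, ← pow_add]
  exact neg_one_pow_congr ⟨m + 1, by push_cast [Nat.cast_sub hi]; ring⟩

theorem superA_eq_sum (x : Species m → SuperForms m M 𝔤 E) :
    superA x = coeffA (m := m) (.field .c) • x (.field .c) +
      coeffA (m := m) (.field .a) • x (.field .a) + coeffA (m := m) (.anti .B) • x (.anti .B) +
      ∑ i : Fin (m - 2), coeffA (.anti (.tau i)) • x (.anti (.tau i)) := by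
  simp only [superA, coeffA, one_smul]

theorem superB_eq_sum (x : Species m → SuperForms m M 𝔤 E) :
    superB x = ∑ i : Fin (m - 2), coeffB (.field (.tau i)) • x (.field (.tau i)) +
      coeffB (m := m) (.field .B) • x (.field .B) + coeffB (m := m) (.anti .a) • x (.anti .a) +
      coeffB (m := m) (.anti .c) • x (.anti .c) := by
  simp only [superB, coeffB, one_smul]

/-- The components of `𝖥_𝖠` of form degree `0`, `1`, `2` and `i + 3` are, up to sign and coefficient, the
images under `δ_BV` of `c`, `a`, `B⁺` and the antifields of the ghosts for ghosts. -/
theorem lieParity_superA_bvDelta (hm : 2 ≤ m) (A₀ : DForm m M 1 ⊗[ℝ] 𝔤) (φ : Config m M 𝔤 E) :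
    TensorProduct.map (lieParity m M 𝔤) LinearMap.id (superA fun s => bvDelta A₀ s E φ) =
      ((-1 : ℝ) ^ m) • superCurvature A₀ E φ := by
  rw [superA_eq_sum, map_add, map_add, map_add, map_sum,
    lieParity_bvDelta_field_of_coeffA hm A₀ rfl rfl,
    lieParity_bvDelta_field_of_coeffA hm A₀ rfl rfl, lieParity_bvDelta_anti_of_coeffB hm A₀ rfl,
    Finset.sum_congr rfl fun i _ => lieParity_bvDelta_anti_of_coeffB (i := .tau i) hm A₀ rfl φ,
    ← Finset.smul_sum, ← smul_add, ← smul_add, ← smul_add]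
  conv_rhs => rw [← sum_formProj (superCurvature A₀ E φ), sum_range_split hm]
  congr 2
  · simp only [FieldName.deg, Nat.sub_sub_self hm]
  · refine Finset.sum_congr rfl fun i _ => ?_
    rw [FieldName.deg, show m - (m - 2 - ((i : ℕ) + 1)) = i + 3 by omega]

/-- The components of `d_𝖠 𝖡` of form degree `m`, `m - 1`, `m - 2` and `m - 3 - i` are, up to sign and
coefficient, the images under `δ_BV` of `c⁺`, `a⁺`, `B` and the ghosts for ghosts. -/
theorem lieParity_superB_bvDelta (hm : 2 ≤ m) (A₀ : DForm m M 1 ⊗[ℝ] 𝔤) (φ : Config m M 𝔤 E) :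
    TensorProduct.map (lieParity m M 𝔤) LinearMap.id (superB fun s => bvDelta A₀ s E φ) =
      ((-1 : ℝ) ^ m) • superCovB A₀ E φ := by
  rw [superB_eq_sum, map_add, map_add, map_add, map_sum,
    lieParity_bvDelta_field_of_coeffB hm A₀ rfl rfl,
    lieParity_bvDelta_anti_of_coeffA hm A₀ rfl, lieParity_bvDelta_anti_of_coeffA hm A₀ rfl,
    Finset.sum_congr rfl fun i _ => lieParity_bvDelta_field_of_coeffB (i := .tau i) hm A₀ rfl rfl φ,
    ← Finset.smul_sum, ← smul_add, ← smul_add, ← smul_add]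
  conv_rhs => rw [← sum_formProj (superCovB A₀ E φ), ← Finset.sum_range_reflect,
    sum_range_split hm]
  congr 1
  have h : ∑ i : Fin (m - 2), formProj m M 𝔤 E (FieldName.tau i).deg (superCovB A₀ E φ) =
      ∑ i : Fin (m - 2), formProj m M 𝔤 E (m + 1 - 1 - (i + 3)) (superCovB A₀ E φ) :=
    Finset.sum_congr rfl fun i _ => by
      rw [FieldName.deg, show m - 2 - ((i : ℕ) + 1) = m + 1 - 1 - (i + 3) by omega]
  rw [h, FieldName.deg, FieldName.deg, FieldName.deg, show m + 1 - 1 - 0 = m - 0 by omega,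
    show m + 1 - 1 - 1 = m - 1 by omega, show m + 1 - 1 - 2 = m - 2 by omega]
  abel

variable [T2Space M] [CompactSpace M] {κ : LinearMap.BilinForm ℝ 𝔤}

theorem dotPairInt_of_mem_ofBidegree {r : ℕ} (hr : r ≤ m) {q : ℤ} {x : SuperForms m M 𝔤 E}
    (hx : x ∈ ofBidegree m M 𝔤 E r q) (y : SuperForms m M 𝔤 E) :
    dotPairInt κ x y =
      ((-1 : ℝ) ^ (q * (m - r))) • pairInt κ x (formProj m M 𝔤 E (m - r) y) := by
  set b := (lieFormPairing κ).compr₂ (totalIntegral m M) with hb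
  refine congrArg (fun g => g y) (superForms_hom_ext (f := dotExt b x)
    (g := ((-1 : ℝ) ^ (q * (m - r))) • (superExt b x ∘ₗ formProj m M 𝔤 E (m - r)))
    fun p η X q' e _ => ?_)
  have hy := pureForm_mem_ofFormDegree (M := M) η X e
  rw [dotExt_eq_superExt b hx hy, LinearMap.smul_apply, LinearMap.comp_apply, formProj_pureForm]
  split_ifs with h
  · rw [show (p : ℤ) = m - r by omega]
  · have := pairInt_eq_zero (κ := κ) (by omega) (ofBidegree_le_ofFormDegree hx) hy
    rw [pairInt, ← hb] at this
    rw [this, map_zero, smul_zero, smul_zero]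

/-- The contribution of a field and its antifield to `(S, S)`. -/
theorem actionLeft_actionRight (hm : 2 ≤ m) (hκs : κ.IsSymm) {A₀ : DForm m M 1 ⊗[ℝ] 𝔤}
    (hA₀ : IsFlat A₀) (i : FieldName m) (φ : Config m M 𝔤 E) :
    actionLeft κ A₀ (.anti i) E φ (actionRight A₀ (.field i) E φ) -
        ((-1 : ℝ) ^ ((m + 1) * i.deg)) •
          actionLeft κ A₀ (.field i) E φ (actionRight A₀ (.anti i) E φ) =
      (-(2 * (-1 : ℝ) ^ ((m + 1) * i.deg + i.gh))) •
        pairInt κ (actionRight A₀ (.field i) E φ) (actionRight A₀ (.anti i) E φ) := by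
  have hi := i.deg_le hm
  rw [actionLeft_apply, actionLeft_apply, pairInt_comm hκs (actionRight_mem hm hA₀ (.anti i) φ)
    (actionRight_mem hm hA₀ (.field i) φ), smul_smul, smul_smul, ← zpow_natCast,
    ← zpow_add₀ (by norm_num), ← zpow_add₀ (by norm_num)]
  simp only [Species.deg, Species.gh, Nat.cast_sub hi, Nat.sub_sub_self hi]
  have hsign : ∀ a b c : ℤ, Even (a - (c + 1)) → Even (b - c) →
      (-1 : ℝ) ^ a - (-1) ^ b = -(2 * (-1) ^ c) := fun a b c ha hb => by
    rw [neg_one_zpow_congr ha, neg_one_zpow_congr hb, ← neg_neg_one_zpow]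
    ring
  obtain ⟨k, hk⟩ := Int.even_mul_succ_self (i.deg : ℤ)
  obtain ⟨l, hl⟩ := Int.even_mul_succ_self i.gh
  have hsub : ∀ (a b c : ℝ) (z : ℝ ⊗[ℝ] E), a - b = c → a • z - b • z = c • z := by
    rintro a b _ z rfl
    module
  refine hsub _ _ _ _ (hsign _ _ _ ⟨-k - i.gh - 1, by linear_combination -hk⟩
    ⟨i.deg * (m - i.deg) - l, ?_⟩)
  push_cast
  linear_combination -hl

/-- The contribution of a field and its antifield to `(S, S)` is the contribution of one form
degree to the vanishing integral `∫_M ⟪F; d_𝖠 𝖡⟫`; for the fields occurring in `𝖺` this is the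
degree of the field. -/
theorem actionLeft_actionRight_of_coeffA (hm : 2 ≤ m) (hκs : κ.IsSymm) {A₀ : DForm m M 1 ⊗[ℝ] 𝔤}
    (hA₀ : IsFlat A₀) {i : FieldName m} (hA : coeffA (.anti i) = 0) (hB : coeffB (.field i) = 0)
    (hi1 : (i.deg : ℤ) + i.gh = 1) (φ : Config m M 𝔤 E) :
    actionLeft κ A₀ (.anti i) E φ (actionRight A₀ (.field i) E φ) -
        ((-1 : ℝ) ^ ((m + 1) * i.deg)) •
          actionLeft κ A₀ (.field i) E φ (actionRight A₀ (.anti i) E φ) =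
      (2 : ℝ) • dotPairInt κ (formProj m M 𝔤 E i.deg (superCurvature A₀ E φ))
        (superCovB A₀ E φ) := by
  have hi := i.deg_le hm
  have hF : formProj m M 𝔤 E i.deg (superCurvature A₀ E φ) ∈ ofBidegree m M 𝔤 E i.deg (2 - i.deg) :=
    formProj_mem_ofBidegree (by ring) (superCurvature_mem hm hA₀ φ)
  have hD : formProj m M 𝔤 E (m - i.deg) (superCovB A₀ E φ) ∈
      ofBidegree m M 𝔤 E (m - i.deg) (i.deg - 1) :=
    formProj_mem_ofBidegree (by push_cast [Nat.cast_sub hi]; ring) (superCovB_mem hm A₀ φ)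
  rw [actionLeft_actionRight hm hκs hA₀, actionRight_of_coeffB hB, actionRight_of_coeffA hA,
    pairInt_smul_left, pairInt_smul_right, dotPairInt_of_mem_ofBidegree hi hF]
  simp only [Species.deg, Nat.sub_sub_self hi]
  rw [pairInt_comm hκs hD hF]
  simp only [smul_smul]
  congr 1
  have h1 := coeffA_field_mul hB
  have h2 : (-1 : ℝ) ^ (((m : ℤ) + 1) * i.deg + i.gh) * (-1) ^ (m + 1) *
      (-1) ^ ((m - i.deg) * (m + (m - i.deg))) *
      (-1) ^ (((m - i.deg : ℕ) : ℤ) * i.deg + (i.deg - 1) * (2 - i.deg)) * (-1) ^ (m + i.deg + 1) =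
      -(-1) ^ ((2 - (i.deg : ℤ)) * (m - i.deg)) := by
    simp only [← zpow_natCast]
    rw [← zpow_add₀ (by norm_num), ← zpow_add₀ (by norm_num), ← zpow_add₀ (by norm_num),
      ← zpow_add₀ (by norm_num), neg_neg_one_zpow, show i.gh = 1 - i.deg by omega]
    refine neg_one_zpow_congr ⟨m * m - i.deg * i.deg + 3 * i.deg, ?_⟩
    push_cast [Nat.cast_sub hi]
    ring
  linear_combination (-(2 * (-1 : ℝ) ^ (((m : ℤ) + 1) * i.deg + i.gh) * (-1) ^ (m + 1) *
    (-1) ^ ((m - i.deg) * (m + (m - i.deg))) *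
    (-1) ^ (((m - i.deg : ℕ) : ℤ) * i.deg + (i.deg - 1) * (2 - i.deg)))) * h1 - 2 * h2

/-- For the fields occurring in `𝖡` the contribution is that of the degree of the antifield. -/
theorem actionLeft_actionRight_of_coeffB (hm : 2 ≤ m) (hκs : κ.IsSymm) {A₀ : DForm m M 1 ⊗[ℝ] 𝔤}
    (hA₀ : IsFlat A₀) {i : FieldName m} (hA : coeffA (.field i) = 0) (hB : coeffB (.anti i) = 0)
    (hi1 : (i.deg : ℤ) + i.gh = m - 2) (φ : Config m M 𝔤 E) :
    actionLeft κ A₀ (.anti i) E φ (actionRight A₀ (.field i) E φ) -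
        ((-1 : ℝ) ^ ((m + 1) * i.deg)) •
          actionLeft κ A₀ (.field i) E φ (actionRight A₀ (.anti i) E φ) =
      (2 : ℝ) • dotPairInt κ (formProj m M 𝔤 E (m - i.deg) (superCurvature A₀ E φ))
        (superCovB A₀ E φ) := by
  have hi := i.deg_le hm
  have hF : formProj m M 𝔤 E (m - i.deg) (superCurvature A₀ E φ) ∈
      ofBidegree m M 𝔤 E (m - i.deg) (2 - m + i.deg) :=
    formProj_mem_ofBidegree (by push_cast [Nat.cast_sub hi]; ring) (superCurvature_mem hm hA₀ φ)
  rw [actionLeft_actionRight hm hκs hA₀, actionRight_of_coeffB hB, actionRight_of_coeffA hA,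
    pairInt_smul_left, pairInt_smul_right, dotPairInt_of_mem_ofBidegree (Nat.sub_le _ _) hF]
  simp only [Species.deg, Nat.sub_sub_self hi, smul_smul]
  congr 1
  have h1 := coeffB_field_mul hm hA
  have h2 : (-1 : ℝ) ^ (((m : ℤ) + 1) * i.deg + i.gh) * (-1) ^ (i.deg * (m + i.deg)) *
      (-1) ^ (m + 1) * (-1) ^ (m * i.deg) =
      -(-1) ^ ((2 - m + (i.deg : ℤ)) * (m - (m - i.deg : ℕ))) := by
    simp only [← zpow_natCast]
    rw [← zpow_add₀ (by norm_num), ← zpow_add₀ (by norm_num), ← zpow_add₀ (by norm_num),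
      neg_neg_one_zpow, show i.gh = m - 2 - i.deg by omega]
    refine neg_one_zpow_congr ⟨2 * m * i.deg + m - 1 - i.deg, ?_⟩
    push_cast [Nat.cast_sub hi]
    ring
  linear_combination (-(2 * (-1 : ℝ) ^ (((m : ℤ) + 1) * i.deg + i.gh) *
    (-1) ^ (i.deg * (m + i.deg)) * (-1) ^ (m + 1))) * h1 - 2 * h2

theorem isBVBracket_bvAction_self (hm : 2 ≤ m) (hM : OrientedCharts m M) (hκs : κ.IsSymm)
    (hκ : κ.lieInvariant 𝔤) {A₀ : DForm m M 1 ⊗[ℝ] 𝔤} (hA₀ : IsFlat A₀) :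
    IsBVBracket κ (bvAction (M := M) κ A₀) (bvAction κ A₀) fun _ _ => 0 := by
  refine ⟨_, _, isRightDeriv_bvAction hm hM hκs hκ hA₀, isLeftDeriv_bvAction hm hM hκs hκ hA₀,
    fun E φ => ?_⟩
  set Q : ℕ → ℝ ⊗[ℝ] E := fun r =>
    dotPairInt κ (formProj m M 𝔤 E r (superCurvature A₀ E φ)) (superCovB A₀ E φ) with hQ
  have htau : ∀ i : Fin (m - 2),
      (((m - 2 - ((i : ℕ) + 1) : ℕ) : ℤ) + (((i : ℕ) : ℤ) + 1) = m - 2) := fun i => by omega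
  have hsum : ∑ r ∈ Finset.range (m + 1), Q r = 0 := by
    rw [← dotPairInt_curvature_covB hm hM hκ hA₀ φ]
    conv_rhs => rw [← sum_formProj (superCurvature A₀ E φ), dotPairInt, map_sum,
      LinearMap.sum_apply]
    rfl
  -- `c`, `a`, `B` and the ghosts for ghosts contribute `2 Q r` for `r = 0`, `1`, `2` and `i + 3`.
  rw [FieldName.sum, actionLeft_actionRight_of_coeffA hm hκs hA₀ rfl rfl rfl,
    actionLeft_actionRight_of_coeffA hm hκs hA₀ rfl rfl rfl,
    actionLeft_actionRight_of_coeffB hm hκs hA₀ rfl rfl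
      (by simp only [FieldName.deg, FieldName.gh]; omega),
    Finset.sum_congr rfl fun i _ => actionLeft_actionRight_of_coeffB (i := .tau i) hm hκs hA₀
      rfl rfl (htau i) φ, ← Finset.smul_sum, ← smul_add, ← smul_add, ← smul_add]
  have h : Q 0 + Q 1 + Q 2 + ∑ i : Fin (m - 2), Q (i + 3) = 0 := by rw [← sum_range_split hm, hsum]
  have hB : m - (FieldName.B : FieldName m).deg = 2 := Nat.sub_sub_self hm
  have hT : ∀ i : Fin (m - 2), m - (FieldName.tau i).deg = i + 3 := fun i => by
    simp only [FieldName.deg]; omega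
  simp only [hB, hT]
  exact ((congrArg ((2 : ℝ) • ·) h).trans (smul_zero _)).symm

end MasterEquation

/-! ### The theory without antifields -/

section ClassicalLimit

variable {m : ℕ} {M : Type*} [TopologicalSpace M] [ChartedSpace (Coord m) M]
  {𝔤 : Type*} [LieRing 𝔤] [LieAlgebra ℝ 𝔤] {E : GhostAlgebra}

theorem formProj_eq_ite (r : ℕ) {p : ℕ} {x : SuperForms m M 𝔤 E}
    (hx : x ∈ ofFormDegree m M 𝔤 E p) : formProj m M 𝔤 E r x = if p = r then x else 0 := by
  split_ifs with h
  · subst h; exact formProj_of_mem hx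
  · exact formProj_of_mem_ne h hx

theorem mem_ofFormDegree_of_eq {p p' : ℕ} (h : p = p') {x : SuperForms m M 𝔤 E}
    (hx : x ∈ ofFormDegree m M 𝔤 E p) : x ∈ ofFormDegree m M 𝔤 E p' := h ▸ hx

theorem Config.c_mem (φ : Config m M 𝔤 E) : φ.val (.field .c) ∈ ofBidegree m M 𝔤 E 0 1 :=
  (φ (.field .c)).2

theorem Config.a_mem (φ : Config m M 𝔤 E) : φ.val (.field .a) ∈ ofBidegree m M 𝔤 E 1 0 :=
  (φ (.field .a)).2

theorem Config.B_mem (φ : Config m M 𝔤 E) : φ.val (.field .B) ∈ ofBidegree m M 𝔤 E (m - 2) 0 :=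
  (φ (.field .B)).2

theorem Config.tau_mem (φ : Config m M 𝔤 E) (i : Fin (m - 2)) : φ.val (.field (.tau i)) ∈
    ofBidegree m M 𝔤 E (m - 2 - ((i : ℕ) + 1)) (((i : ℕ) : ℤ) + 1) :=
  (φ (.field (.tau i))).2

/-- The superfield `𝖡` without its antifields has the ghosts for ghosts as components. -/
theorem formProj_fieldB_tau {φ : Config m M 𝔤 E} (h0 : ∀ i, φ (.anti i) = 0) (i : Fin (m - 2)) :
    formProj m M 𝔤 E (m - 2 - ((i : ℕ) + 1)) (fieldB E φ) =
      ((-1 : ℝ) ^ (((i : ℕ) + 1) * (i : ℕ) / 2)) • φ.val (.field (.tau i)) := by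
  have hz : ∀ i, φ.val (.anti i) = 0 := fun i => by rw [Config.val, h0]; rfl
  have hi := i.2
  have hB := formProj_of_mem_ne (r := m - 2 - ((i : ℕ) + 1)) (by omega)
    (ofBidegree_le_ofFormDegree φ.B_mem)
  rw [fieldB, superB, hz, hz, smul_zero, add_zero, add_zero, map_add, hB, add_zero, map_sum,
    Finset.sum_eq_single i]
  · rw [map_smul, formProj_of_mem (ofBidegree_le_ofFormDegree (φ.tau_mem i))]
  · intro j _ hj
    have := j.2
    have hji : (j : ℕ) ≠ i := fun h => hj (Fin.ext h)
    rw [map_smul, formProj_of_mem_ne (by omega) (ofBidegree_le_ofFormDegree (φ.tau_mem j)),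
      smul_zero]
  · intro h; exact absurd (Finset.mem_univ _) h

theorem formProj_fieldB_B {φ : Config m M 𝔤 E} (h0 : ∀ i, φ (.anti i) = 0) :
    formProj m M 𝔤 E (m - 2) (fieldB E φ) = φ.val (.field .B) := by
  have hz : ∀ i, φ.val (.anti i) = 0 := fun i => by rw [Config.val, h0]; rfl
  rw [fieldB, superB, hz, hz, smul_zero, add_zero, add_zero, map_add,
    formProj_of_mem (ofBidegree_le_ofFormDegree φ.B_mem), map_sum, Finset.sum_eq_zero, zero_add]
  intro j _
  have := j.2
  rw [map_smul, formProj_of_mem_ne (by omega) (ofBidegree_le_ofFormDegree (φ.tau_mem j)), smul_zero]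

theorem fieldA_eq {φ : Config m M 𝔤 E} (h0 : ∀ i, φ (.anti i) = 0) :
    fieldA E φ = ((-1 : ℝ) ^ (m + 1)) • φ.val (.field .c) + φ.val (.field .a) := by
  have hz : ∀ i, φ.val (.anti i) = 0 := fun i => by rw [Config.val, h0]; rfl
  rw [fieldA, superA, hz, Finset.sum_eq_zero fun i _ => by rw [hz, smul_zero], smul_zero, add_zero,
    add_zero]

variable [IsManifold (𝓡 m) ∞ M]

theorem covD_add (A x y : SuperForms m M 𝔤 E) : covD A (x + y) = covD A x + covD A y := by
  rw [covD, covD, covD, map_add, superBracket_add_right]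
  abel

theorem covD_smul (A : SuperForms m M 𝔤 E) (c : ℝ) (x : SuperForms m M 𝔤 E) :
    covD A (c • x) = c • covD A x := by
  rw [covD, covD, map_smul, superBracket_smul_right, smul_add]

theorem covD_zero (A : SuperForms m M 𝔤 E) : covD A (0 : SuperForms m M 𝔤 E) = 0 := by
  rw [covD, map_zero, superBracket, map_zero, add_zero]

theorem covD_mem_ofFormDegree {A : SuperForms m M 𝔤 E} (hA : A ∈ ofFormDegree m M 𝔤 E 1) {p : ℕ}
    {x : SuperForms m M 𝔤 E} (hx : x ∈ ofFormDegree m M 𝔤 E p) :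
    covD A x ∈ ofFormDegree m M 𝔤 E (p + 1) := by
  refine add_mem (superD_mem_ofFormDegree hx) ?_
  have := superBracket_mem_ofFormDegree hA hx
  rwa [add_comm 1 p] at this

theorem covD_sum_formProj (A x : SuperForms m M 𝔤 E) :
    covD A x = ∑ r ∈ Finset.range (m + 1), covD A (formProj m M 𝔤 E r x) := by
  simp only [covD, superBracket, Finset.sum_add_distrib, ← map_sum, sum_formProj]

theorem formProj_covD_succ {A : SuperForms m M 𝔤 E} (hA : A ∈ ofFormDegree m M 𝔤 E 1) {r : ℕ}
    (hr : r ≤ m) (x : SuperForms m M 𝔤 E) :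
    formProj m M 𝔤 E (r + 1) (covD A x) = covD A (formProj m M 𝔤 E r x) := by
  rw [covD_sum_formProj, map_sum, Finset.sum_eq_single r]
  · exact formProj_of_mem (covD_mem_ofFormDegree hA (formProj_mem r x))
  · intro b _ hb
    exact formProj_of_mem_ne (by omega) (covD_mem_ofFormDegree hA (formProj_mem b x))
  · intro h; exact absurd (Finset.mem_range.2 (by omega)) h

theorem formProj_covD_zero {A : SuperForms m M 𝔤 E} (hA : A ∈ ofFormDegree m M 𝔤 E 1)
    (x : SuperForms m M 𝔤 E) : formProj m M 𝔤 E 0 (covD A x) = 0 := by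
  rw [covD_sum_formProj, map_sum, Finset.sum_eq_zero]
  intro b _
  exact formProj_of_mem_ne (by omega) (covD_mem_ofFormDegree hA (formProj_mem b x))

theorem dotBracket_eq_superBracket {p p' : ℕ} {q : ℤ} {x y : SuperForms m M 𝔤 E}
    (hx : x ∈ ofBidegree m M 𝔤 E p q) (hy : y ∈ ofFormDegree m M 𝔤 E p') :
    dotBracket x y = ((-1 : ℝ) ^ (q * p')) • superBracket x y := dotExt_eq_superExt _ hx hy

theorem formProj_dotBracket {q : ℤ} {c : SuperForms m M 𝔤 E} (hc : c ∈ ofBidegree m M 𝔤 E 0 q)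
    {r : ℕ} (hr : r ≤ m) (x : SuperForms m M 𝔤 E) :
    formProj m M 𝔤 E r (dotBracket c x) =
      ((-1 : ℝ) ^ (q * r)) • superBracket c (formProj m M 𝔤 E r x) := by
  have h : dotBracket c x =
      ∑ r ∈ Finset.range (m + 1), dotBracket c (formProj m M 𝔤 E r x) := by
    simp only [dotBracket, ← map_sum, sum_formProj]
  have hmem : ∀ b, superBracket c (formProj m M 𝔤 E b x) ∈ ofFormDegree m M 𝔤 E b := fun b => by
    have := superBracket_mem_ofFormDegree (ofBidegree_le_ofFormDegree hc) (formProj_mem b x)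
    rwa [zero_add] at this
  rw [h, map_sum, Finset.sum_eq_single r]
  · rw [dotBracket_eq_superBracket hc (formProj_mem r x), map_smul, formProj_of_mem (hmem r)]
  · intro b _ hb
    rw [dotBracket_eq_superBracket hc (formProj_mem b x), map_smul, formProj_of_mem_ne hb (hmem b),
      smul_zero]
  · intro h; exact absurd (Finset.mem_range.2 (by omega)) h

theorem superConnection_classical_mem (A₀ : DForm m M 1 ⊗[ℝ] 𝔤) (φ : Config m M 𝔤 E) :
    constForm A₀ + φ.val (.field .a) ∈ ofFormDegree m M 𝔤 E 1 :=
  add_mem (ofBidegree_le_ofFormDegree (constForm_mem A₀)) (ofBidegree_le_ofFormDegree φ.a_mem)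

/-- Without antifields `d_𝖠` is the sum of the covariant derivative of the classical connection and
of the bracket with the ghost. -/
theorem superCovB_classical {A₀ : DForm m M 1 ⊗[ℝ] 𝔤} {φ : Config m M 𝔤 E}
    (h0 : ∀ i, φ (.anti i) = 0) : superCovB A₀ E φ =
      covD (constForm A₀ + φ.val (.field .a)) (fieldB E φ) +
        ((-1 : ℝ) ^ (m + 1)) • dotBracket (φ.val (.field .c)) (fieldB E φ) := by
  have ha := φ.a_mem
  rw [superCovB, covD, covD, fieldA_eq h0, dotBracket_add_left, dotBracket_smul_left,
    superBracket_add_left]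
  have h : dotBracket (φ.val (.field .a)) (fieldB E φ) =
      superBracket (φ.val (.field .a)) (fieldB E φ) := dotExt_of_ghost_zero _ ha _
  rw [h]
  abel

/-- The components of the supercurvature without antifields. -/
theorem superCurvature_classical {A₀ : DForm m M 1 ⊗[ℝ] 𝔤} {φ : Config m M 𝔤 E}
    (h0 : ∀ i, φ (.anti i) = 0) : superCurvature A₀ E φ =
      (1 / 2 : ℝ) • superBracket (φ.val (.field .c)) (φ.val (.field .c)) +
      ((-1 : ℝ) ^ (m + 1)) • covD (constForm A₀ + φ.val (.field .a)) (φ.val (.field .c)) +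
      (covD (constForm A₀) (φ.val (.field .a)) +
        (1 / 2 : ℝ) • superBracket (φ.val (.field .a)) (φ.val (.field .a))) := by
  have ha := φ.a_mem
  have hc := φ.c_mem
  have haT := ofBidegree_le_totalDegree (n := 1) (by norm_num) ha
  have hcT := ofBidegree_le_totalDegree (n := 1) (by norm_num) hc
  have h : ∀ x, dotBracket (φ.val (.field .a)) x = superBracket (φ.val (.field .a)) x :=
    fun x => dotExt_of_ghost_zero _ ha x
  have hcc := dotBracket_eq_superBracket hc (ofBidegree_le_ofFormDegree hc)
  rw [Nat.cast_zero, mul_zero, zpow_zero, one_smul] at hcc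
  have hs : ((-1 : ℝ) ^ (m + 1)) * (-1) ^ (m + 1) = 1 := by
    rw [← mul_pow]; norm_num
  rw [superCurvature, fieldA_eq h0, covD_add, covD_smul, dotBracket_add_left, dotBracket_add_right,
    dotBracket_add_right, dotBracket_smul_left, dotBracket_smul_left, dotBracket_smul_right,
    dotBracket_smul_right, smul_smul, hs, one_smul, dotBracket_comm_one hcT haT, h, h, hcc,
    covD, covD, covD, superBracket_add_left]
  module

theorem formProj_superCurvature_classical {A₀ : DForm m M 1 ⊗[ℝ] 𝔤} {φ : Config m M 𝔤 E}
    (h0 : ∀ i, φ (.anti i) = 0) (r : ℕ) : formProj m M 𝔤 E r (superCurvature A₀ E φ) =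
      (if 0 = r then (1 / 2 : ℝ) • superBracket (φ.val (.field .c)) (φ.val (.field .c)) else 0) +
      (if 1 = r then ((-1 : ℝ) ^ (m + 1)) •
        covD (constForm A₀ + φ.val (.field .a)) (φ.val (.field .c)) else 0) +
      (if 2 = r then covD (constForm A₀) (φ.val (.field .a)) +
        (1 / 2 : ℝ) • superBracket (φ.val (.field .a)) (φ.val (.field .a)) else 0) := by
  have ha := ofBidegree_le_ofFormDegree φ.a_mem
  have hc := ofBidegree_le_ofFormDegree φ.c_mem
  have hcc := mem_ofFormDegree_of_eq (zero_add 0) (superBracket_mem_ofFormDegree hc hc)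
  have hac := mem_ofFormDegree_of_eq (zero_add 1)
    (covD_mem_ofFormDegree (superConnection_classical_mem A₀ φ) hc)
  have hda := mem_ofFormDegree_of_eq one_add_one_eq_two
    (covD_mem_ofFormDegree (ofBidegree_le_ofFormDegree (constForm_mem A₀)) ha)
  have haa := mem_ofFormDegree_of_eq one_add_one_eq_two (superBracket_mem_ofFormDegree ha ha)
  rw [superCurvature_classical h0, map_add, map_add,
    formProj_eq_ite r (Submodule.smul_mem _ _ hcc), formProj_eq_ite r (Submodule.smul_mem _ _ hac),
    formProj_eq_ite r (add_mem hda (Submodule.smul_mem _ _ haa))]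

theorem formProj_covD_fieldB {A₀ : DForm m M 1 ⊗[ℝ] 𝔤} {φ : Config m M 𝔤 E}
    (h0 : ∀ i, φ (.anti i) = 0) {k : ℕ} (hk : k ≤ m - 2) :
    formProj m M 𝔤 E (m - 2 - k) (covD (constForm A₀ + φ.val (.field .a)) (fieldB E φ)) =
      ((-1 : ℝ) ^ ((k + 1) * k / 2)) •
        covD (constForm A₀ + φ.val (.field .a)) (nextTau φ k) := by
  have hA := superConnection_classical_mem A₀ φ
  rw [nextTau]
  split_ifs with h
  · rw [show m - 2 - k = m - 2 - (k + 1) + 1 by omega, formProj_covD_succ hA (by omega),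
      formProj_fieldB_tau h0 ⟨k, h⟩, covD_smul]
  · rw [show m - 2 - k = 0 by omega, formProj_covD_zero hA, covD_zero, smul_zero]

theorem superBracket_ghost_comm {c x : SuperForms m M 𝔤 E} (hc : c ∈ ofBidegree m M 𝔤 E 0 1)
    {p : ℕ} {q : ℤ} (hx : x ∈ ofBidegree m M 𝔤 E p q) :
    superBracket c x = ((-1 : ℝ) ^ (q + 1)) • superBracket x c := by
  rw [superBracket_comm hc hx, ← neg_neg_one_zpow]
  simp only [Nat.cast_zero, zero_mul, zero_add, one_mul]
  module

/-- Without antifields `δ_BV` is the BRST operator on the fields. -/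
theorem bvDelta_eq_brst (hm : 2 ≤ m) (A₀ : DForm m M 1 ⊗[ℝ] 𝔤) {φ : Config m M 𝔤 E}
    (h0 : ∀ i, φ (.anti i) = 0) (i : FieldName m) : bvDelta A₀ (.field i) E φ = brst A₀ φ i := by
  have hc := φ.c_mem
  rcases i with _ | _ | _ | i
  · rw [bvDelta_field_of_coeffA hm A₀ rfl, formProj_superCurvature_classical h0]
    simp [FieldName.deg, coeffB, brst]
    module
  · rw [bvDelta_field_of_coeffA hm A₀ rfl, formProj_superCurvature_classical h0]
    simp [FieldName.deg, coeffB, brst, smul_smul, ← pow_add]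
  · have h1 := formProj_covD_fieldB (A₀ := A₀) h0 (k := 0) (Nat.zero_le _)
    rw [Nat.sub_zero, Nat.mul_zero, Nat.zero_div, pow_zero, one_smul] at h1
    have h2 : (-1 : ℝ) ^ m * (-1) ^ (m * (m - 2 + 1) + (m - 2)) = 1 := by
      obtain ⟨k, hk⟩ := Int.even_mul_succ_self (m : ℤ)
      rw [← pow_add, neg_one_pow_congr (b := 0), pow_zero]
      exact ⟨k - 1, by push_cast [Nat.cast_sub hm]; linear_combination hk⟩
    have h3 : (-1 : ℝ) ^ (m + 1) * (-1) ^ (1 * ((m - 2 : ℕ) : ℤ)) * (-1) ^ ((0 : ℤ) + 1) = 1 := by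
      rw [← zpow_natCast, ← zpow_add₀ (by norm_num), ← zpow_add₀ (by norm_num),
        Even.neg_one_zpow ⟨m, by push_cast [Nat.cast_sub hm]; ring⟩]
    rw [bvDelta_field_of_coeffB hm A₀ rfl, superCovB_classical h0, map_add, map_smul,
      FieldName.deg, h1, formProj_dotBracket hc (by omega), formProj_fieldB_B h0,
      superBracket_ghost_comm hc φ.B_mem, smul_smul, smul_smul, h3, coeffA, h2, one_smul, one_smul,
      add_comm]
    rfl
  · have hi : (i : ℕ) + 1 ≤ m - 2 := i.2
    -- The binomial coefficients in the coefficients of `τ_k` and `τ_{k+1}` differ by `k`.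
    have hk : ((i : ℕ) + 1 + 1) * ((i : ℕ) + 1) / 2 = ((i : ℕ) + 1) * (i : ℕ) / 2 + (i + 1) :=
      Nat.triangle_succ (i + 1)
    have h2 : (-1 : ℝ) ^ (((i : ℕ) + 1) * (i : ℕ) / 2 + m * ((i : ℕ) + 2)) *
        (-1) ^ (m * (m - 2 - ((i : ℕ) + 1) + 1) + (m - 2 - ((i : ℕ) + 1))) *
        (-1) ^ (((i : ℕ) + 1 + 1) * ((i : ℕ) + 1) / 2) = 1 := by
      obtain ⟨k, h⟩ := Int.even_mul_succ_self (m : ℤ)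
      rw [hk, ← pow_add, ← pow_add, neg_one_pow_congr (b := 0), pow_zero]
      generalize ((i : ℕ) + 1) * (i : ℕ) / 2 = t
      exact ⟨k + t - 1, by push_cast [Nat.cast_sub hi, Nat.cast_sub hm]; linear_combination h⟩
    have h3 : (-1 : ℝ) ^ (((i : ℕ) + 1) * (i : ℕ) / 2 + m * ((i : ℕ) + 2)) *
        (-1) ^ (m * (m - 2 - ((i : ℕ) + 1) + 1) + (m - 2 - ((i : ℕ) + 1))) *
        (-1) ^ (m + 1) * (-1) ^ (1 * ((m - 2 - ((i : ℕ) + 1) : ℕ) : ℤ)) *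
        (-1) ^ (((i : ℕ) + 1) * (i : ℕ) / 2) * (-1) ^ (((i : ℕ) : ℤ) + 1 + 1) =
        (-1) ^ ((i : ℕ) + 1) := by
      obtain ⟨k, h⟩ := Int.even_mul_succ_self (m : ℤ)
      generalize ((i : ℕ) + 1) * (i : ℕ) / 2 = t
      simp only [← zpow_natCast, ← zpow_add₀ (show (-1 : ℝ) ≠ 0 by norm_num)]
      refine neg_one_zpow_congr ⟨k + t + m - 2 - i, ?_⟩
      push_cast [Nat.cast_sub hi, Nat.cast_sub hm]
      linear_combination h
    rw [bvDelta_field_of_coeffB hm A₀ rfl, superCovB_classical h0, map_add, map_smul,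
      FieldName.deg, formProj_covD_fieldB h0 hi, formProj_dotBracket hc (by omega),
      formProj_fieldB_tau h0, superBracket_smul_right, superBracket_ghost_comm hc (φ.tau_mem i),
      smul_add, smul_smul, smul_smul, smul_smul, smul_smul, smul_smul, coeffA, h2, h3, one_smul,
      add_comm]
    rfl

/-- The curvature of `A₀ + a` for a flat background `A₀`. -/
theorem curvature_classical {A₀ : DForm m M 1 ⊗[ℝ] 𝔤} (hA₀ : IsFlat A₀) (φ : Config m M 𝔤 E) :
    curvature (constForm A₀ + φ.val (.field .a)) = covD (constForm A₀) (φ.val (.field .a)) +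
      (1 / 2 : ℝ) • superBracket (φ.val (.field .a)) (φ.val (.field .a)) := by
  have ha := φ.a_mem
  have h := superBracket_comm ha (constForm_mem A₀)
  norm_num at h
  have h1 := superD_constForm (E := E) hA₀
  rw [curvature, map_add, superBracket_add_left, superBracket_add_right, superBracket_add_right, h,
    covD, ← sub_eq_zero, ← h1]
  module

variable [T2Space M] [CompactSpace M] {κ : LinearMap.BilinForm ℝ 𝔤}

/-- Without antifields the action is the classical `BF` action: the ghosts for ghosts would have to
be paired with components of the supercurvature of form degree at least three. -/
theorem bvAction_classical (hm : 2 ≤ m) {A₀ : DForm m M 1 ⊗[ℝ] 𝔤} (hA₀ : IsFlat A₀)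
    {φ : Config m M 𝔤 E} (h0 : ∀ i, φ (.anti i) = 0) : bvAction κ A₀ E φ =
      classicalAction κ (constForm A₀ + φ.val (.field .a)) (φ.val (.field .B)) := by
  have hz : ∀ i, φ.val (.anti i) = 0 := fun i => by rw [Config.val, h0]; rfl
  have hsum : dotPairInt κ (∑ i : Fin (m - 2), ((-1 : ℝ) ^ (((i : ℕ) + 1) * (i : ℕ) / 2)) •
      φ.val (.field (.tau i))) (superCurvature A₀ E φ) = 0 := by
    rw [dotPairInt, map_sum, LinearMap.sum_apply]
    refine Finset.sum_eq_zero fun i _ => ?_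
    have := i.2
    change dotPairInt κ _ _ = 0
    rw [dotPairInt_smul_left, dotPairInt_of_mem_ofBidegree (by omega) (φ.tau_mem i),
      formProj_superCurvature_classical h0, if_neg (by omega), if_neg (by omega),
      if_neg (by omega), add_zero, add_zero, pairInt, map_zero, smul_zero, smul_zero]
  rw [bvAction, fieldB, superB, hz, hz, smul_zero, add_zero, add_zero, dotPairInt_add_left, hsum,
    zero_add, dotPairInt_of_mem_ofBidegree (by omega) φ.B_mem, zero_mul, zpow_zero, one_smul,
    formProj_superCurvature_classical h0, if_neg (by omega), if_neg (by omega),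
    if_pos (by omega), zero_add, zero_add, classicalAction, curvature_classical hA₀]

end ClassicalLimit

end BFTheory

end

theorem theorem6p2 {m : ℕ} (hm : 2 ≤ m)
    {M : Type*} [TopologicalSpace M] [ChartedSpace (BFTheory.Coord m) M]
    [IsManifold (𝓡 m) ∞ M] [T2Space M] [CompactSpace M] (hM : BFTheory.OrientedCharts m M)
    {𝔤 : Type*} [LieRing 𝔤] [LieAlgebra ℝ 𝔤] [Module.Finite ℝ 𝔤]
    (κ : LinearMap.BilinForm ℝ 𝔤) (hκ_symm : κ.IsSymm) (hκ_inv : κ.lieInvariant 𝔤)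
    (hκ_nondeg : κ.Nondegenerate)
    (A₀ : BFTheory.DForm m M 1 ⊗[ℝ] 𝔤) (hA₀ : BFTheory.IsFlat A₀) :
    BFTheory.IsBVBracket κ (BFTheory.bvAction κ A₀) (BFTheory.bvAction κ A₀) (fun _ _ => 0) ∧
    BFTheory.IsSuperBracket κ LinearMap.id (BFTheory.bvAction κ A₀) (BFTheory.bvAction κ A₀)
      (fun _ _ => 0) ∧
    (∀ (E : BFTheory.GhostAlgebra) (φ : BFTheory.Config m M 𝔤 E), (∀ i, φ (.anti i) = 0) →
      BFTheory.bvAction κ A₀ E φ =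
        BFTheory.classicalAction κ (BFTheory.constForm A₀ + φ.val (.field .a))
          (φ.val (.field .B))) ∧
    BFTheory.IsSuperBracket κ (BFTheory.lieParity m M 𝔤) (BFTheory.bvAction κ A₀)
      BFTheory.fieldA (fun E φ => ((-1 : ℝ) ^ m) • BFTheory.superCurvature A₀ E φ) ∧
    BFTheory.IsSuperBracket κ (BFTheory.lieParity m M 𝔤) (BFTheory.bvAction κ A₀)
      BFTheory.fieldB (fun E φ => ((-1 : ℝ) ^ m) • BFTheory.superCovB A₀ E φ) ∧
    ∃ δ : BFTheory.Species m → BFTheory.Functional m M 𝔤 (BFTheory.LieForms m M 𝔤),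
      (∀ s, BFTheory.IsBVBracket κ (BFTheory.bvAction κ A₀) (BFTheory.fieldComponent s) (δ s)) ∧
      (∀ (E : BFTheory.GhostAlgebra) (φ : BFTheory.Config m M 𝔤 E),
        TensorProduct.map (BFTheory.lieParity m M 𝔤) LinearMap.id
            (BFTheory.superA fun s => δ s E φ) =
          ((-1 : ℝ) ^ m) • BFTheory.superCurvature A₀ E φ ∧
        TensorProduct.map (BFTheory.lieParity m M 𝔤) LinearMap.id
            (BFTheory.superB fun s => δ s E φ) =
          ((-1 : ℝ) ^ m) • BFTheory.superCovB A₀ E φ) ∧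
      ∀ (E : BFTheory.GhostAlgebra) (φ : BFTheory.Config m M 𝔤 E), (∀ i, φ (.anti i) = 0) →
        ∀ i : BFTheory.FieldName m, δ (.field i) E φ = BFTheory.brst A₀ φ i :=
  ⟨BFTheory.isBVBracket_bvAction_self hm hM hκ_symm hκ_inv hA₀,
    BFTheory.isSuperBracket_bvAction_self hm hM hκ_symm hκ_inv hA₀,
    fun _ _ h0 => BFTheory.bvAction_classical hm hA₀ h0,
    BFTheory.isSuperBracket_bvAction_fieldA hm hM hκ_symm hκ_inv hA₀,
    BFTheory.isSuperBracket_bvAction_fieldB hm hM hκ_symm hκ_inv hA₀,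
    BFTheory.bvDelta A₀,
    BFTheory.isBVBracket_bvAction_fieldComponent hm hM hκ_symm hκ_inv hA₀,
    fun _ φ => ⟨BFTheory.lieParity_superA_bvDelta hm A₀ φ,
      BFTheory.lieParity_superB_bvDelta hm A₀ φ⟩,
    fun _ _ h0 i => BFTheory.bvDelta_eq_brst hm A₀ h0 i⟩
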